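/- Let $M=(M_0,\mathcal O_M)$ be a real smooth supermanifold of dimension $(p,q)$: $M_0$ is a Hausdorff, second countable smooth $p$-manifold, $\mathcal O_M$ is a sheaf of supercommutative real superalgebras on $M_0$ that is locally isomorphic to $C^\infty_{M_0}\otimes\Lambda(\mathbb R^q)$, and $j\colon M_0\to M$ is the canonical embedding. A retraction on $M$ is a morphism $\gamma\colon M\to M_0$ with $\gamma\circ j=\mathrm{id}_{M_0}$. A coordinate system $x=(u,\xi)$ on an open subspace $U$ has $\gamma$ as its associated retraction if $u=\gamma^*(u_0)$, where $u_0=j^*(u)$ is the underlying classical chart; every superfunction on $U$ then has a unique expansion $f=\sum_{\nu\in\{0,1\}^q}\gamma^*(f_\nu)\,\xi^\nu$ with $f_\nu\in C^\infty(U_0)$. A Berezin density $\omega$ on $M$ is a global section of the sheaf $|\mathrm{Ber}|_M$, that is, $\omega=f\,|Dx|$ in each coordinate system $x$, where for coordinate systems $x=(u,\xi)$ and $y=(v,\eta)$ on the same $U$ $$|Dx|=\operatorname{sgn}\bigl(j^*\det R\bigr)\,\det(R-SV^{-1}T)\,\det(V^{-1})\;|Dy|,\qquad \begin{pmatrix}R&S\\T&V\end{pmatrix}=\begin{pmatrix}\partial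 u/\partial v&\partial\xi/\partial v\\ \partial u/\partial\eta&\partial\xi/\partial\eta\end{pmatrix}.$$ Fix a sign convention $(-1)^{s(p,q)}$. The fibre integral of $\omega$ along $\gamma$ is the density $\gamma_!(\omega)$ on $M_0$ given by $\gamma_!(\omega)|_U=(-1)^{s(p,q)}f_{(1,\dots,1)}\,|du_0|$ whenever $x=(u,\xi)$ is a coordinate system on $U$ with associated retraction $\gamma$ and $\omega|_U=f\,|Dx|$. The Berezin density $\omega$ is called integrable with respect to $\gamma$ if $\gamma_!(\omega)$ is integrable on $M_0$, and then $\int_{(M,\gamma)}\omega:=\int_{M_0}\gamma_!(\omega)$. **Statement.** Let $\gamma,\gamma'$ be retractions on $M$ and let $\omega$ be a Berezin density on $M$ with compact support. Then $\omega$ is integrable with respect to $\gamma$ and with respect to $\gamma'$, and $$\int_{(M,\gamma)}\omega=\int_{(M,\gamma')}\omega.$$ -/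

import Mathlib

open scoped Manifold ContDiff
open TopologicalSpace MeasureTheory Opposite CategoryTheory

universe u

noncomputable section

namespace Supergeometry

/-! ### The underlying smooth manifold -/

/-- The model space `ℝ^p` of the underlying manifolds. -/
abbrev Model (p : ℕ) : Type := EuclideanSpace ℝ (Fin p)

section Classical

variable {p : ℕ} {M₀ : Type u} [TopologicalSpace M₀] [ChartedSpace (Model p) M₀]

/-- The `ℝ`-algebra `C^∞(U)` of smooth real functions on an open subset `U` of `M₀`. -/
abbrev Smooth (p : ℕ) {M₀ : Type u} [TopologicalSpace M₀] [ChartedSpace (Model p) M₀]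
    (U : Opens M₀) : Type u :=
  C^∞⟮𝓡 p, U; 𝓘(ℝ), ℝ⟯

/-- A smooth function on `U`, as an element of `C^∞(U)`. -/
def toSmooth {U : Opens M₀} (f : U → ℝ) (hf : ContMDiff (𝓡 p) 𝓘(ℝ) ∞ f) : Smooth p U := ⟨f, hf⟩

theorem toSmooth_apply {U : Opens M₀} (f : U → ℝ) (hf : ContMDiff (𝓡 p) 𝓘(ℝ) ∞ f) (x : U) :
    toSmooth f hf x = f x := rfl

/-- Restriction of smooth functions to a smaller open subset. -/
def smoothRes {U V : Opens M₀} (h : V ≤ U) : Smooth p U →ₐ[ℝ] Smooth p V :=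
  { ContMDiffMap.restrictRingHom (𝓡 p) 𝓘(ℝ) ℝ h with
    commutes' := fun _ => rfl }

/-- The classical charts of `M₀`: the members of its maximal smooth atlas. -/
abbrev charts (p : ℕ) (M₀ : Type u) [TopologicalSpace M₀] [ChartedSpace (Model p) M₀] :
    Set (OpenPartialHomeomorph M₀ (Model p)) :=
  IsManifold.maximalAtlas (𝓡 p) ∞ M₀

/-- The `i`-th coordinate function of a chart with domain `U`. -/
def chartCoord {U : Opens M₀} (e : OpenPartialHomeomorph M₀ (Model p)) (he : e ∈ charts p M₀)
    (hU : e.source = U) (i : Fin p) : Smooth p U :=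
  toSmooth (fun x => e x i) <| by
    intro x
    have hx : (x : M₀) ∈ e.source := by rw [hU]; exact x.2
    have h1 : ContMDiffAt (𝓡 p) (𝓡 p) ∞ e (x : M₀) :=
      contMDiffAt_of_mem_maximalAtlas he hx
    have h2 : ContMDiffAt (𝓡 p) (𝓡 p) ∞ (fun y : U => e y) x := contMDiffAt_subtype_iff.2 h1
    exact ((EuclideanSpace.proj i : Model p →L[ℝ] ℝ).contDiff.contMDiff.contMDiffAt).comp x h2

/-- A function on `U`, read in a chart: `y ↦ g (e⁻¹ y)` on the range of the chart
(and `0` where `e⁻¹ y` is not in `U`). -/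
def inChart {U : Opens M₀} (e : OpenPartialHomeomorph M₀ (Model p)) (g : Smooth p U) :
    Model p → ℝ :=
  fun y => Function.extend (Subtype.val : U → M₀) g 0 (e.symm y)

theorem inChart_contDiffOn {U : Opens M₀} (e : OpenPartialHomeomorph M₀ (Model p))
    (he : e ∈ charts p M₀) (hU : e.source = U) (g : Smooth p U) :
    ContDiffOn ℝ ∞ (inChart e g) e.target := by
  rw [← contMDiffOn_iff_contDiffOn]
  intro y hy
  apply ContMDiffAt.contMDiffWithinAt
  have hmem : e.symm y ∈ (U : Set M₀) := hU ▸ e.map_target hy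
  have h1 : ContMDiffAt (𝓡 p) 𝓘(ℝ) ∞ (Function.extend (Subtype.val : U → M₀) g 0)
      ((⟨e.symm y, hmem⟩ : U) : M₀) := by
    rw [← contMDiffAt_subtype_iff]
    have : (fun x : U => Function.extend (Subtype.val : U → M₀) g 0 (x : M₀)) = g := by
      funext x
      exact Subtype.val_injective.extend_apply _ _ _
    rw [this]
    exact g.contMDiff _
  exact ContMDiffAt.comp y h1 (contMDiffAt_symm_of_mem_maximalAtlas he hy)

/-- The classical partial derivative `∂g/∂e_i` of `g ∈ C^∞(U)` in a chart `e` with domain `U`. -/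
def chartDeriv {U : Opens M₀} (e : OpenPartialHomeomorph M₀ (Model p)) (he : e ∈ charts p M₀)
    (hU : e.source = U) (i : Fin p) (g : Smooth p U) : Smooth p U :=
  toSmooth (fun x => fderiv ℝ (inChart e g) (e x) (EuclideanSpace.single i 1)) <| by
    intro x
    have hx : (x : M₀) ∈ e.source := by rw [hU]; exact x.2
    have h1 : ContMDiffAt (𝓡 p) (𝓡 p) ∞ (fun y : U => e y) x :=
      contMDiffAt_subtype_iff.2 (contMDiffAt_of_mem_maximalAtlas he hx)
    have h2 : ContDiffOn ℝ ∞ (fderiv ℝ (inChart e g)) e.target :=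
      (inChart_contDiffOn e he hU g).fderiv_of_isOpen e.open_target (by simp)
    have h3 : ContDiffAt ℝ ∞
        (fun y => fderiv ℝ (inChart e g) y (EuclideanSpace.single i 1)) (e x) :=
      (h2.contDiffAt (e.open_target.mem_nhds (e.map_source hx))).clm_apply contDiffAt_const
    exact ContMDiffAt.comp x h3.contMDiffAt h1

open Classical in
/-- The function `x ↦ sgn (g x)`, as a smooth function. It is smooth when `g` vanishes nowhere
(see `smoothSign_apply`), which is the only case in which it is used. -/
def smoothSign {U : Opens M₀} (g : Smooth p U) : Smooth p U :=
  if h : ContMDiff (𝓡 p) 𝓘(ℝ) ∞ (fun x : U => Real.sign (g x)) then toSmooth _ h else 0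

theorem smoothSign_apply {U : Opens M₀} (g : Smooth p U) (hg : ∀ x, g x ≠ 0) (x : U) :
    smoothSign g x = Real.sign (g x) := by
  have h : ContMDiff (𝓡 p) 𝓘(ℝ) ∞ (fun x : U => Real.sign (g x)) := by
    intro y
    have hc : ContinuousAt g y := g.contMDiff.continuous.continuousAt
    rcases lt_or_gt_of_ne (hg y) with hy | hy
    · refine (contMDiffAt_const (c := (-1 : ℝ))).congr_of_eventuallyEq ?_
      filter_upwards [hc.eventually (gt_mem_nhds hy)] with z hz
      exact Real.sign_of_neg hz
    · refine (contMDiffAt_const (c := (1 : ℝ))).congr_of_eventuallyEq ?_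
      filter_upwards [hc.eventually (lt_mem_nhds hy)] with z hz
      exact Real.sign_of_pos hz
  rw [smoothSign, dif_pos h, toSmooth_apply]

/-! ### Densities on the underlying manifold and their integral -/

/-- A smooth density `ρ ∈ |Ω^p|M₀`: in each chart `e` it reads `ρ = (val e) · |de|` on the domain
of `e` (the values of `val e` outside of it are irrelevant), and
`|de| = |det (∂e/∂e')| |de'|` on overlaps. -/
structure Density (p : ℕ) (M₀ : Type u) [TopologicalSpace M₀] [ChartedSpace (Model p) M₀] where
  val : OpenPartialHomeomorph M₀ (Model p) → M₀ → ℝ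
  smooth : ∀ e ∈ charts p M₀, ContMDiffOn (𝓡 p) 𝓘(ℝ) ∞ (val e) e.source
  change : ∀ e ∈ charts p M₀, ∀ e' ∈ charts p M₀, ∀ x ∈ e.source ∩ e'.source,
    val e' x = val e x * |(fderiv ℝ (fun y => e (e'.symm y)) (e' x)).det|

/-- A countable partition of `M₀` into Borel sets, each of them contained in the domain of a
chart. -/
structure ChartPartition (p : ℕ) (M₀ : Type u) [TopologicalSpace M₀]
    [ChartedSpace (Model p) M₀] where
  ι : Type u
  countable : Countable ι
  chart : ι → OpenPartialHomeomorph M₀ (Model p)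
  chart_mem : ∀ n, chart n ∈ charts p M₀
  piece : ι → Set M₀
  measurable : ∀ n, MeasurableSet[borel M₀] (piece n)
  subset : ∀ n, piece n ⊆ (chart n).source
  disjoint : Pairwise (Function.onFun Disjoint piece)
  cover : ⋃ n, piece n = Set.univ

/-- Every second countable manifold has such a partition. -/
theorem ChartPartition.nonempty (p : ℕ) (M₀ : Type u) [TopologicalSpace M₀]
    [SecondCountableTopology M₀] [ChartedSpace (Model p) M₀] [IsManifold (𝓡 p) ∞ M₀] :
    Nonempty (ChartPartition p M₀) := by
  obtain ⟨s, hs, hcov⟩ := TopologicalSpace.countable_cover_nhds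
    (f := fun x : M₀ => (chartAt (Model p) x).source) (fun x => chart_source_mem_nhds _ x)
  have : Countable s := hs.to_subtype
  obtain ⟨c, hc⟩ := exists_injective_nat s
  refine ⟨⟨s, this, fun n => chartAt (Model p) (n : M₀),
    fun n => IsManifold.chart_mem_maximalAtlas (n : M₀),
    fun n => (chartAt (Model p) (n : M₀)).source \
      ⋃ m : s, ⋃ _ : c m < c n, (chartAt (Model p) (m : M₀)).source, ?_, ?_, ?_, ?_⟩⟩
  · intro n
    let _ : MeasurableSpace M₀ := borel M₀
    have : BorelSpace M₀ := ⟨rfl⟩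
    have ho : IsOpen (⋃ m : s, ⋃ _ : c m < c n, (chartAt (Model p) (m : M₀)).source) :=
      isOpen_iUnion fun m => isOpen_iUnion fun _ => (chartAt (Model p) (m : M₀)).open_source
    exact (chartAt (Model p) (n : M₀)).open_source.measurableSet.diff ho.measurableSet
  · exact fun n => Set.sdiff_subset
  · have key : ∀ m n : s, c m < c n → Disjoint
        ((chartAt (Model p) (m : M₀)).source \
          ⋃ k : s, ⋃ _ : c k < c m, (chartAt (Model p) (k : M₀)).source)
        ((chartAt (Model p) (n : M₀)).source \
          ⋃ k : s, ⋃ _ : c k < c n, (chartAt (Model p) (k : M₀)).source) := by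
      intro m n hmn
      rw [Set.disjoint_left]
      intro x hx hx'
      exact hx'.2 (Set.mem_iUnion₂.2 ⟨m, hmn, hx.1⟩)
    intro m n hmn
    rcases lt_or_gt_of_ne (fun h => hmn (hc h)) with h | h
    · exact key m n h
    · exact (key n m h).symm
  · rw [Set.eq_univ_iff_forall]
    intro x
    have hx : x ∈ ⋃ y ∈ s, (chartAt (Model p) y).source := hcov ▸ Set.mem_univ x
    obtain ⟨y, hy, hxy⟩ := Set.mem_iUnion₂.1 hx
    have hex : ∃ k, ∃ n : s, c n = k ∧ x ∈ (chartAt (Model p) (n : M₀)).source :=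
      ⟨_, ⟨y, hy⟩, rfl, hxy⟩
    classical
    obtain ⟨n, hn, hxn⟩ := Nat.find_spec hex
    refine Set.mem_iUnion.2 ⟨n, hxn, fun hx' => ?_⟩
    obtain ⟨m, hm, hxm⟩ := Set.mem_iUnion₂.1 hx'
    exact Nat.find_min hex (hn ▸ hm) ⟨m, rfl, hxm⟩

/-- `ρ` is (absolutely) integrable on `M₀` and `∫_{M₀} ρ = I`: for every partition of `M₀` into
countably many Borel sets `A n` that lie in charts `e n`, the Lebesgue integrals of
`ρ = ρ_n |d(e n)|` over the sets `A n` exist and sum up, absolutely, to `I`. -/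
def Density.HasIntegral (ρ : Density p M₀) (I : ℝ) : Prop :=
  ∀ P : ChartPartition p M₀,
    (∀ n, IntegrableOn (fun y => ρ.val (P.chart n) ((P.chart n).symm y))
      (P.chart n '' P.piece n) volume) ∧
    Summable (fun n => ∫ y in P.chart n '' P.piece n,
      |ρ.val (P.chart n) ((P.chart n).symm y)|) ∧
    HasSum (fun n => ∫ y in P.chart n '' P.piece n,
      ρ.val (P.chart n) ((P.chart n).symm y)) I

end Classical

/-! ### Supermanifolds -/

/-- A sheaf of supercommutative real superalgebras on a topological space. -/
structure SuperalgebraSheaf (X : Type u) [TopologicalSpace X] where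
  /-- the sheaf of (ungraded) `ℝ`-algebras -/
  sheaf : TopCat.Sheaf (AlgCat.{u} ℝ) (TopCat.of X)
  /-- the even (`0`) and odd (`1`) sections over an open set -/
  parity : ∀ U : Opens X, ZMod 2 → Submodule ℝ (sheaf.presheaf.obj (op U))
  isCompl : ∀ U, IsCompl (parity U 0) (parity U 1)
  graded : ∀ U, SetLike.GradedMonoid (parity U)
  supercomm : ∀ (U : Opens X) (i j : ZMod 2) (a b : sheaf.presheaf.obj (op U)),
    a ∈ parity U i → b ∈ parity U j → a * b = (-1) ^ (i.val * j.val) * (b * a)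
  map_parity : ∀ {U V : Opens X} (h : V ≤ U) (i : ZMod 2) (a : sheaf.presheaf.obj (op U)),
    a ∈ parity U i → (sheaf.presheaf.map (homOfLE h).op).hom a ∈ parity V i

namespace SuperalgebraSheaf

variable {X : Type u} [TopologicalSpace X] (𝒪 : SuperalgebraSheaf X)

/-- The sections over an open subset. -/
abbrev Sec (U : Opens X) : Type u := 𝒪.sheaf.presheaf.obj (op U)

/-- Restriction of sections. -/
def res {U V : Opens X} (h : V ≤ U) : 𝒪.Sec U →ₐ[ℝ] 𝒪.Sec V :=
  (𝒪.sheaf.presheaf.map (homOfLE h).op).hom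

theorem res_res {U V W : Opens X} (h : V ≤ U) (h' : W ≤ V) (f : 𝒪.Sec U) :
    𝒪.res h' (𝒪.res h f) = 𝒪.res (h'.trans h) f := by
  have : 𝒪.sheaf.presheaf.map (homOfLE (h'.trans h)).op =
      𝒪.sheaf.presheaf.map (homOfLE h).op ≫ 𝒪.sheaf.presheaf.map (homOfLE h').op := by
    rw [← Functor.map_comp]; rfl
  simp only [res, this]
  rfl

end SuperalgebraSheaf

/-- The monomial `ξ^ν = ξ_1^{ν_1} ⋯ ξ_q^{ν_q}`, the factors in increasing order, for
`ν ∈ {0,1}^q`, given as the set of the indices `j` with `ν_j = 1`. -/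
def oddMonomial {R : Type*} [Ring R] {q : ℕ} (ξ : Fin q → R) (ν : Finset (Fin q)) : R :=
  (List.ofFn fun j => if j ∈ ν then ξ j else 1).prod

theorem map_oddMonomial {R S : Type*} [Ring R] [Ring S] [Algebra ℝ R] [Algebra ℝ S] {q : ℕ}
    (φ : R →ₐ[ℝ] S) (ξ : Fin q → R) (ν : Finset (Fin q)) :
    φ (oddMonomial ξ ν) = oddMonomial (fun j => φ (ξ j)) ν := by
  simp only [oddMonomial, map_list_prod, List.map_ofFn]
  congr 2
  funext j
  by_cases h : j ∈ ν <;> simp [h]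

/-- An isomorphism `C^∞_U ⊗ Λ(ℝ^q) ≅ 𝒪|_U` of sheaves of superalgebras over `U`. It is given by an
even morphism of sheaves of algebras `C^∞_U → 𝒪|_U` and by the odd sections `ξ_1, …, ξ_q` over `U`
to which the generators of `Λ(ℝ^q)` go; since even sections are central and odd ones
anticommute, these data amount to a morphism `C^∞_U ⊗ Λ(ℝ^q) → 𝒪|_U`, and it is an
isomorphism if and only if over each open `W ⊆ U` each section `f` has a unique decomposition
`f = ∑_ν pullback(f_ν) ξ^ν`, with `f_ν ∈ C^∞(W)`. -/
structure Splitting {p : ℕ} {M₀ : Type u} [TopologicalSpace M₀] [ChartedSpace (Model p) M₀]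
    (q : ℕ) (𝒪 : SuperalgebraSheaf M₀) (U : Opens M₀) where
  pullback : ∀ W : Opens M₀, W ≤ U → (Smooth p W →ₐ[ℝ] 𝒪.Sec W)
  pullback_even : ∀ W hW g, pullback W hW g ∈ 𝒪.parity W 0
  res_pullback : ∀ {V W : Opens M₀} (hW : W ≤ U) (h : V ≤ W) (g : Smooth p W),
    𝒪.res h (pullback W hW g) = pullback V (h.trans hW) (smoothRes h g)
  odd : Fin q → 𝒪.Sec U
  odd_mem : ∀ j, odd j ∈ 𝒪.parity U 1
  bijective : ∀ (W : Opens M₀) (hW : W ≤ U), Function.Bijective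
    (fun c : Finset (Fin q) → Smooth p W =>
      ∑ ν, pullback W hW (c ν) * oddMonomial (fun j => 𝒪.res hW (odd j)) ν)

/-- A real supermanifold of dimension `(p, q)` with underlying manifold `M₀`: a sheaf `𝒪` of
superalgebras on `M₀` that is locally isomorphic to `C^∞ ⊗ Λ(ℝ^q)`, together with the canonical
embedding `j : M₀ → M`, that is, the morphism `j^* : 𝒪 → C^∞` of sheaves of algebras over the
identity of `M₀` (it is unique: over an open set with a splitting it has to kill the odd sections
and to invert the pullback of functions, see `Supermanifold.body_pullback`). -/
structure Supermanifold (p q : ℕ) (M₀ : Type u) [TopologicalSpace M₀]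
    [ChartedSpace (Model p) M₀] extends SuperalgebraSheaf M₀ where
  body : ∀ U : Opens M₀, toSuperalgebraSheaf.Sec U →ₐ[ℝ] Smooth p U
  body_res : ∀ {U V : Opens M₀} (h : V ≤ U) (f : toSuperalgebraSheaf.Sec U),
    body V (toSuperalgebraSheaf.res h f) = smoothRes h (body U f)
  locally_split : ∀ x : M₀, ∃ U : Opens M₀, x ∈ U ∧
    Nonempty (Splitting (p := p) q toSuperalgebraSheaf U)

namespace Supermanifold

variable {p q : ℕ} {M₀ : Type u} [TopologicalSpace M₀] [ChartedSpace (Model p) M₀]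

/-- The superfunctions on the open subspace `U` of `M`. -/
abbrev Sec (M : Supermanifold p q M₀) (U : Opens M₀) : Type u := M.toSuperalgebraSheaf.Sec U

theorem body_pullback (M : Supermanifold p q M₀) {U : Opens M₀}
    (σ : Splitting (p := p) q M.toSuperalgebraSheaf U) (W : Opens M₀) (hW : W ≤ U)
    (g : Smooth p W) : M.body W (σ.pullback W hW g) = g := by
  ext x
  by_contra hne
  set d : ℝ := M.body W (σ.pullback W hW g) x with hd
  have hopen : IsOpen (Subtype.val '' {y : W | g y ≠ d}) :=
    W.isOpen.isOpenMap_subtype_val _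
      (isOpen_ne_fun g.contMDiff.continuous continuous_const)
  let V : Opens M₀ := ⟨_, hopen⟩
  have hV : V ≤ W := by
    rintro _ ⟨y, _, rfl⟩
    exact y.2
  have hxV : (x : M₀) ∈ V := ⟨x, fun h => hne h.symm, rfl⟩
  let k : Smooth p V := smoothRes hV g - algebraMap ℝ _ d
  have hk : ∀ y, k y ≠ 0 := by
    rintro ⟨_, y, hy, rfl⟩
    exact sub_ne_zero.2 hy
  let l : Smooth p V := ⟨fun y => (k y)⁻¹, fun y => (k.contMDiff y).inv₀ (hk y)⟩
  have hkl : k * l = 1 := by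
    ext y
    exact mul_inv_cancel₀ (hk y)
  have h1 := congrArg (fun a => M.body V (σ.pullback V (hV.trans hW) a)) hkl
  simp only [map_mul, map_one] at h1
  have h2 : M.body V (σ.pullback V (hV.trans hW) k) ⟨x, hxV⟩ = 0 := by
    have : M.body V (σ.pullback V (hV.trans hW) k) =
        smoothRes hV (M.body W (σ.pullback W hW g)) - algebraMap ℝ _ d := by
      simp only [k, map_sub, AlgHom.commutes]
      rw [← σ.res_pullback, M.body_res]
    rw [this]
    exact sub_self _
  have h3 := congrArg (fun a : Smooth p V => a ⟨x, hxV⟩) h1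
  change M.body V (σ.pullback V (hV.trans hW) k) ⟨x, hxV⟩ * _ = (1 : ℝ) at h3
  rw [h2, zero_mul] at h3
  exact zero_ne_one h3

/-- A retraction `γ : M → M₀`, a morphism of supermanifolds with `γ ∘ j = id`. The underlying
map of such a `γ` is the identity of `M₀`, so that `γ` is a morphism `γ^* : C^∞ → 𝒪` of sheaves
of superalgebras on `M₀` (`C^∞` is purely even), with `j^* ∘ γ^* = id`. -/
structure Retraction (M : Supermanifold p q M₀) where
  pullback : ∀ U : Opens M₀, Smooth p U →ₐ[ℝ] M.Sec U
  pullback_even : ∀ U g, pullback U g ∈ M.parity U 0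
  res_pullback : ∀ {U V : Opens M₀} (h : V ≤ U) (g : Smooth p U),
    M.res h (pullback U g) = pullback V (smoothRes h g)
  body_pullback : ∀ U g, M.body U (pullback U g) = g

/-- A coordinate system `x = (u, ξ)` on the open subspace `U`: an isomorphism of `M|_U` with an
open subspace of `ℝ^{p|q}`, given by a classical chart `u₀` with domain `U` and a
splitting. The even coordinates are `u_i = pullback (u₀)_i`, the odd ones `ξ_j = odd j`. -/
structure CoordSystem (M : Supermanifold p q M₀) (U : Opens M₀) extends
    Splitting (p := p) q M.toSuperalgebraSheaf U where
  chart : OpenPartialHomeomorph M₀ (Model p)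
  chart_mem : chart ∈ charts p M₀
  source_eq : chart.source = U

namespace CoordSystem

variable {M : Supermanifold p q M₀} {U : Opens M₀}

/-- The restriction of a coordinate system to a smaller open subspace. -/
def restrict (x : M.CoordSystem U) (V : Opens M₀) (h : V ≤ U) : M.CoordSystem V where
  pullback W hW := x.pullback W (hW.trans h)
  pullback_even W hW g := x.pullback_even W (hW.trans h) g
  res_pullback hW h' g := x.res_pullback (hW.trans h) h' g
  odd j := M.res h (x.odd j)
  odd_mem j := M.map_parity h 1 _ (x.odd_mem j)
  bijective W hW := by
    simp only [SuperalgebraSheaf.res_res]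
    exact x.bijective W (hW.trans h)
  chart := x.chart.restr V
  chart_mem := restr_mem_maximalAtlas (contDiffGroupoid ∞ (𝓡 p)) x.chart_mem V.isOpen
  source_eq := by
    rw [OpenPartialHomeomorph.restr_source' _ _ V.isOpen, x.source_eq]
    exact Set.inter_eq_right.2 h

/-- The even coordinate functions `u_i`. -/
def even (x : M.CoordSystem U) (i : Fin p) : M.Sec U :=
  x.pullback U le_rfl (chartCoord x.chart x.chart_mem x.source_eq i)

/-- The monomial `ξ^ν` in the odd coordinates. -/
def monomial (x : M.CoordSystem U) (ν : Finset (Fin q)) : M.Sec U := oddMonomial x.odd ν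

/-- The coefficients `f_ν` in the decomposition `f = ∑_ν γ^*(f_ν) ξ^ν` of a superfunction on `U`,
where `γ` is the retraction associated with `x`. -/
def coeff (x : M.CoordSystem U) (f : M.Sec U) : Finset (Fin q) → Smooth p U :=
  (Equiv.ofBijective _ (x.bijective U le_rfl)).symm f

theorem sum_coeff (x : M.CoordSystem U) (f : M.Sec U) :
    ∑ ν, x.pullback U le_rfl (x.coeff f ν) * x.monomial ν = f := by
  have h := (Equiv.ofBijective _ (x.bijective U le_rfl)).apply_symm_apply f
  have hid : ∀ a : M.Sec U, M.res (le_refl U) a = a := by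
    intro a
    have : M.sheaf.presheaf.map (homOfLE (le_refl U)).op = 𝟙 _ :=
      M.sheaf.presheaf.map_id (op U)
    simp only [SuperalgebraSheaf.res, this]
    rfl
  have hodd : (fun j => M.res (le_refl U) (x.odd j)) = x.odd := funext fun j => hid _
  refine Eq.trans (Finset.sum_congr rfl fun ν _ => ?_) h
  change _ = x.pullback U le_rfl (x.coeff f ν) *
    oddMonomial (fun j => M.res (le_refl U) (x.odd j)) ν
  rw [hodd]
  rfl

/-- The derivation `∂/∂u_i`: `f ↦ ∑_ν γ^*(∂f_ν/∂(u₀)_i) ξ^ν`. -/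
def derivEven (x : M.CoordSystem U) (i : Fin p) (f : M.Sec U) : M.Sec U :=
  ∑ ν, x.pullback U le_rfl (chartDeriv x.chart x.chart_mem x.source_eq i (x.coeff f ν)) *
    x.monomial ν

/-- The derivation `∂/∂ξ_j`:
`f ↦ ∑_{ν, ν_j = 1} γ^*(f_ν) ξ^{ν - e_j} (-1)^{ν_1 + ⋯ + ν_{j-1}}`. -/
def derivOdd (x : M.CoordSystem U) (j : Fin q) (f : M.Sec U) : M.Sec U :=
  ∑ ν with j ∈ ν, (-1) ^ (ν.filter (· < j)).card *
    (x.pullback U le_rfl (x.coeff f ν) * x.monomial (ν.erase j))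

end CoordSystem

end Supermanifold

/-! ### Berezin densities -/

/-- The determinant of a matrix with pairwise commuting entries in a ring, by the Leibniz
formula. It is applied to matrices of even sections only. -/
def leibnizDet {R : Type*} [Ring R] {n : ℕ} (A : Matrix (Fin n) (Fin n) R) : R :=
  ∑ σ : Equiv.Perm (Fin n),
    ((Equiv.Perm.sign σ : ℤ) : R) * (List.ofFn fun i => A (σ i) i).prod

theorem leibnizDet_eq_det {R : Type*} [CommRing R] {n : ℕ} (A : Matrix (Fin n) (Fin n) R) :
    leibnizDet A = A.det := by
  simp [leibnizDet, Matrix.det_apply', List.prod_ofFn]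

/-- The Berezinian `det (R - S V⁻¹ T) · det V⁻¹` of an even supermatrix with blocks `R, S, T, V`,
where `R` and `V` have even entries, `S` and `T` odd ones, and `V` is invertible. -/
def berezinian {A : Type*} [Ring A] {p q : ℕ} (R : Matrix (Fin p) (Fin p) A)
    (S : Matrix (Fin p) (Fin q) A) (T : Matrix (Fin q) (Fin p) A)
    (V : Matrix (Fin q) (Fin q) A) : A :=
  leibnizDet (R - S * Ring.inverse V * T) * leibnizDet (Ring.inverse V)

namespace Supermanifold

variable {p q : ℕ} {M₀ : Type u} [TopologicalSpace M₀] [ChartedSpace (Model p) M₀]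

namespace CoordSystem

variable {M : Supermanifold p q M₀} {U : Opens M₀}

/-- The block `∂u/∂v` of the matrix `∂x/∂y`, for `x = (u, ξ)` and `y = (v, η)`: rows are indexed
by the coordinates `y`, columns by the coordinates `x`. -/
def jacEvenEven (x y : M.CoordSystem U) : Matrix (Fin p) (Fin p) (M.Sec U) :=
  Matrix.of fun i j => y.derivEven i (x.even j)

/-- The Berezinian `Ber (∂x/∂y)` of the coordinate change, where
`∂x/∂y` has the blocks `∂u/∂v`, `∂ξ/∂v`, `∂u/∂η`, `∂ξ/∂η`. -/
def ber (x y : M.CoordSystem U) : M.Sec U :=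
  berezinian (jacEvenEven x y)
    (Matrix.of fun i b => y.derivEven i (x.odd b))
    (Matrix.of fun a j => y.derivOdd a (x.even j))
    (Matrix.of fun a b => y.derivOdd a (x.odd b))

/-- `|Ber| (∂x/∂y) = sgn (j^* det (∂u/∂v)) · Ber (∂x/∂y)`. -/
def absBer (x y : M.CoordSystem U) : M.Sec U :=
  y.pullback U le_rfl (smoothSign (M.body U (leibnizDet (jacEvenEven x y)))) * ber x y

end CoordSystem

/-- A Berezin density `β` on `M`, that is, a global section of the sheaf `|Ber|_M`: for each
coordinate system `x` on an open subspace `U` it has the form `β|_U = (val U x) |Dx|`, with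
`|Dx| = |Ber| (∂x/∂y) |Dy|`, compatibly with restrictions. -/
structure BerezinDensity (M : Supermanifold p q M₀) where
  val : ∀ U : Opens M₀, M.CoordSystem U → M.Sec U
  val_restrict : ∀ {U V : Opens M₀} (h : V ≤ U) (x : M.CoordSystem U),
    val V (x.restrict V h) = M.res h (val U x)
  change : ∀ {U : Opens M₀} (x y : M.CoordSystem U), val U y = val U x * x.absBer y

/-- The coordinate system `x` on `U` has `γ` as its associated retraction. -/
def CoordSystem.IsAdapted {M : Supermanifold p q M₀} {U : Opens M₀} (x : M.CoordSystem U)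
    (γ : M.Retraction) : Prop :=
  ∀ (W : Opens M₀) (hW : W ≤ U), x.pullback W hW = γ.pullback W

namespace BerezinDensity

variable {M : Supermanifold p q M₀} (β : M.BerezinDensity)

/-- `β` vanishes on the open subspace `W`. -/
def VanishesOn (W : Opens M₀) : Prop :=
  ∀ U : Opens M₀, U ≤ W → ∀ x : M.CoordSystem U, β.val U x = 0

/-- The support of `β`: the points without an open neighbourhood on which `β` vanishes. -/
def support : Set M₀ := {x | ∀ W : Opens M₀, x ∈ W → ¬ β.VanishesOn W}

/-- The density `ρ` on `M₀` is the fibre integral `γ_!(β)`, where the sign convention of the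
Berezin integral in dimension `(p, q)` is `(-1)^{s(p,q)}`: on each coordinate neighbourhood `U`
with a coordinate system `x = (u, ξ)` with associated retraction `γ`, for `β|_U = f |Dx|` one has
`ρ = (-1)^{s(p,q)} f_{(1,…,1)} |du₀|`. -/
def IsFibreIntegral (s : ℕ → ℕ → ℕ) (γ : M.Retraction) (ρ : Density p M₀) : Prop :=
  ∀ (U : Opens M₀) (x : M.CoordSystem U), x.IsAdapted γ → ∀ o : U,
    ρ.val x.chart o = (-1) ^ s p q * x.coeff (β.val U x) Finset.univ o

/-- `β` is integrable with respect to `γ`, with `∫_{(M,γ)} β = ∫_{M₀} γ_!(β) = I`. -/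
def HasIntegral (s : ℕ → ℕ → ℕ) (γ : M.Retraction) (I : ℝ) : Prop :=
  ∃ ρ : Density p M₀, β.IsFibreIntegral s γ ρ ∧ ρ.HasIntegral I

/-- `β` is integrable with respect to `γ`. -/
def IsIntegrable (s : ℕ → ℕ → ℕ) (γ : M.Retraction) : Prop := ∃ I, β.HasIntegral s γ I

open Classical in
/-- The integral `∫_{(M,γ)} β` of a Berezin density that is integrable with respect to `γ`. -/
def integral (s : ℕ → ℕ → ℕ) (γ : M.Retraction) : ℝ :=
  if h : β.IsIntegrable s γ then h.choose else 0

end BerezinDensity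

end Supermanifold

end Supergeometry

end

noncomputable section

namespace Supergeometry

/-!
The fibre integral of a Berezin density depends on `γ` alone: for coordinate systems `x = (u, ξ)`
and `y = (v, η)` with the same associated retraction `γ`, the factor `|Ber| (∂x/∂y)` is `γ^*` of the
absolute value of the classical Jacobian determinant times `det (∂ξ/∂η)⁻¹`, and the top coefficient
of `f * det (∂ξ/∂η)⁻¹` in the generators `η` is the top coefficient of `f` in the generators `ξ`.

By a partition of unity it suffices to compare two retractions for a density whose support lies in
a coordinate neighbourhood, where one retraction is turned into the other by shifting one even
coordinate `u_i` at a time by an even nilpotent superfunction `m`. A superfunction with coefficients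
`g_ν` in the shifted coordinates has the Taylor expansion `∑ n, ∂_i ^ n G * m ^ n / n!` in the old
ones, where `G` has the coefficients `g_ν` in the old coordinates, and the Berezinian of the shift
is `1 + ∂_i m`. The product telescopes to `G + ∂_i H`, so that the top coefficient changes by a
partial derivative of a function with compact support, whose integral vanishes.
-/

/-! ### Odd monomials -/

section Monomials

variable {q : ℕ} {A : Type*} [Ring A]

theorem oddMonomial_eq_prod_sort (ξ : Fin q → A) (ν : Finset (Fin q)) :
    oddMonomial ξ ν = (ν.sort.map ξ).prod := by
  have hsort : (List.finRange q).filter (· ∈ ν) = ν.sort := by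
    refine List.Perm.eq_of_pairwise' (r := (· ≤ ·)) ?_ (ν.pairwise_sort _) ?_
    · exact ((List.pairwise_lt_finRange q).imp le_of_lt).filter _
    · refine (List.perm_ext_iff_of_nodup ((List.nodup_finRange q).filter _)
        (ν.sort_nodup _)).2 fun i => ?_
      simp only [List.mem_filter, List.mem_finRange, true_and, decide_eq_true_eq,
        Finset.mem_sort]
  rw [oddMonomial, List.ofFn_eq_map, ← hsort]
  generalize List.finRange q = l
  induction l with
  | nil => rfl
  | cons i l ih =>
    by_cases hi : i ∈ ν <;> simp [hi, ih]

theorem oddMonomial_empty (ξ : Fin q → A) : oddMonomial ξ ∅ = 1 := by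
  simp [oddMonomial_eq_prod_sort]

theorem oddMonomial_insert_of_lt (ξ : Fin q → A) {j : Fin q} {ν : Finset (Fin q)}
    (h : ∀ i ∈ ν, j < i) : oddMonomial ξ (insert j ν) = ξ j * oddMonomial ξ ν := by
  rw [oddMonomial_eq_prod_sort, oddMonomial_eq_prod_sort,
    Finset.sort_insert _ (fun i hi => (h i hi).le) fun hj => lt_irrefl j (h j hj),
    List.map_cons, List.prod_cons]

/-- The elements `i` of `ν` that are smaller than `j`: the generators that `ξ_j` passes on its
way to its place in `ξ^ν`. -/
abbrev below (ν : Finset (Fin q)) (j : Fin q) : Finset (Fin q) := ν.filter (· < j)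

theorem card_below_insert_of_lt {i j : Fin q} {ν : Finset (Fin q)} (hi : i ∉ ν) (h : i < j) :
    (below (insert i ν) j).card = (below ν j).card + 1 := by
  rw [below, Finset.filter_insert, if_pos h,
    Finset.card_insert_of_notMem fun hmem => hi (Finset.mem_of_mem_filter i hmem)]

theorem mul_oddMonomial {ξ : Fin q → A} (hanti : ∀ i j, ξ i * ξ j = -(ξ j * ξ i))
    (hsq : ∀ i, ξ i * ξ i = 0) (j : Fin q) (ν : Finset (Fin q)) :
    ξ j * oddMonomial ξ ν =
      if j ∈ ν then 0 else (-1 : ℤ) ^ (below ν j).card • oddMonomial ξ (insert j ν) := by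
  induction ν using Finset.induction_on_min with
  | empty =>
    rw [oddMonomial_insert_of_lt ξ (by simp)]
    simp
  | insert i ν hi ih =>
    have hiν : i ∉ ν := fun h => lt_irrefl i (hi i h)
    rcases lt_trichotomy j i with hji | rfl | hij
    · have hlt : ∀ k ∈ insert i ν, j < k := by
        simpa [hji] using fun k hk => hji.trans (hi k hk)
      have hj : j ∉ insert i ν := fun h => lt_irrefl j (hlt j h)
      have hb : below (insert i ν) j = ∅ :=
        Finset.filter_eq_empty_iff.2 fun k hk => (hlt k hk).le.not_gt
      simp [hj, hb, oddMonomial_insert_of_lt ξ hlt]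
    · simp [oddMonomial_insert_of_lt ξ hi, ← mul_assoc, hsq]
    · rw [oddMonomial_insert_of_lt ξ hi, ← mul_assoc, hanti, neg_mul, mul_assoc, ih]
      by_cases hj : j ∈ ν
      · simp [hj]
      · have hlt : ∀ k ∈ insert j ν, i < k := by simpa [hij] using hi
        rw [if_neg hj, if_neg (by simp [hij.ne', hj]), card_below_insert_of_lt hiν hij,
          Finset.insert_comm, oddMonomial_insert_of_lt ξ hlt, mul_smul_comm, pow_succ,
          mul_neg_one, neg_smul]

end Monomials

/-! ### Grassmann algebras over a commutative ring -/

/-- A presentation of the ring `A` as the Grassmann algebra over its central subring `C` in the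
generators `gen 0, …, gen (q - 1)`. -/
structure GrassmannFrame (q : ℕ) (C A : Type*) [CommRing C] [Ring A] where
  incl : C →+* A
  gen : Fin q → A
  incl_comm : ∀ c a, incl c * a = a * incl c
  gen_anticomm : ∀ i j, gen i * gen j = -(gen j * gen i)
  gen_mul_self : ∀ i, gen i * gen i = 0
  bijective : Function.Bijective fun c : Finset (Fin q) → C =>
    ∑ ν, incl (c ν) * oddMonomial gen ν

namespace GrassmannFrame

variable {q : ℕ} {C A : Type*} [CommRing C] [Ring A] (x : GrassmannFrame q C A)

/-- The monomials `ξ^ν` in the generators. -/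
def monomial (ν : Finset (Fin q)) : A := oddMonomial x.gen ν

/-- The bijection `c ↦ ∑_ν c_ν ξ^ν` of families of constants with elements of the algebra. -/
def expansion : (Finset (Fin q) → C) ≃+ A :=
  AddEquiv.ofBijective
    (AddMonoidHom.mk' (fun c => ∑ ν, x.incl (c ν) * x.monomial ν) fun a b => by
      simp only [Pi.add_apply, map_add, add_mul, Finset.sum_add_distrib]) x.bijective

theorem expansion_apply (c : Finset (Fin q) → C) :
    x.expansion c = ∑ ν, x.incl (c ν) * x.monomial ν := rfl

/-- The coefficient of `ξ^ν`. -/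
def coeff (ν : Finset (Fin q)) : A →+ C :=
  (Pi.evalAddMonoidHom _ ν).comp (x.expansion.symm : A →+ (Finset (Fin q) → C))

theorem coeff_sum (c : Finset (Fin q) → C) (ν : Finset (Fin q)) :
    x.coeff ν (∑ μ, x.incl (c μ) * x.monomial μ) = c ν :=
  congrFun (x.expansion.symm_apply_apply c) ν

theorem sum_coeff (a : A) : ∑ ν, x.incl (x.coeff ν a) * x.monomial ν = a :=
  x.expansion.apply_symm_apply a

theorem ext_coeff {a b : A} (h : ∀ ν, x.coeff ν a = x.coeff ν b) : a = b :=
  x.expansion.symm.injective (funext h)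

theorem coeff_incl_mul (c : C) (a : A) (ν : Finset (Fin q)) :
    x.coeff ν (x.incl c * a) = c * x.coeff ν a := by
  conv_lhs => rw [← x.sum_coeff a, Finset.mul_sum]
  simp only [← mul_assoc, ← map_mul]
  exact x.coeff_sum (fun μ => c * x.coeff μ a) ν

theorem coeff_monomial (μ ν : Finset (Fin q)) :
    x.coeff ν (x.monomial μ) = if ν = μ then 1 else 0 := by
  have hsingle : x.monomial μ =
      ∑ κ, x.incl ((Pi.single μ 1 : Finset (Fin q) → C) κ) * x.monomial κ := by
    rw [Finset.sum_eq_single μ (fun κ _ hκ => by simp [Pi.single_eq_of_ne hκ]) (by simp)]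
    simp
  rw [hsingle, coeff_sum, Pi.single_apply]

theorem coeff_incl_mul_monomial (c : C) (μ ν : Finset (Fin q)) :
    x.coeff ν (x.incl c * x.monomial μ) = if ν = μ then c else 0 := by
  rw [coeff_incl_mul, coeff_monomial, mul_ite, mul_one, mul_zero]

theorem monomial_empty : x.monomial ∅ = 1 := oddMonomial_empty _

theorem coeff_incl (c : C) (ν : Finset (Fin q)) :
    x.coeff ν (x.incl c) = if ν = ∅ then c else 0 := by
  simpa [monomial_empty] using x.coeff_incl_mul_monomial c ∅ ν

theorem coeff_mul_mem (J : Ideal C) {a : A} (ha : ∀ ν, x.coeff ν a ∈ J) (b : A)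
    (ν : Finset (Fin q)) : x.coeff ν (a * b) ∈ J := by
  rw [← x.sum_coeff a, Finset.sum_mul, map_sum]
  refine sum_mem fun μ _ => ?_
  rw [mul_assoc, coeff_incl_mul]
  exact J.mul_mem_right _ (ha μ)

theorem coeff_smul {R : Type*} [CommSemiring R] [Algebra R C] [Algebra R A]
    (hincl : ∀ r, x.incl (algebraMap R C r) = algebraMap R A r) (r : R) (a : A)
    (ν : Finset (Fin q)) : x.coeff ν (r • a) = r • x.coeff ν a := by
  rw [Algebra.smul_def, ← hincl, coeff_incl_mul, ← Algebra.smul_def]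

theorem coeff_map {C' A' : Type*} [CommRing C'] [Ring A'] (x' : GrassmannFrame q C' A')
    {φ : A →+* A'} {ψ : C →+* C'} (hincl : ∀ c, φ (x.incl c) = x'.incl (ψ c))
    (hgen : ∀ j, φ (x.gen j) = x'.gen j) (ν : Finset (Fin q)) (a : A) :
    x'.coeff ν (φ a) = ψ (x.coeff ν a) := by
  have hmonomial (μ : Finset (Fin q)) : φ (x.monomial μ) = x'.monomial μ := by
    rw [monomial, monomial, oddMonomial_eq_prod_sort, oddMonomial_eq_prod_sort, map_list_prod,
      List.map_map, ← funext hgen, Function.comp_def]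
  have hexpand : φ a = ∑ μ, x'.incl (ψ (x.coeff μ a)) * x'.monomial μ := by
    conv_lhs => rw [← x.sum_coeff a]
    simp only [map_sum, map_mul, hincl, hmonomial]
  rw [hexpand, coeff_sum]

theorem gen_mul_monomial (j : Fin q) (ν : Finset (Fin q)) : x.gen j * x.monomial ν =
    if j ∈ ν then 0 else (-1 : ℤ) ^ (below ν j).card • x.monomial (insert j ν) :=
  mul_oddMonomial x.gen_anticomm x.gen_mul_self j ν

theorem monomial_insert_of_lt {j : Fin q} {ν : Finset (Fin q)} (h : ∀ i ∈ ν, j < i) :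
    x.monomial (insert j ν) = x.gen j * x.monomial ν :=
  oddMonomial_insert_of_lt x.gen h

theorem monomial_singleton (j : Fin q) : x.monomial {j} = x.gen j := by
  simpa [monomial_empty] using x.monomial_insert_of_lt (j := j) (ν := ∅) (by simp)

@[elab_as_elim]
theorem monomial_induction {P : A → Prop} (one : P 1) (gen_mul : ∀ j a, P a → P (x.gen j * a))
    (ν : Finset (Fin q)) : P (x.monomial ν) := by
  induction ν using Finset.induction_on_min with
  | empty => exact x.monomial_empty ▸ one
  | insert j ν hj ih => exact x.monomial_insert_of_lt hj ▸ gen_mul j _ ih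

@[elab_as_elim]
theorem induction {P : A → Prop} (one : P 1) (add : ∀ a b, P a → P b → P (a + b))
    (incl_mul : ∀ c a, P a → P (x.incl c * a)) (gen_mul : ∀ j a, P a → P (x.gen j * a)) (a : A) :
    P a := by
  have zero : P 0 := by simpa using incl_mul 0 1 one
  rw [← x.sum_coeff a]
  exact Finset.sum_induction _ P add zero fun ν _ =>
    incl_mul _ _ (x.monomial_induction one gen_mul ν)

/-! ### The degree filtration -/

/-- The ideal of the elements all of whose terms have degree at least `k`. -/
def filtration (k : ℕ) : AddSubgroup A where
  carrier := {a | ∀ ν : Finset (Fin q), ν.card < k → x.coeff ν a = 0}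
  zero_mem' _ _ := map_zero _
  add_mem' ha hb ν hν := by rw [map_add, ha ν hν, hb ν hν, add_zero]
  neg_mem' ha ν hν := by rw [map_neg, ha ν hν, neg_zero]

theorem filtration_antitone : Antitone x.filtration :=
  fun _ _ h _ ha ν hν => ha ν (hν.trans_le h)

theorem mem_filtration_zero (a : A) : a ∈ x.filtration 0 := fun _ h => absurd h (Nat.not_lt_zero _)

theorem eq_zero_of_mem_filtration {k : ℕ} (hk : q < k) {a : A} (h : a ∈ x.filtration k) :
    a = 0 := by
  refine x.ext_coeff fun ν => ?_
  rw [map_zero]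
  exact h ν ((card_finset_fin_le ν).trans_lt hk)

theorem incl_mul_mem_filtration {k : ℕ} (c : C) {a : A} (h : a ∈ x.filtration k) :
    x.incl c * a ∈ x.filtration k :=
  fun ν hν => by rw [coeff_incl_mul, h ν hν, mul_zero]

theorem monomial_mem_filtration (ν : Finset (Fin q)) : x.monomial ν ∈ x.filtration ν.card := by
  intro μ hμ
  rw [coeff_monomial, if_neg]
  rintro rfl
  exact lt_irrefl _ hμ

theorem gen_mem_filtration_one (j : Fin q) : x.gen j ∈ x.filtration 1 := by
  simpa [monomial_singleton] using x.monomial_mem_filtration {j}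

theorem gen_mul_mem_filtration {k : ℕ} (j : Fin q) {a : A} (ha : a ∈ x.filtration k) :
    x.gen j * a ∈ x.filtration (k + 1) := by
  rw [← x.sum_coeff a, Finset.mul_sum]
  refine sum_mem fun ν _ => ?_
  by_cases hν : ν.card < k
  · rw [ha ν hν, map_zero, zero_mul, mul_zero]
    exact zero_mem _
  rw [← mul_assoc, ← x.incl_comm, mul_assoc, gen_mul_monomial]
  refine x.incl_mul_mem_filtration _ ?_
  split_ifs with hj
  · exact zero_mem _
  · refine zsmul_mem (x.filtration_antitone ?_ (x.monomial_mem_filtration _)) _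
    rw [Finset.card_insert_of_notMem hj]
    exact Nat.succ_le_succ (not_lt.1 hν)

theorem monomial_mul_mem_filtration {k : ℕ} (ν : Finset (Fin q)) {a : A}
    (ha : a ∈ x.filtration k) : x.monomial ν * a ∈ x.filtration (ν.card + k) := by
  induction ν using Finset.induction_on_min with
  | empty => simpa [monomial_empty] using ha
  | insert j ν hj ih =>
    rw [x.monomial_insert_of_lt hj, mul_assoc,
      Finset.card_insert_of_notMem fun h => lt_irrefl j (hj j h), add_right_comm]
    exact x.gen_mul_mem_filtration j ih

theorem mul_mem_filtration {k l : ℕ} {a b : A} (ha : a ∈ x.filtration k)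
    (hb : b ∈ x.filtration l) : a * b ∈ x.filtration (k + l) := by
  rw [← x.sum_coeff a, Finset.sum_mul]
  refine sum_mem fun ν _ => ?_
  by_cases hν : ν.card < k
  · rw [ha ν hν, map_zero, zero_mul, zero_mul]
    exact zero_mem _
  · rw [mul_assoc]
    exact x.incl_mul_mem_filtration _ (x.filtration_antitone
      (Nat.add_le_add_right (not_lt.1 hν) l) (x.monomial_mul_mem_filtration ν hb))

theorem mul_mem_filtration_left {k : ℕ} {a : A} (b : A) (ha : a ∈ x.filtration k) :
    b * a ∈ x.filtration k := by
  simpa using x.mul_mem_filtration (x.mem_filtration_zero b) ha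

theorem mul_mem_filtration_right {k : ℕ} {a : A} (b : A) (ha : a ∈ x.filtration k) :
    a * b ∈ x.filtration k := by
  simpa using x.mul_mem_filtration ha (x.mem_filtration_zero b)

theorem pow_mem_filtration {a : A} (ha : a ∈ x.filtration 1) (n : ℕ) :
    a ^ n ∈ x.filtration n := by
  induction n with
  | zero => exact x.mem_filtration_zero _
  | succ n ih => exact pow_succ a n ▸ x.mul_mem_filtration ih ha

theorem sub_incl_coeff_empty_mem_filtration (a : A) :
    a - x.incl (x.coeff ∅ a) ∈ x.filtration 1 := by
  intro ν hν
  rw [Nat.lt_one_iff, Finset.card_eq_zero] at hν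
  rw [hν, map_sub, coeff_incl, if_pos rfl, sub_self]

/-- The term of degree `0`, as a homomorphism onto the ring of constants. -/
def body : A →+* C where
  toFun := x.coeff ∅
  map_one' := by simpa using x.coeff_incl 1 ∅
  map_zero' := map_zero _
  map_add' := map_add _
  map_mul' a b := by
    have hmem : a * b - x.incl (x.coeff ∅ a * x.coeff ∅ b) ∈ x.filtration 1 := by
      have hsplit : a * b - x.incl (x.coeff ∅ a * x.coeff ∅ b) =
          (a - x.incl (x.coeff ∅ a)) * b +
            x.incl (x.coeff ∅ a) * (b - x.incl (x.coeff ∅ b)) := by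
        rw [map_mul, sub_mul, mul_sub, sub_add_sub_cancel]
      rw [hsplit]
      exact add_mem (x.mul_mem_filtration_right _ (x.sub_incl_coeff_empty_mem_filtration a))
        (x.mul_mem_filtration_left _ (x.sub_incl_coeff_empty_mem_filtration b))
    have hzero := hmem ∅ Nat.one_pos
    rwa [map_sub, coeff_incl, if_pos rfl, sub_eq_zero] at hzero

theorem body_apply (a : A) : x.body a = x.coeff ∅ a := rfl

theorem mem_filtration_one_iff {a : A} : a ∈ x.filtration 1 ↔ x.body a = 0 := by
  refine ⟨fun h => h ∅ Nat.one_pos, fun h ν hν => ?_⟩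
  rw [Nat.lt_one_iff, Finset.card_eq_zero] at hν
  exact hν ▸ h

end GrassmannFrame

namespace GrassmannFrame

variable {q : ℕ} {C A : Type*} [CommRing C] [Ring A] (x : GrassmannFrame q C A)

theorem gen_mul_incl_mul (j : Fin q) (c : C) (a : A) :
    x.gen j * (x.incl c * a) = x.incl c * (x.gen j * a) := by
  rw [← mul_assoc, ← x.incl_comm, mul_assoc]

theorem addHom_ext {B : Type*} [AddCommGroup B] {f g : A →+ B}
    (h : ∀ c ν, f (x.incl c * x.monomial ν) = g (x.incl c * x.monomial ν)) : f = g := by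
  ext a
  rw [← x.sum_coeff a, map_sum, map_sum]
  exact Finset.sum_congr rfl fun ν _ => h _ ν

/-! ### The grading involution -/

/-- The grading involution `ξ_j ↦ -ξ_j`: its fixed points are the even elements. -/
def involute : A →+ A :=
  AddMonoidHom.mk' (fun a => ∑ ν, x.incl ((-1) ^ ν.card * x.coeff ν a) * x.monomial ν)
    fun a b => by simp only [map_add, mul_add, add_mul, Finset.sum_add_distrib]

theorem coeff_involute (a : A) (ν : Finset (Fin q)) :
    x.coeff ν (x.involute a) = (-1) ^ ν.card * x.coeff ν a :=
  x.coeff_sum (fun ν => (-1) ^ ν.card * x.coeff ν a) ν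

theorem involute_incl_mul (c : C) (a : A) :
    x.involute (x.incl c * a) = x.incl c * x.involute a :=
  x.ext_coeff fun ν => by
    rw [coeff_involute, coeff_incl_mul, coeff_incl_mul, coeff_involute, mul_left_comm]

theorem involute_monomial (ν : Finset (Fin q)) :
    x.involute (x.monomial ν) = (-1 : ℤ) ^ ν.card • x.monomial ν := by
  refine x.ext_coeff fun μ => ?_
  rw [coeff_involute, map_zsmul, coeff_monomial]
  split_ifs with h
  · simp [h]
  · simp

theorem involute_one : x.involute 1 = 1 := by
  simpa [monomial_empty] using x.involute_monomial ∅

theorem involute_gen_mul (j : Fin q) (a : A) :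
    x.involute (x.gen j * a) = -(x.gen j * x.involute a) := by
  refine DFunLike.congr_fun (x.addHom_ext (f := x.involute.comp (AddMonoidHom.mulLeft (x.gen j)))
    (g := -(AddMonoidHom.mulLeft (x.gen j)).comp x.involute) fun c ν => ?_) a
  simp only [AddMonoidHom.comp_apply, AddMonoidHom.neg_apply, AddMonoidHom.coe_mulLeft,
    gen_mul_incl_mul, involute_incl_mul, involute_monomial, gen_mul_monomial, mul_smul_comm]
  split_ifs with h
  · simp
  · rw [map_zsmul, involute_monomial, Finset.card_insert_of_notMem h, pow_succ, mul_neg_one,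
      neg_smul, smul_neg, mul_neg, mul_smul_comm, mul_smul_comm, mul_smul_comm, smul_comm]

theorem involute_mul (a b : A) : x.involute (a * b) = x.involute a * x.involute b := by
  induction a using x.induction with
  | one => rw [one_mul, involute_one, one_mul]
  | add a a' h h' => rw [add_mul, map_add, map_add, add_mul, h, h']
  | incl_mul c a h => rw [mul_assoc, involute_incl_mul, involute_incl_mul, h, mul_assoc]
  | gen_mul j a h => rw [mul_assoc, involute_gen_mul, involute_gen_mul, h, neg_mul, mul_assoc]

theorem gen_mul (j : Fin q) (a : A) : x.gen j * a = x.involute a * x.gen j := by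
  induction a using x.induction with
  | one => rw [involute_one, one_mul, mul_one]
  | add a b h h' => rw [mul_add, map_add, add_mul, h, h']
  | incl_mul c a h => rw [gen_mul_incl_mul, h, involute_incl_mul, mul_assoc]
  | gen_mul i a h =>
    rw [involute_gen_mul, ← mul_assoc, x.gen_anticomm, neg_mul, mul_assoc, h, neg_mul, mul_assoc]

theorem commute_of_involute_eq {a : A} (ha : x.involute a = a) (b : A) : a * b = b * a := by
  induction b using x.induction with
  | one => rw [mul_one, one_mul]
  | add b c h h' => rw [mul_add, add_mul, h, h']
  | incl_mul c b h => rw [← mul_assoc, ← x.incl_comm, mul_assoc, h, mul_assoc]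
  | gen_mul j b h => rw [← mul_assoc, ← ha, ← gen_mul, ha, mul_assoc, h, mul_assoc]

/-- The central subring of the even elements, over which the Jacobians of changes of generators
are defined. -/
def evenSubring : Subring A where
  carrier := {a | x.involute a = a}
  zero_mem' := map_zero _
  one_mem' := x.involute_one
  add_mem' {a b} (ha : x.involute a = a) (hb : x.involute b = b) :=
    show x.involute (a + b) = a + b by rw [map_add, ha, hb]
  neg_mem' {a} (ha : x.involute a = a) := show x.involute (-a) = -a by rw [map_neg, ha]
  mul_mem' {a b} (ha : x.involute a = a) (hb : x.involute b = b) :=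
    show x.involute (a * b) = a * b by rw [involute_mul, ha, hb]

instance : CommRing x.evenSubring where
  mul_comm a b := Subtype.ext (x.commute_of_involute_eq a.2 b)

/-! ### Odd derivatives -/

/-- The derivative `∂/∂ξ_j`. -/
def oddDeriv (j : Fin q) : A →+ A :=
  AddMonoidHom.mk' (fun a => ∑ ν with j ∈ ν,
    (-1 : ℤ) ^ (below ν j).card • (x.incl (x.coeff ν a) * x.monomial (ν.erase j)))
    fun a b => by simp only [map_add, add_mul, smul_add, Finset.sum_add_distrib]

theorem oddDeriv_apply (j : Fin q) (a : A) : x.oddDeriv j a = ∑ ν with j ∈ ν,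
    (-1 : ℤ) ^ (below ν j).card • (x.incl (x.coeff ν a) * x.monomial (ν.erase j)) := rfl

theorem oddDeriv_incl_mul (j : Fin q) (c : C) (a : A) :
    x.oddDeriv j (x.incl c * a) = x.incl c * x.oddDeriv j a := by
  simp only [oddDeriv_apply, Finset.mul_sum, coeff_incl_mul, map_mul, mul_assoc, mul_smul_comm]

theorem oddDeriv_monomial (j : Fin q) (ν : Finset (Fin q)) : x.oddDeriv j (x.monomial ν) =
    if j ∈ ν then (-1 : ℤ) ^ (below ν j).card • x.monomial (ν.erase j) else 0 := by
  simp only [oddDeriv_apply, coeff_monomial, apply_ite x.incl, map_one, map_zero, ite_mul, one_mul,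
    zero_mul, smul_ite, smul_zero, Finset.sum_ite_eq', Finset.mem_filter, Finset.mem_univ,
    true_and]

theorem oddDeriv_one (j : Fin q) : x.oddDeriv j 1 = 0 := by
  simpa [monomial_empty] using x.oddDeriv_monomial j ∅

theorem oddDeriv_incl (j : Fin q) (c : C) : x.oddDeriv j (x.incl c) = 0 := by
  simpa [oddDeriv_one] using x.oddDeriv_incl_mul j c 1

theorem oddDeriv_gen_mul_monomial_self {j : Fin q} {ν : Finset (Fin q)} (hj : j ∉ ν) :
    x.oddDeriv j (x.gen j * x.monomial ν) = x.monomial ν := by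
  have hbelow : below (insert j ν) j = below ν j := by
    rw [below, Finset.filter_insert, if_neg (lt_irrefl j)]
  rw [gen_mul_monomial, if_neg hj, map_zsmul, oddDeriv_monomial,
    if_pos (Finset.mem_insert_self j ν), hbelow, Finset.erase_insert hj, smul_smul, ← mul_pow,
    neg_one_mul, neg_neg, one_pow, one_smul]

theorem monomial_eq_smul_gen_mul {j : Fin q} {ν : Finset (Fin q)} (hj : j ∈ ν) :
    x.monomial ν =
      (-1 : ℤ) ^ (below (ν.erase j) j).card • (x.gen j * x.monomial (ν.erase j)) := by
  rw [gen_mul_monomial, if_neg (Finset.notMem_erase j ν), Finset.insert_erase hj, smul_smul,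
    ← mul_pow, neg_one_mul, neg_neg, one_pow, one_smul]

theorem oddDeriv_gen_mul_monomial_of_ne {i j : Fin q} (hij : i ≠ j) (ν : Finset (Fin q)) :
    x.oddDeriv j (x.gen i * x.monomial ν) = -(x.gen i * x.oddDeriv j (x.monomial ν)) := by
  by_cases hj : j ∈ ν
  · have hswap : x.oddDeriv j (x.gen i * (x.gen j * x.monomial (ν.erase j))) =
        -(x.gen i * x.monomial (ν.erase j)) := by
      rw [← mul_assoc, x.gen_anticomm, neg_mul, map_neg, mul_assoc, gen_mul_monomial]
      split_ifs
      · rw [mul_zero, map_zero]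
      · rw [mul_smul_comm, map_zsmul, oddDeriv_gen_mul_monomial_self]
        simp [hij.symm]
    rw [x.monomial_eq_smul_gen_mul hj, mul_smul_comm, map_zsmul, hswap, map_zsmul,
      x.oddDeriv_gen_mul_monomial_self (Finset.notMem_erase j ν), mul_smul_comm, smul_neg]
  · rw [x.oddDeriv_monomial, if_neg hj, mul_zero, neg_zero, gen_mul_monomial]
    split_ifs
    · exact map_zero _
    · rw [map_zsmul, oddDeriv_monomial, if_neg, smul_zero]
      simp [hij.symm, hj]

theorem oddDeriv_gen_mul_monomial (i j : Fin q) (ν : Finset (Fin q)) :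
    x.oddDeriv j (x.gen i * x.monomial ν) =
      (if i = j then x.monomial ν else 0) - x.gen i * x.oddDeriv j (x.monomial ν) := by
  split_ifs with hij
  · subst hij
    by_cases hi : i ∈ ν
    · have herase := x.oddDeriv_gen_mul_monomial_self (Finset.notMem_erase i ν)
      rw [x.monomial_eq_smul_gen_mul hi, mul_smul_comm, ← mul_assoc, x.gen_mul_self, zero_mul,
        smul_zero, map_zero, map_zsmul, herase, mul_smul_comm, sub_self]
    · rw [x.oddDeriv_gen_mul_monomial_self hi, oddDeriv_monomial, if_neg hi, mul_zero, sub_zero]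
  · rw [zero_sub, x.oddDeriv_gen_mul_monomial_of_ne hij]

theorem oddDeriv_gen_mul (i j : Fin q) (a : A) :
    x.oddDeriv j (x.gen i * a) = (if i = j then a else 0) - x.gen i * x.oddDeriv j a := by
  conv_lhs => rw [← x.sum_coeff a]
  conv_rhs => rw [← x.sum_coeff a]
  simp only [Finset.mul_sum, map_sum, gen_mul_incl_mul, oddDeriv_incl_mul,
    oddDeriv_gen_mul_monomial, mul_sub, Finset.sum_sub_distrib]
  split_ifs <;> simp

theorem oddDeriv_mul (j : Fin q) (a b : A) :
    x.oddDeriv j (a * b) = x.oddDeriv j a * b + x.involute a * x.oddDeriv j b := by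
  induction a using x.induction with
  | one => rw [one_mul, oddDeriv_one, involute_one, zero_mul, one_mul, zero_add]
  | add a a' h h' => simp only [add_mul, map_add, h, h', add_add_add_comm]
  | incl_mul c a h =>
    simp only [mul_assoc, involute_incl_mul, oddDeriv_incl_mul, h, mul_add]
  | gen_mul i a h =>
    simp only [mul_assoc, oddDeriv_gen_mul, involute_gen_mul, h, sub_mul, neg_mul, mul_add,
      ite_mul, zero_mul, sub_add_eq_sub_sub, ← sub_eq_add_neg]

theorem oddDeriv_gen (i j : Fin q) : x.oddDeriv j (x.gen i) = if i = j then 1 else 0 := by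
  simpa [oddDeriv_one] using x.oddDeriv_gen_mul i j 1

theorem involute_oddDeriv (j : Fin q) (a : A) :
    x.involute (x.oddDeriv j a) = -x.oddDeriv j (x.involute a) := by
  induction a using x.induction with
  | one => rw [involute_one, oddDeriv_one, map_zero, neg_zero]
  | add a a' h h' => simp only [map_add, h, h', neg_add]
  | incl_mul c a h => rw [oddDeriv_incl_mul, involute_incl_mul, involute_incl_mul,
      oddDeriv_incl_mul, h, mul_neg]
  | gen_mul i a h =>
    simp only [oddDeriv_gen_mul, involute_gen_mul, map_sub, map_neg, h, mul_neg, neg_neg, neg_sub,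
      apply_ite x.involute, map_zero]

theorem oddDeriv_oddDeriv (i j : Fin q) (a : A) :
    x.oddDeriv i (x.oddDeriv j a) = -x.oddDeriv j (x.oddDeriv i a) := by
  induction a using x.induction with
  | one => rw [oddDeriv_one, oddDeriv_one, map_zero, map_zero, neg_zero]
  | add a a' h h' => simp only [map_add, h, h', neg_add]
  | incl_mul c a h => simp only [oddDeriv_incl_mul, h, mul_neg]
  | gen_mul k a h =>
    simp only [oddDeriv_gen_mul, map_sub, h, apply_ite (x.oddDeriv _), map_zero, mul_neg]
    abel

theorem coeff_univ_oddDeriv (j : Fin q) (a : A) : x.coeff Finset.univ (x.oddDeriv j a) = 0 := by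
  rw [oddDeriv_apply, map_sum]
  refine Finset.sum_eq_zero fun ν _ => ?_
  have hne : Finset.univ ≠ ν.erase j :=
    fun h => Finset.notMem_erase j ν (h ▸ Finset.mem_univ j)
  rw [map_zsmul, coeff_incl_mul_monomial, if_neg hne, smul_zero]

theorem coeff_empty_oddDeriv (j : Fin q) (a : A) :
    x.coeff ∅ (x.oddDeriv j a) = x.coeff {j} a := by
  rw [oddDeriv_apply, map_sum, Finset.sum_eq_single {j}]
  · have hbelow : below {j} j = ∅ := by simp [below]
    rw [hbelow, Finset.card_empty, pow_zero, one_smul, Finset.erase_singleton,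
      coeff_incl_mul_monomial, if_pos rfl]
  · intro ν hν hne
    have hj : j ∈ ν := (Finset.mem_filter.1 hν).2
    rw [map_zsmul, coeff_incl_mul_monomial, if_neg, smul_zero]
    intro h
    rw [← Finset.insert_erase hj, ← h] at hne
    exact hne rfl
  · simp

/-! ### Even derivatives -/

section EvenDeriv

variable {R : Type*} [CommSemiring R] [Algebra R C] (d : Derivation R C C)

/-- The extension of a derivation `d` of the constants to the Grassmann algebra, which kills the
generators. -/
def evenDeriv : A →+ A :=
  AddMonoidHom.mk' (fun a => ∑ ν, x.incl (d (x.coeff ν a)) * x.monomial ν)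
    fun a b => by simp only [map_add, add_mul, Finset.sum_add_distrib]

theorem evenDeriv_apply (a : A) :
    x.evenDeriv d a = ∑ ν, x.incl (d (x.coeff ν a)) * x.monomial ν := rfl

theorem coeff_evenDeriv (a : A) (ν : Finset (Fin q)) :
    x.coeff ν (x.evenDeriv d a) = d (x.coeff ν a) :=
  x.coeff_sum (fun ν => d (x.coeff ν a)) ν

theorem evenDeriv_incl_mul (c : C) (a : A) :
    x.evenDeriv d (x.incl c * a) = x.incl c * x.evenDeriv d a + x.incl (d c) * a :=
  x.ext_coeff fun ν => by
    simp only [coeff_evenDeriv, coeff_incl_mul, map_add, d.leibniz, smul_eq_mul, mul_comm]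

theorem evenDeriv_monomial (ν : Finset (Fin q)) : x.evenDeriv d (x.monomial ν) = 0 :=
  x.ext_coeff fun μ => by
    rw [coeff_evenDeriv, coeff_monomial, map_zero]
    split_ifs <;> simp

theorem evenDeriv_one : x.evenDeriv d 1 = 0 := x.monomial_empty ▸ x.evenDeriv_monomial d ∅

theorem evenDeriv_gen (j : Fin q) : x.evenDeriv d (x.gen j) = 0 :=
  x.monomial_singleton j ▸ x.evenDeriv_monomial d {j}

theorem evenDeriv_incl (c : C) : x.evenDeriv d (x.incl c) = x.incl (d c) := by
  simpa [evenDeriv_one] using x.evenDeriv_incl_mul d c 1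

theorem evenDeriv_gen_mul (j : Fin q) (a : A) :
    x.evenDeriv d (x.gen j * a) = x.gen j * x.evenDeriv d a := by
  refine DFunLike.congr_fun (x.addHom_ext
    (f := (x.evenDeriv d).comp (AddMonoidHom.mulLeft (x.gen j)))
    (g := (AddMonoidHom.mulLeft (x.gen j)).comp (x.evenDeriv d)) fun c ν => ?_) a
  simp only [AddMonoidHom.comp_apply, AddMonoidHom.coe_mulLeft, gen_mul_incl_mul,
    evenDeriv_incl_mul, evenDeriv_monomial, mul_zero, zero_add, gen_mul_monomial]
  split_ifs
  · simp
  · rw [map_zsmul, evenDeriv_monomial, smul_zero, mul_zero, zero_add]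

theorem evenDeriv_mul (a b : A) :
    x.evenDeriv d (a * b) = a * x.evenDeriv d b + x.evenDeriv d a * b := by
  induction a using x.induction with
  | one => rw [one_mul, one_mul, evenDeriv_one, zero_mul, add_zero]
  | add a a' h h' => simp only [add_mul, map_add, h, h', add_add_add_comm]
  | incl_mul c a h =>
    simp only [mul_assoc, x.evenDeriv_incl_mul d, h, mul_add, add_mul, add_assoc]
  | gen_mul j a h => simp only [mul_assoc, evenDeriv_gen_mul, h, mul_add]

theorem evenDeriv_smul [Algebra R A] (hincl : ∀ r, x.incl (algebraMap R C r) = algebraMap R A r)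
    (r : R) (a : A) : x.evenDeriv d (r • a) = r • x.evenDeriv d a :=
  x.ext_coeff fun ν => by
    rw [coeff_evenDeriv, x.coeff_smul hincl, x.coeff_smul hincl, coeff_evenDeriv, d.map_smul]

end EvenDeriv

/-- Two homomorphisms `φ` and `ψ` into the Grassmann algebra that agree modulo degree `k + 1`
differ in the degrees below `2 * (k + 1)` by a derivation. -/
def coeffSubDerivation {R : Type*} [CommSemiring R] [Algebra R C] [Algebra R A]
    (hincl : ∀ r, x.incl (algebraMap R C r) = algebraMap R A r) (φ ψ : C →ₐ[R] A)
    (hψ : ∀ c, ψ c = x.incl c) (k : ℕ) (hφ : ∀ c, φ c - ψ c ∈ x.filtration (k + 1))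
    (ν : Finset (Fin q)) (hν : ν.card < k + 1 + (k + 1)) : Derivation R C C :=
  Derivation.mk'
    { toFun := fun c => x.coeff ν (φ c - ψ c)
      map_add' := fun a b => by rw [map_add, map_add, add_sub_add_comm, map_add]
      map_smul' := fun r a => by
        rw [map_smul, map_smul, ← smul_sub, x.coeff_smul hincl, RingHom.id_apply] }
    fun a b => by
      have hsplit : φ (a * b) - ψ (a * b) = x.incl a * (φ b - ψ b) + x.incl b * (φ a - ψ a) +
          (φ a - ψ a) * (φ b - ψ b) := by
        rw [map_mul, map_mul, x.incl_comm b, ← hψ, ← hψ]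
        noncomm_ring
      change x.coeff ν (φ (a * b) - ψ (a * b)) =
        a * x.coeff ν (φ b - ψ b) + b * x.coeff ν (φ a - ψ a)
      rw [hsplit, map_add, map_add, x.mul_mem_filtration (hφ a) (hφ b) ν hν, add_zero,
        coeff_incl_mul, coeff_incl_mul]

theorem coeffSubDerivation_apply {R : Type*} [CommSemiring R] [Algebra R C] [Algebra R A]
    (hincl : ∀ r, x.incl (algebraMap R C r) = algebraMap R A r) (φ ψ : C →ₐ[R] A)
    (hψ : ∀ c, ψ c = x.incl c) (k : ℕ) (hφ : ∀ c, φ c - ψ c ∈ x.filtration (k + 1))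
    (ν : Finset (Fin q)) (hν : ν.card < k + 1 + (k + 1)) (c : C) :
    x.coeffSubDerivation hincl φ ψ hψ k hφ ν hν c = x.coeff ν (φ c - ψ c) := rfl

end GrassmannFrame

/-! ### Changing the embedding of the constants -/

namespace GrassmannFrame

variable {q : ℕ} {C A : Type*} [CommRing C] [Ring A]

theorem bijective_of_sub_mem_filtration_succ (x : GrassmannFrame q C A) (T : AddMonoid.End A)
    (hT : ∀ k, ∀ a ∈ x.filtration k, T a - a ∈ x.filtration (k + 1)) : Function.Bijective T := by
  have hpow : ∀ k a, ((T - 1) ^ k) a ∈ x.filtration k := by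
    intro k
    induction k with
    | zero => exact fun a => x.mem_filtration_zero _
    | succ k ih => exact fun a => pow_succ' (T - 1) k ▸ hT k _ (ih a)
  have hnil : IsNilpotent (T - 1) :=
    ⟨q + 1, AddMonoidHom.ext fun a => x.eq_zero_of_mem_filtration q.lt_succ_self (hpow (q + 1) a)⟩
  obtain ⟨u, hu⟩ : IsUnit T := by simpa using hnil.isUnit_one_add
  subst hu
  exact Function.bijective_iff_has_inverse.2 ⟨(↑u⁻¹ : AddMonoid.End A),
    DFunLike.congr_fun u.inv_mul, DFunLike.congr_fun u.mul_inv⟩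

theorem bijective_of_sub_mem_filtration (x : GrassmannFrame q C A) (π : C →+* A)
    (h : ∀ c, π c - x.incl c ∈ x.filtration 1) :
    Function.Bijective fun c : Finset (Fin q) → C => ∑ ν, π (c ν) * oddMonomial x.gen ν := by
  let T : AddMonoid.End A :=
    AddMonoidHom.mk' (fun a => ∑ ν, π (x.coeff ν a) * x.monomial ν) fun a b => by
      simp only [map_add, add_mul, Finset.sum_add_distrib]
  have hT : Function.Bijective T := by
    refine x.bijective_of_sub_mem_filtration_succ T fun k a ha => ?_
    have hsub : T a - a = ∑ ν, (π (x.coeff ν a) - x.incl (x.coeff ν a)) * x.monomial ν := by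
      simp only [sub_mul, Finset.sum_sub_distrib, x.sum_coeff]
      rfl
    rw [hsub]
    refine sum_mem fun ν _ => ?_
    by_cases hν : ν.card < k
    · rw [ha ν hν, map_zero, map_zero, sub_zero, zero_mul]
      exact zero_mem _
    · exact x.filtration_antitone (by omega)
        (x.mul_mem_filtration (h _) (x.monomial_mem_filtration ν))
  have hcomp : (fun c : Finset (Fin q) → C => ∑ ν, π (c ν) * oddMonomial x.gen ν) =
      T ∘ x.expansion := by
    funext c
    exact Finset.sum_congr rfl fun ν _ =>
      congrArg (fun b => π b * x.monomial ν) (x.coeff_sum c ν).symm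
  rw [hcomp]
  exact hT.comp x.expansion.bijective

end GrassmannFrame

/-! ### Jacobi's formula -/

section Jacobi

variable {n : ℕ} {E : Type*} [CommRing E]

theorem derivation_prod {R B ι : Type*} [CommRing R] [Algebra R E] [AddCommGroup B] [Module R B]
    [Module E B] [DecidableEq ι] (D : Derivation R E B) (s : Finset ι) (f : ι → E) :
    D (∏ i ∈ s, f i) = ∑ i ∈ s, (∏ k ∈ s.erase i, f k) • D (f i) := by
  induction s using Finset.induction_on with
  | empty => simp
  | insert a s ha ih =>
    rw [Finset.prod_insert ha, D.leibniz, ih, Finset.sum_insert ha, Finset.erase_insert ha,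
      Finset.smul_sum, add_comm]
    refine congrArg _ (Finset.sum_congr rfl fun i hi => ?_)
    have hia : a ≠ i := fun h => ha (h ▸ hi)
    rw [Finset.erase_insert_of_ne hia,
      Finset.prod_insert fun h => ha (Finset.mem_of_mem_erase h), mul_smul]

theorem adjugate_apply_eq_sum_perm (M : Matrix (Fin n) (Fin n) E) (i j : Fin n) :
    M.adjugate j i = ∑ σ : Equiv.Perm (Fin n), if σ j = i then
      (Equiv.Perm.sign σ : ℤ) • ∏ k ∈ Finset.univ.erase j, M (σ k) k else 0 := by
  rw [Matrix.adjugate_apply, Matrix.det_apply]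
  refine Finset.sum_congr rfl fun σ _ => ?_
  split_ifs with h
  · rw [← Finset.mul_prod_erase _ _ (Finset.mem_univ j), h, Matrix.updateRow_self,
      Pi.single_eq_same, one_mul]
    refine congrArg _ (Finset.prod_congr rfl fun k hk => ?_)
    rw [Matrix.updateRow_ne fun hki => Finset.ne_of_mem_erase hk (σ.injective (hki.trans h.symm))]
  · rw [Finset.prod_eq_zero (Finset.mem_univ (σ.symm i)), smul_zero]
    have hne : σ.symm i ≠ j := fun hj => h (by rw [← hj, Equiv.apply_symm_apply])
    rw [Equiv.apply_symm_apply, Matrix.updateRow_self, Pi.single_eq_of_ne hne]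

theorem derivation_det {R B : Type*} [CommRing R] [Algebra R E] [AddCommGroup B] [Module R B]
    [Module E B] (D : Derivation R E B) (M : Matrix (Fin n) (Fin n) E) :
    D M.det = ∑ i, ∑ j, M.adjugate j i • D (M i j) := by
  calc D M.det
      = ∑ σ : Equiv.Perm (Fin n), ∑ j, ((Equiv.Perm.sign σ : ℤ) •
          ∏ k ∈ Finset.univ.erase j, M (σ k) k) • D (M (σ j) j) := by
        rw [Matrix.det_apply, map_sum]
        refine Finset.sum_congr rfl fun σ _ => ?_
        rw [Units.smul_def, map_zsmul, derivation_prod, Finset.smul_sum]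
        exact Finset.sum_congr rfl fun j _ => (smul_assoc _ _ _).symm
    _ = ∑ σ : Equiv.Perm (Fin n), ∑ j, ∑ i, (if σ j = i then (Equiv.Perm.sign σ : ℤ) •
          ∏ k ∈ Finset.univ.erase j, M (σ k) k else 0) • D (M i j) := by
        simp only [ite_smul, zero_smul, Finset.sum_ite_eq, Finset.mem_univ, if_true]
    _ = ∑ i, ∑ j, M.adjugate j i • D (M i j) := by
        simp only [adjugate_apply_eq_sum_perm, Finset.sum_smul]
        rw [Finset.sum_comm, Finset.sum_comm' (t' := Finset.univ) (s' := fun _ => Finset.univ)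
          (by simp)]
        simp only [Finset.sum_comm (s := (Finset.univ : Finset (Equiv.Perm (Fin n))))]
        exact Finset.sum_comm

theorem map_leibnizDet {R S : Type*} [Ring R] [Ring S] (f : R →+* S)
    (M : Matrix (Fin n) (Fin n) R) : f (leibnizDet M) = leibnizDet (M.map f) := by
  simp only [leibnizDet, map_sum, map_mul, map_intCast, map_list_prod, List.map_ofFn,
    Function.comp_def, Matrix.map_apply]

end Jacobi

/-! ### Products of linear combinations of anticommuting elements -/

section LinearCombinations

variable {n : ℕ} {C A : Type*} [CommRing C] [Ring A] [Algebra C A]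

theorem sum_smul_mul_sum_smul_eq_zero {ι : Type*} {ξ : ι → A}
    (hanti : ∀ i j, ξ i * ξ j = -(ξ j * ξ i)) (hsq : ∀ i, ξ i * ξ i = 0) (s : Finset ι)
    (v : ι → C) : (∑ i ∈ s, v i • ξ i) * ∑ i ∈ s, v i • ξ i = 0 := by
  classical
  induction s using Finset.induction_on with
  | empty => simp
  | insert a s ha ih =>
    rw [Finset.sum_insert ha, add_mul, mul_add, mul_add, ih, smul_mul_smul_comm, hsq, smul_zero,
      zero_add, add_zero, Finset.mul_sum, Finset.sum_mul, ← Finset.sum_add_distrib]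
    refine Finset.sum_eq_zero fun i _ => ?_
    rw [smul_mul_smul_comm, smul_mul_smul_comm, hanti a i, smul_neg, mul_comm, neg_add_cancel]

/-- The product of the values of a square-zero linear map, as an alternating map. -/
def squareZeroProd (n : ℕ) {V : Type*} [AddCommGroup V] [Module C V] (L : V →ₗ[C] A)
    (hL : ∀ v, L v * L v = 0) : V [⋀^Fin n]→ₗ[C] A :=
  (ExteriorAlgebra.lift C ⟨L, hL⟩).toLinearMap.compAlternatingMap (ExteriorAlgebra.ιMulti C n)

theorem squareZeroProd_apply {V : Type*} [AddCommGroup V] [Module C V] (L : V →ₗ[C] A)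
    (hL : ∀ v, L v * L v = 0) (v : Fin n → V) :
    squareZeroProd n L hL v = (List.ofFn fun b => L (v b)).prod := by
  simp only [squareZeroProd, LinearMap.compAlternatingMap_apply, AlgHom.toLinearMap_apply,
    ExteriorAlgebra.ιMulti_apply, map_list_prod, List.map_ofFn, Function.comp_def,
    ExteriorAlgebra.lift_ι_apply]

theorem alternatingMap_eq_det_smul {B : Type*} [AddCommGroup B] [Module C B]
    (F : (Fin n → C) [⋀^Fin n]→ₗ[C] B) (M : Matrix (Fin n) (Fin n) C) :
    F M = M.det • F (1 : Matrix (Fin n) (Fin n) C) := by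
  let G : (Fin n → C) [⋀^Fin n]→ₗ[C] B := (LinearMap.toSpanSingleton C B
    (F (1 : Matrix (Fin n) (Fin n) C))).compAlternatingMap Matrix.detRowAlternating
  have hbasis : (fun i => Pi.basisFun C (Fin n) i) = (1 : Matrix (Fin n) (Fin n) C) := by
    ext i j
    rw [Pi.basisFun_apply, Matrix.one_eq_pi_single]
  have hFG_one : F (fun i => Pi.basisFun C (Fin n) i) = G fun i => Pi.basisFun C (Fin n) i := by
    rw [hbasis]
    change _ = (1 : Matrix (Fin n) (Fin n) C).det • F (1 : Matrix (Fin n) (Fin n) C)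
    rw [Matrix.det_one, one_smul]
  have hFG : F = G := by
    refine (Pi.basisFun C (Fin n)).ext_alternating fun v hv => ?_
    let σ : Equiv.Perm (Fin n) := Equiv.ofBijective v (Finite.injective_iff_bijective.1 hv)
    exact (F.map_perm _ σ).trans ((congrArg _ hFG_one).trans (G.map_perm _ σ).symm)
  exact DFunLike.congr_fun hFG M

theorem prod_sum_smul_eq_det_smul {ξ : Fin n → A} (hanti : ∀ i j, ξ i * ξ j = -(ξ j * ξ i))
    (hsq : ∀ i, ξ i * ξ i = 0) (M : Matrix (Fin n) (Fin n) C) :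
    (List.ofFn fun b => ∑ c, M b c • ξ c).prod = M.det • (List.ofFn ξ).prod := by
  let L : (Fin n → C) →ₗ[C] A := Fintype.linearCombination C ξ
  have hL (v : Fin n → C) : L v * L v = 0 :=
    sum_smul_mul_sum_smul_eq_zero hanti hsq Finset.univ v
  have hone (b : Fin n) : L ((1 : Matrix (Fin n) (Fin n) C) b) = ξ b := by
    simp only [L, Fintype.linearCombination_apply, Matrix.one_apply, ite_smul, one_smul,
      zero_smul, Finset.sum_ite_eq, Finset.mem_univ, if_true]
  calc (List.ofFn fun b => ∑ c, M b c • ξ c).prod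
      = squareZeroProd n L hL M := (squareZeroProd_apply L hL M).symm
    _ = M.det • squareZeroProd n L hL (1 : Matrix (Fin n) (Fin n) C) :=
        alternatingMap_eq_det_smul _ M
    _ = M.det • (List.ofFn ξ).prod := congrArg _ <| (squareZeroProd_apply L hL _).trans <|
        congrArg (fun f => (List.ofFn f).prod) (funext hone)

end LinearCombinations

/-! ### The Berezinian of a change of odd generators -/

namespace GrassmannFrame

variable {q : ℕ} {C A : Type*} [CommRing C] [Ring A]

/-- Odd elements of `A`, relative to a frame: those with no monomials of even degree. -/
def IsOdd (x : GrassmannFrame q C A) (a : A) : Prop := ∀ ν, Even ν.card → x.coeff ν a = 0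

theorem IsOdd.involute_eq {x : GrassmannFrame q C A} {a : A} (h : x.IsOdd a) :
    x.involute a = -a := by
  refine x.ext_coeff fun ν => ?_
  rw [coeff_involute, map_neg]
  rcases Nat.even_or_odd ν.card with hν | hν
  · rw [h ν hν, mul_zero, neg_zero]
  · rw [hν.neg_one_pow, neg_one_mul]

theorem IsOdd.mem_filtration_one {x : GrassmannFrame q C A} {a : A} (h : x.IsOdd a) :
    a ∈ x.filtration 1 :=
  fun ν hν => h ν (by rw [Nat.lt_one_iff.1 hν]; exact Even.zero)

theorem involute_eq_involute {x y : GrassmannFrame q C A} (hincl : x.incl = y.incl)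
    (hodd : ∀ b, y.IsOdd (x.gen b)) (a : A) : x.involute a = y.involute a := by
  induction a using x.induction with
  | one => rw [involute_one, involute_one]
  | add a b ha hb => rw [map_add, map_add, ha, hb]
  | incl_mul c a ha => rw [involute_incl_mul, hincl, involute_incl_mul, ha]
  | gen_mul j a ha => rw [involute_gen_mul, involute_mul, ha, (hodd j).involute_eq, neg_mul]

theorem involute_oddDeriv_of_involute_eq_neg (y : GrassmannFrame q C A) (j : Fin q) {a : A}
    (ha : y.involute a = -a) : y.involute (y.oddDeriv j a) = y.oddDeriv j a := by
  rw [involute_oddDeriv, ha, map_neg, neg_neg]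

theorem oddDeriv_eq_sum_oddDeriv_gen_mul {x y : GrassmannFrame q C A} (hincl : x.incl = y.incl)
    (hodd : ∀ b, y.involute (x.gen b) = -x.gen b) (j : Fin q) (a : A) :
    y.oddDeriv j a = ∑ b, y.oddDeriv j (x.gen b) * x.oddDeriv b a := by
  induction a using x.induction with
  | one => simp only [oddDeriv_one, mul_zero, Finset.sum_const_zero]
  | add a b ha hb => simp only [map_add, ha, hb, mul_add, Finset.sum_add_distrib]
  | incl_mul c a ha =>
    simp only [oddDeriv_incl_mul]
    rw [hincl, oddDeriv_incl_mul, ha, Finset.mul_sum]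
    refine Finset.sum_congr rfl fun b _ => ?_
    rw [← mul_assoc, ← mul_assoc, y.incl_comm]
  | gen_mul i a ha =>
    have hterm (b : Fin q) : y.oddDeriv j (x.gen b) * x.oddDeriv b (x.gen i * a) =
        (if i = b then y.oddDeriv j (x.gen b) * a else 0) -
          x.gen i * (y.oddDeriv j (x.gen b) * x.oddDeriv b a) := by
      have hcomm := y.commute_of_involute_eq
        (y.involute_oddDeriv_of_involute_eq_neg j (hodd b)) (x.gen i)
      rw [x.oddDeriv_gen_mul, mul_sub, ← mul_assoc _ (x.gen i), hcomm, mul_assoc]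
      split_ifs <;> simp only [mul_zero]
    rw [Finset.sum_congr rfl fun b _ => hterm b, y.oddDeriv_mul, hodd, ha,
      Finset.sum_sub_distrib, neg_mul, ← sub_eq_add_neg, Finset.mul_sum, Finset.sum_ite_eq,
      if_pos (Finset.mem_univ i)]

/-- The odd derivative as an ordinary derivation: on even elements it has no sign. -/
def oddDerivation (y : GrassmannFrame q C A) (j : Fin q) : Derivation ℤ y.evenSubring A :=
  Derivation.mk' ((y.oddDeriv j).comp y.evenSubring.subtype.toAddMonoidHom).toIntLinearMap
    fun a b => by
      change y.oddDeriv j (a * b) = (a : A) * y.oddDeriv j b + (b : A) * y.oddDeriv j a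
      rw [oddDeriv_mul, show y.involute a = a from a.2, add_comm, y.commute_of_involute_eq b.2]

theorem oddDerivation_apply (y : GrassmannFrame q C A) (j : Fin q) (a : y.evenSubring) :
    y.oddDerivation j a = y.oddDeriv j a := rfl

/-- The Jacobian matrix `∂η_a/∂ξ_b` of two systems of odd generators `ξ` and `η`. -/
def jacobian (x y : GrassmannFrame q C A) : Matrix (Fin q) (Fin q) A :=
  Matrix.of fun b a => x.oddDeriv b (y.gen a)

/-- The two frames have the same constants and the generators of each are odd for the other. -/
structure Compatible (x y : GrassmannFrame q C A) : Prop where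
  incl_eq : x.incl = y.incl
  left_odd : ∀ b, y.IsOdd (x.gen b)
  right_odd : ∀ b, x.IsOdd (y.gen b)

theorem leibnizDet_map_subtype {x : GrassmannFrame q C A} {n : ℕ}
    (M : Matrix (Fin n) (Fin n) x.evenSubring) :
    leibnizDet (M.map x.evenSubring.subtype) = (M.det : A) := by
  rw [← map_leibnizDet, leibnizDet_eq_det]
  rfl

namespace Compatible

variable {x y : GrassmannFrame q C A}

theorem symm (h : Compatible x y) : Compatible y x :=
  ⟨h.incl_eq.symm, h.right_odd, h.left_odd⟩

theorem involute_eq (h : Compatible x y) (a : A) : x.involute a = y.involute a :=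
  involute_eq_involute h.incl_eq h.left_odd a

theorem oddDeriv_eq_sum (h : Compatible x y) (j : Fin q) (a : A) :
    y.oddDeriv j a = ∑ b, jacobian y x j b * x.oddDeriv b a :=
  oddDeriv_eq_sum_oddDeriv_gen_mul h.incl_eq (fun b => (h.left_odd b).involute_eq) j a

theorem jacobian_mul_jacobian (h : Compatible x y) : jacobian x y * jacobian y x = 1 := by
  ext b c
  rw [Matrix.mul_apply, Matrix.one_apply]
  simp only [eq_comm (a := b)]
  exact (h.symm.oddDeriv_eq_sum b (x.gen c)).symm.trans (x.oddDeriv_gen c b)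

theorem inverse_jacobian (h : Compatible x y) :
    Ring.inverse (jacobian y x) = jacobian x y :=
  Ring.inverse_unit ⟨jacobian y x, jacobian x y, h.symm.jacobian_mul_jacobian,
    h.jacobian_mul_jacobian⟩

/-- The Jacobian matrix over the commutative ring of even elements. -/
def evenJacobian (h : Compatible x y) : Matrix (Fin q) (Fin q) x.evenSubring :=
  Matrix.of fun b a => ⟨x.oddDeriv b (y.gen a),
    x.involute_oddDeriv_of_involute_eq_neg b (h.right_odd a).involute_eq⟩

theorem leibnizDet_jacobian (h : Compatible x y) :
    leibnizDet (jacobian x y) = (h.evenJacobian.det : A) :=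
  leibnizDet_map_subtype h.evenJacobian

/-- The inverse Jacobian matrix, over the same ring as `evenJacobian`. -/
def evenJacobianInv (h : Compatible x y) : Matrix (Fin q) (Fin q) x.evenSubring :=
  Matrix.of fun b a => ⟨y.oddDeriv b (x.gen a), (h.involute_eq _).trans <|
    y.involute_oddDeriv_of_involute_eq_neg b (h.left_odd a).involute_eq⟩

theorem evenJacobian_mul_evenJacobianInv (h : Compatible x y) :
    h.evenJacobian * h.evenJacobianInv = 1 := by
  refine Matrix.map_injective Subtype.val_injective ?_
  change (h.evenJacobian * h.evenJacobianInv).map x.evenSubring.subtype =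
    Matrix.map 1 x.evenSubring.subtype
  rw [Matrix.map_mul, Matrix.map_one _ (map_zero _) (map_one _)]
  exact h.jacobian_mul_jacobian

theorem adjugate_evenJacobian (h : Compatible x y) :
    h.evenJacobian.adjugate = h.evenJacobian.det • h.evenJacobianInv := by
  calc h.evenJacobian.adjugate
      = h.evenJacobian.adjugate * (h.evenJacobian * h.evenJacobianInv) := by
        rw [h.evenJacobian_mul_evenJacobianInv, mul_one]
    _ = h.evenJacobian.det • h.evenJacobianInv := by
        rw [← mul_assoc, Matrix.adjugate_mul, Matrix.smul_mul, one_mul]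

theorem leibnizDet_jacobian_mul_comm (h : Compatible x y) (a : A) :
    leibnizDet (jacobian x y) * a = a * leibnizDet (jacobian x y) := by
  rw [h.leibnizDet_jacobian]
  exact x.commute_of_involute_eq h.evenJacobian.det.2 a

theorem oddDeriv_leibnizDet_jacobian (h : Compatible x y) (b : Fin q) :
    x.oddDeriv b (leibnizDet (jacobian x y)) = ∑ i, ∑ j, leibnizDet (jacobian x y) *
      (jacobian y x j i * x.oddDeriv b (jacobian x y i j)) := by
  rw [h.leibnizDet_jacobian, ← oddDerivation_apply, derivation_det]
  refine Finset.sum_congr rfl fun i _ => Finset.sum_congr rfl fun j _ => ?_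
  rw [h.adjugate_evenJacobian, oddDerivation_apply, ← mul_assoc]
  rfl

-- Jacobi's formula and the anticommutation of odd derivatives make the two halves cancel.
theorem sum_oddDeriv_jacobian_mul_det (h : Compatible x y) (b : Fin q) :
    ∑ a, y.oddDeriv a (jacobian x y b a * leibnizDet (jacobian x y)) = 0 := by
  set w : A := leibnizDet (jacobian x y)
  have hleibniz (a : Fin q) : y.oddDeriv a (jacobian x y b a * w) =
      w * y.oddDeriv a (jacobian x y b a) + jacobian x y b a * y.oddDeriv a w := by
    rw [oddDeriv_mul, h.leibnizDet_jacobian_mul_comm, ← h.involute_eq]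
    congr 2
    exact (h.evenJacobian b a).2
  have hdet : ∑ a, jacobian x y b a * y.oddDeriv a w =
      ∑ i, ∑ j, w * (jacobian y x j i * x.oddDeriv b (jacobian x y i j)) :=
    (h.symm.oddDeriv_eq_sum b w).symm.trans (h.oddDeriv_leibnizDet_jacobian b)
  have hanti (i j : Fin q) :
      x.oddDeriv b (jacobian x y i j) = -x.oddDeriv i (jacobian x y b j) :=
    x.oddDeriv_oddDeriv b i _
  simp only [hleibniz, Finset.sum_add_distrib, hdet, hanti]
  rw [Finset.sum_comm, ← Finset.sum_add_distrib]
  refine Finset.sum_eq_zero fun j _ => ?_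
  rw [h.oddDeriv_eq_sum j, ← Finset.mul_sum, ← mul_add]
  simp only [mul_neg, Finset.sum_neg_distrib, add_neg_cancel, mul_zero]

theorem coeff_univ_oddDeriv_mul_det (h : Compatible x y) (b : Fin q) (a : A) :
    y.coeff Finset.univ (x.oddDeriv b a * leibnizDet (jacobian x y)) = 0 := by
  set w : A := leibnizDet (jacobian x y) with hw
  have heven (c : Fin q) : y.involute (jacobian x y b c * w) = jacobian x y b c * w := by
    rw [← h.involute_eq, hw, h.leibnizDet_jacobian]
    exact (h.evenJacobian b c * h.evenJacobian.det).2
  have hleibniz (c : Fin q) : y.oddDeriv c (jacobian x y b c * w * a) =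
      y.oddDeriv c (jacobian x y b c * w) * a + jacobian x y b c * y.oddDeriv c a * w := by
    rw [oddDeriv_mul, heven, mul_assoc _ w, mul_assoc _ _ w, h.leibnizDet_jacobian_mul_comm]
  have hdiv : x.oddDeriv b a * w = ∑ c, y.oddDeriv c (jacobian x y b c * w * a) := by
    rw [Finset.sum_congr rfl fun c _ => hleibniz c, Finset.sum_add_distrib, ← Finset.sum_mul,
      ← Finset.sum_mul, h.sum_oddDeriv_jacobian_mul_det b, zero_mul, zero_add,
      h.symm.oddDeriv_eq_sum b a]
  rw [hdiv, map_sum]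
  exact Finset.sum_eq_zero fun c _ => y.coeff_univ_oddDeriv c _

end Compatible

theorem prod_ofFn_mem_filtration (y : GrassmannFrame q C A) {n : ℕ} (f : Fin n → A)
    (hf : ∀ i, f i ∈ y.filtration 1) : (List.ofFn f).prod ∈ y.filtration n := by
  induction n with
  | zero => exact y.mem_filtration_zero _
  | succ n ih =>
    rw [List.ofFn_succ, List.prod_cons]
    exact y.filtration_antitone (by omega)
      (y.mul_mem_filtration (hf 0) (ih (fun i => f i.succ) fun i => hf i.succ))

theorem prod_ofFn_sub_mem_filtration (y : GrassmannFrame q C A) {n : ℕ} (f g : Fin n → A)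
    (hf : ∀ i, f i ∈ y.filtration 1) (hg : ∀ i, g i ∈ y.filtration 1)
    (hfg : ∀ i, f i - g i ∈ y.filtration 2) :
    (List.ofFn f).prod - (List.ofFn g).prod ∈ y.filtration (n + 1) := by
  induction n with
  | zero => simp only [List.ofFn_zero, List.prod_nil, sub_self, zero_mem]
  | succ n ih =>
    have htelescope (a b c d : A) : a * b - c * d = (a - c) * b + c * (b - d) := by noncomm_ring
    rw [List.ofFn_succ, List.ofFn_succ, List.prod_cons, List.prod_cons, htelescope]
    refine add_mem (y.filtration_antitone (by omega) (y.mul_mem_filtration (hfg 0)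
      (y.prod_ofFn_mem_filtration _ fun i => hf i.succ))) (y.filtration_antitone (by omega)
      (y.mul_mem_filtration (hg 0) (ih (fun i => f i.succ) (fun i => g i.succ)
        (fun i => hf i.succ) (fun i => hg i.succ) fun i => hfg i.succ)))

theorem monomial_univ (y : GrassmannFrame q C A) :
    y.monomial Finset.univ = (List.ofFn y.gen).prod := by
  simp only [monomial, oddMonomial, Finset.mem_univ, if_true]

theorem sub_sum_incl_mul_gen_mem_filtration_two (y : GrassmannFrame q C A) {a : A}
    (ha : a ∈ y.filtration 1) :
    a - ∑ c, y.incl (y.coeff {c} a) * y.gen c ∈ y.filtration 2 := by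
  intro ν hν
  have hcoeff (c : Fin q) : y.coeff ν (y.incl (y.coeff {c} a) * y.gen c) =
      if ν = {c} then y.coeff {c} a else 0 := by
    rw [← monomial_singleton, coeff_incl_mul_monomial]
  rw [map_sub, map_sum, Finset.sum_congr rfl fun c _ => hcoeff c]
  rcases Nat.lt_or_ge ν.card 1 with hν₀ | hν₁
  · rw [ha ν hν₀, Finset.sum_eq_zero fun c _ => if_neg ?_, sub_zero]
    rintro rfl
    exact absurd hν₀ (by simp)
  · obtain ⟨d, rfl⟩ := Finset.card_eq_one.1 (show ν.card = 1 by omega)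
    simp only [Finset.singleton_inj, Finset.sum_ite_eq, Finset.mem_univ, if_true, sub_self]

theorem prod_ofFn_eq_incl_det_mul_monomial_univ (y : GrassmannFrame q C A) (a : Fin q → A)
    (ha : ∀ b, a b ∈ y.filtration 1) :
    (List.ofFn a).prod =
      y.incl (Matrix.of fun b c => y.coeff {c} (a b)).det * y.monomial Finset.univ := by
  let _ : Algebra C A := y.incl.toAlgebra' y.incl_comm
  have hlinear := prod_sum_smul_eq_det_smul (C := C) y.gen_anticomm y.gen_mul_self
    (Matrix.of fun b c => y.coeff {c} (a b))
  simp only [Algebra.smul_def, RingHom.algebraMap_toAlgebra', Matrix.of_apply] at hlinear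
  rw [monomial_univ, ← hlinear, ← sub_eq_zero]
  exact y.eq_zero_of_mem_filtration q.lt_succ_self (y.prod_ofFn_sub_mem_filtration _ _ ha
    (fun b => sum_mem fun c _ => y.incl_mul_mem_filtration _ (y.gen_mem_filtration_one c))
    fun b => y.sub_sum_incl_mul_gen_mem_filtration_two (ha b))

theorem monomial_univ_mul (y : GrassmannFrame q C A) (a : A) :
    y.monomial Finset.univ * a = y.incl (y.body a) * y.monomial Finset.univ := by
  rw [y.incl_comm, ← sub_eq_zero, ← mul_sub]
  refine y.eq_zero_of_mem_filtration q.lt_succ_self (y.mul_mem_filtration (k := q) (l := 1) ?_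
    (y.sub_incl_coeff_empty_mem_filtration a))
  simpa only [Finset.card_univ, Fintype.card_fin] using y.monomial_mem_filtration Finset.univ

namespace Compatible

variable {x y : GrassmannFrame q C A}

theorem coeff_univ_monomial_univ_mul_det (h : Compatible x y) :
    y.coeff Finset.univ (x.monomial Finset.univ * leibnizDet (jacobian x y)) = 1 := by
  have hmatrix : (Matrix.of fun b c => y.coeff {c} (x.gen b)) =
      ((jacobian y x).map y.body).transpose := by
    ext b c
    exact (y.coeff_empty_oddDeriv c (x.gen b)).symm
  have hinv : (jacobian y x).map y.body * (jacobian x y).map y.body = 1 := by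
    rw [← Matrix.map_mul, h.symm.jacobian_mul_jacobian,
      Matrix.map_one _ (map_zero _) (map_one _)]
  rw [x.monomial_univ, y.prod_ofFn_eq_incl_det_mul_monomial_univ x.gen
      fun b => (h.left_odd b).mem_filtration_one, mul_assoc, monomial_univ_mul, ← mul_assoc,
    ← map_mul, map_leibnizDet, leibnizDet_eq_det, hmatrix, Matrix.det_transpose,
    ← Matrix.det_mul, hinv, Matrix.det_one, map_one, one_mul, coeff_monomial, if_pos rfl]

-- A monomial other than the top one is an odd derivative, so only the top one contributes.
theorem coeff_univ_mul_det (h : Compatible x y) (a : A) :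
    y.coeff Finset.univ (a * leibnizDet (jacobian x y)) = x.coeff Finset.univ a := by
  suffices hhom : (y.coeff Finset.univ).comp
      (AddMonoidHom.mulRight (leibnizDet (jacobian x y))) = x.coeff Finset.univ from
    DFunLike.congr_fun hhom a
  refine x.addHom_ext fun c ν => ?_
  simp only [AddMonoidHom.comp_apply, AddMonoidHom.coe_mulRight, coeff_incl_mul_monomial]
  rw [mul_assoc, h.incl_eq, coeff_incl_mul]
  split_ifs with hν
  · rw [← hν, h.coeff_univ_monomial_univ_mul_det, mul_one]
  · obtain ⟨b, hb⟩ : ∃ b, b ∉ ν := by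
      by_contra! hmem
      exact hν (Finset.eq_univ_iff_forall.2 hmem).symm
    have hderiv : x.monomial ν = x.oddDeriv b (x.gen b * x.monomial ν) := by
      rw [oddDeriv_gen_mul, oddDeriv_monomial, if_pos rfl, if_neg hb, mul_zero, sub_zero]
    rw [hderiv, h.coeff_univ_oddDeriv_mul_det, mul_zero]

end Compatible

end GrassmannFrame

/-! ### Hadamard's lemma -/

section ParametricIntegral

variable {E F : Type*} [NormedAddCommGroup E] [NormedSpace ℝ E] [NormedAddCommGroup F]
  [NormedSpace ℝ F]

theorem sub_eq_integral_fderiv_lineMap [CompleteSpace F] {f : E → F} (hf : ContDiff ℝ 1 f)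
    (a y : E) : f y - f a = ∫ t in (0 : ℝ)..1, fderiv ℝ f (AffineMap.lineMap a y t) (y - a) := by
  have hderiv (t : ℝ) : HasDerivAt (fun t : ℝ => f (AffineMap.lineMap a y t))
      (fderiv ℝ f (AffineMap.lineMap a y t) (y - a)) t :=
    (hf.differentiable one_ne_zero _).hasFDerivAt.comp_hasDerivAt t AffineMap.hasDerivAt_lineMap
  have hcont : Continuous fun t : ℝ => fderiv ℝ f (AffineMap.lineMap a y t) (y - a) :=
    ((hf.continuous_fderiv one_ne_zero).comp (AffineMap.lineMap_continuous)).clm_apply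
      continuous_const
  rw [intervalIntegral.integral_eq_sub_of_hasDerivAt (fun t _ => hderiv t)
    (hcont.intervalIntegrable _ _), AffineMap.lineMap_apply_one, AffineMap.lineMap_apply_zero]

variable [FiniteDimensional ℝ E]

theorem hasFDerivAt_parametric_intervalIntegral {f : ℝ × E → F} (hf : ContDiff ℝ 1 f) (a b : ℝ)
    (y : E) :
    HasFDerivAt (fun y => ∫ t in a..b, f (t, y))
      (∫ t in a..b, (fderiv ℝ f (t, y)).comp (ContinuousLinearMap.inr ℝ ℝ E)) y := by
  have hf' : Continuous fun z : ℝ × E => (fderiv ℝ f z).comp (ContinuousLinearMap.inr ℝ ℝ E) :=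
    (hf.continuous_fderiv one_ne_zero).clm_comp continuous_const
  obtain ⟨B, hB⟩ := ((isCompact_uIcc (a := a) (b := b)).prod
    (isCompact_closedBall y 1)).exists_bound_of_continuousOn hf'.continuousOn
  refine intervalIntegral.hasFDerivAt_integral_of_dominated_of_fderiv_le (bound := fun _ => B)
    (F := fun y t => f (t, y))
    (F' := fun y t => (fderiv ℝ f (t, y)).comp (ContinuousLinearMap.inr ℝ ℝ E))
    (Metric.closedBall_mem_nhds y one_pos) ?_ ?_ ?_ ?_ intervalIntegrable_const ?_
  · exact Filter.Eventually.of_forall fun z => Continuous.aestronglyMeasurable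
      (hf.continuous.comp (by fun_prop))
  · exact Continuous.intervalIntegrable (hf.continuous.comp (by fun_prop)) _ _
  · exact Continuous.aestronglyMeasurable (hf'.comp (by fun_prop : Continuous fun t : ℝ => (t, y)))
  · exact Filter.Eventually.of_forall fun t ht z hz => hB (t, z) ⟨Set.uIoc_subset_uIcc ht, hz⟩
  · exact Filter.Eventually.of_forall fun t _ z _ =>
      (hf.differentiable one_ne_zero (t, z)).hasFDerivAt.comp z (hasFDerivAt_prodMk_right t z)

theorem contDiff_parametric_intervalIntegral [CompleteSpace F] {f : ℝ × E → F}
    (hf : ContDiff ℝ ∞ f) (a b : ℝ) :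
    ContDiff ℝ ∞ fun y => ∫ t in a..b, f (t, y) := by
  rw [contDiff_infty]
  intro n
  induction n generalizing f with
  | zero =>
    rw [Nat.cast_zero, contDiff_zero]
    refine intervalIntegral.continuous_parametric_intervalIntegral_of_continuous' ?_ a b
    exact hf.continuous.comp (by fun_prop : Continuous fun z : E × ℝ => (z.2, z.1))
  | succ n ih =>
    have hderiv := hasFDerivAt_parametric_intervalIntegral (hf.of_le (by simp)) a b
    rw [Nat.cast_succ, contDiff_succ_iff_fderiv_apply]
    refine ⟨fun y => (hderiv y).differentiableAt, by simp, fun v => ?_⟩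
    have hpartial : (fun y => fderiv ℝ (fun y => ∫ t in a..b, f (t, y)) y v) =
        fun y => ∫ t in a..b, fderiv ℝ f (t, y) (0, v) := by
      funext y
      have hcont : Continuous fun t : ℝ =>
          (fderiv ℝ f (t, y)).comp (ContinuousLinearMap.inr ℝ ℝ E) :=
        ((hf.continuous_fderiv (by simp)).comp (by fun_prop)).clm_comp continuous_const
      rw [(hderiv y).fderiv,
        ContinuousLinearMap.intervalIntegral_apply (hcont.intervalIntegrable _ _)]
      rfl
    rw [hpartial]
    exact ih (f := fun z => fderiv ℝ f z (0, v))
      ((hf.fderiv_right (by simp)).clm_apply contDiff_const)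

theorem exists_contDiff_eq_add_apply_sub [CompleteSpace F] {f : E → F} (hf : ContDiff ℝ ∞ f)
    (a : E) : ∃ L : E → E →L[ℝ] F, ContDiff ℝ ∞ L ∧ ∀ y, f y = f a + L y (y - a) := by
  have hline : ContDiff ℝ ∞ fun z : ℝ × E => AffineMap.lineMap a z.2 z.1 := by
    simp only [AffineMap.lineMap_apply_module']
    fun_prop
  have hfderiv : ContDiff ℝ ∞ fun z : ℝ × E => fderiv ℝ f (AffineMap.lineMap a z.2 z.1) :=
    (hf.fderiv_right (m := ∞) (by simp)).comp hline
  refine ⟨fun y => ∫ t in (0 : ℝ)..1, fderiv ℝ f (AffineMap.lineMap a y t),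
    contDiff_parametric_intervalIntegral hfderiv 0 1, fun y => ?_⟩
  have hcont : Continuous fun t : ℝ => fderiv ℝ f (AffineMap.lineMap a y t) :=
    hfderiv.continuous.comp (continuous_id.prodMk continuous_const)
  rw [ContinuousLinearMap.intervalIntegral_apply (hcont.intervalIntegrable 0 1),
    ← sub_eq_integral_fderiv_lineMap (hf.of_le (by simp)), add_sub_cancel]

end ParametricIntegral

theorem exists_contDiff_eq_add_sum_mul {p : ℕ} {f : Model p → ℝ} (hf : ContDiff ℝ ∞ f)
    (a : Model p) :
    ∃ h : Fin p → Model p → ℝ, (∀ i, ContDiff ℝ ∞ (h i)) ∧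
      ∀ y, f y = f a + ∑ i, (y i - a i) * h i y := by
  obtain ⟨L, hL, hfL⟩ := exists_contDiff_eq_add_apply_sub hf a
  refine ⟨fun i y => L y (EuclideanSpace.single i 1), fun i => hL.clm_apply contDiff_const,
    fun y => ?_⟩
  have hbasis : y - a = ∑ i, (y i - a i) • EuclideanSpace.single i (1 : ℝ) := by
    ext j
    simp [Finset.sum_apply, Pi.single_apply]
  rw [hfL, hbasis, map_sum]
  simp only [map_smul, smul_eq_mul]

theorem exists_contDiff_eventuallyEq {E F : Type*} [NormedAddCommGroup E] [NormedSpace ℝ E]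
    [HasContDiffBump E] [NormedAddCommGroup F] [NormedSpace ℝ F] {n : ℕ∞} {f : E → F} {s : Set E}
    (hs : IsOpen s) (hf : ContDiffOn ℝ n f s) {a : E} (ha : a ∈ s) :
    ∃ f' : E → F, ContDiff ℝ n f' ∧ f' =ᶠ[nhds a] f := by
  obtain ⟨r, hr, hrs⟩ := Metric.isOpen_iff.1 hs a ha
  let φ : ContDiffBump a := ⟨r / 4, r / 2, by positivity, by linarith⟩
  have hφr : φ.rOut < r := half_lt_self hr
  refine ⟨fun y => φ y • f y, contDiff_iff_contDiffAt.2 fun y => ?_, ?_⟩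
  · by_cases hy : y ∈ s
    · exact φ.contDiff.contDiffAt.smul (hf.contDiffAt (hs.mem_nhds hy))
    · have hy' : y ∉ tsupport φ := by
        rw [φ.tsupport_eq]
        exact fun hball => hy (hrs (Metric.closedBall_subset_ball hφr hball))
      refine (contDiffAt_const (c := 0)).congr_of_eventuallyEq ?_
      filter_upwards [notMem_tsupport_iff_eventuallyEq.1 hy'] with z hz
      rw [hz, Pi.zero_apply, zero_smul]
  · filter_upwards [φ.eventuallyEq_one] with y hy
    rw [hy, Pi.one_apply, one_smul]

theorem integral_fderiv_apply_eq_zero {E : Type*} [NormedAddCommGroup E] [NormedSpace ℝ E]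
    [FiniteDimensional ℝ E] [MeasurableSpace E] [BorelSpace E] (μ : Measure E)
    [μ.IsAddHaarMeasure] {f : E → ℝ} (hf : ContDiff ℝ 1 f) (hc : HasCompactSupport f) (v : E) :
    ∫ y, fderiv ℝ f y v ∂μ = 0 := by
  have hcont : Continuous fun y => fderiv ℝ f y v :=
    (hf.continuous_fderiv one_ne_zero).clm_apply continuous_const
  have hparts := integral_mul_fderiv_eq_neg_fderiv_mul_of_integrable (μ := μ)
    (f := fun _ => (1 : ℝ)) (g := f) (v := v) (by simp)
    (by simpa using hcont.integrable_of_hasCompactSupport (hc.fderiv_apply ℝ v))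
    (by simpa using hf.continuous.integrable_of_hasCompactSupport hc)
    (fun _ _ => differentiableAt_const _) (fun y _ => hf.differentiable one_ne_zero y)
  simpa using hparts

theorem contDiff_indicator {E F : Type*} [NormedAddCommGroup E] [NormedSpace ℝ E]
    [NormedAddCommGroup F] [NormedSpace ℝ F] {n : WithTop ℕ∞} {f : E → F} {s K : Set E}
    (hs : IsOpen s) (hf : ContDiffOn ℝ n f s) (hK : IsClosed K) (hKs : K ⊆ s)
    (hfK : ∀ y ∈ s, y ∉ K → f y = 0) : ContDiff ℝ n (s.indicator f) := by
  refine contDiff_iff_contDiffAt.2 fun y => ?_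
  by_cases hy : y ∈ K
  · refine (hf.contDiffAt (hs.mem_nhds (hKs hy))).congr_of_eventuallyEq ?_
    filter_upwards [hs.mem_nhds (hKs hy)] with z hz
    exact Set.indicator_of_mem hz f
  · refine (contDiffAt_const (c := 0)).congr_of_eventuallyEq ?_
    filter_upwards [hK.isOpen_compl.mem_nhds hy] with z hz
    exact Set.indicator_apply_eq_zero.2 fun hzs => hfK z hzs hz

theorem setIntegral_fderiv_apply_eq_zero {E : Type*} [NormedAddCommGroup E] [NormedSpace ℝ E]
    [FiniteDimensional ℝ E] [MeasurableSpace E] [BorelSpace E] (μ : Measure E)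
    [μ.IsAddHaarMeasure] {f : E → ℝ} {s K : Set E} (hs : IsOpen s) (hf : ContDiffOn ℝ 1 f s)
    (hK : IsCompact K) (hKs : K ⊆ s) (hfK : ∀ y ∈ s, y ∉ K → f y = 0) (v : E) :
    ∫ y in s, fderiv ℝ f y v ∂μ = 0 := by
  have hzero (y : E) (hy : y ∉ K) : s.indicator f y = 0 :=
    Set.indicator_apply_eq_zero.2 fun hys => hfK y hys hy
  have hderiv : ∀ y ∈ s, fderiv ℝ f y v = fderiv ℝ (s.indicator f) y v := fun y hy => by
    have hlocal : f =ᶠ[nhds y] s.indicator f := by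
      filter_upwards [hs.mem_nhds hy] with z hz
      exact (Set.indicator_of_mem hz f).symm
    rw [hlocal.fderiv_eq]
  have hderiv_compl : ∀ y ∉ s, fderiv ℝ (s.indicator f) y v = 0 := fun y hy => by
    have hlocal : s.indicator f =ᶠ[nhds y] fun _ => 0 := by
      filter_upwards [hK.isClosed.isOpen_compl.mem_nhds fun hyK => hy (hKs hyK)] with z hz
      exact hzero z hz
    rw [hlocal.fderiv_eq, fderiv_const_apply, zero_apply]
  rw [setIntegral_congr_fun hs.measurableSet hderiv,
    setIntegral_eq_integral_of_forall_compl_eq_zero hderiv_compl]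
  exact integral_fderiv_apply_eq_zero μ (contDiff_indicator hs hf hK.isClosed hKs hfK)
    (HasCompactSupport.intro hK hzero) v

/-! ### Partial derivatives in charts -/

section ChartCalculus

variable {p : ℕ} {M₀ : Type u} [TopologicalSpace M₀]

theorem restr_source_eq {e : OpenPartialHomeomorph M₀ (Model p)} {V : Opens M₀}
    (hV : (V : Set M₀) ⊆ e.source) : (e.restr V).source = V := by
  rw [OpenPartialHomeomorph.restr_source' _ _ V.isOpen]
  exact Set.inter_eq_right.2 hV

theorem symm_mem_of_mem_target {e : OpenPartialHomeomorph M₀ (Model p)} {U : Opens M₀}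
    (hU : e.source = U) {y : Model p} (hy : y ∈ e.target) : e.symm y ∈ U :=
  (hU ▸ e.map_target hy : e.symm y ∈ (U : Set M₀))

variable [ChartedSpace (Model p) M₀]

theorem restr_mem_charts {e : OpenPartialHomeomorph M₀ (Model p)} (he : e ∈ charts p M₀)
    (V : Opens M₀) : e.restr V ∈ charts p M₀ :=
  restr_mem_maximalAtlas (contDiffGroupoid ∞ (𝓡 p)) he V.isOpen

/-- Evaluation of smooth functions at a point, as a ring homomorphism. -/
def evalAt {U : Opens M₀} (x : U) : Smooth p U →+* ℝ :=
  (Pi.evalRingHom (fun _ : U => ℝ) x).comp ContMDiffMap.coeFnRingHom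

theorem evalAt_apply {U : Opens M₀} (x : U) (f : Smooth p U) : evalAt x f = f x := rfl

theorem smoothRes_apply {U V : Opens M₀} (h : V ≤ U) (f : Smooth p U) (x : V) :
    smoothRes h f x = f ⟨x, h x.2⟩ := rfl

theorem inChart_of_mem {U : Opens M₀} (e : OpenPartialHomeomorph M₀ (Model p)) (g : Smooth p U)
    {y : Model p} (hy : e.symm y ∈ U) : inChart e g y = g ⟨e.symm y, hy⟩ :=
  Subtype.val_injective.extend_apply g 0 ⟨e.symm y, hy⟩

theorem inChart_of_notMem {U : Opens M₀} (e : OpenPartialHomeomorph M₀ (Model p)) (g : Smooth p U)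
    {y : Model p} (hy : e.symm y ∉ U) : inChart e g y = 0 :=
  Function.extend_apply' _ _ _ fun ⟨x, hx⟩ => hy (hx ▸ x.2)

theorem inChart_apply {U : Opens M₀} {e : OpenPartialHomeomorph M₀ (Model p)}
    (hU : e.source = U) (g : Smooth p U) (x : U) : inChart e g (e x) = g x := by
  have hx : e.symm (e x) = x := e.left_inv (hU ▸ x.2)
  rw [inChart_of_mem e g (hx.symm ▸ x.2)]
  exact congrArg g (Subtype.ext hx)

theorem inChart_add {U : Opens M₀} (e : OpenPartialHomeomorph M₀ (Model p)) (f g : Smooth p U) :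
    inChart e (f + g) = inChart e f + inChart e g := by
  funext y
  by_cases hy : e.symm y ∈ U
  · simp only [Pi.add_apply, inChart_of_mem e _ hy]
    rfl
  · simp only [Pi.add_apply, inChart_of_notMem e _ hy, add_zero]

theorem inChart_mul {U : Opens M₀} (e : OpenPartialHomeomorph M₀ (Model p)) (f g : Smooth p U) :
    inChart e (f * g) = inChart e f * inChart e g := by
  funext y
  by_cases hy : e.symm y ∈ U
  · simp only [Pi.mul_apply, inChart_of_mem e _ hy]
    rfl
  · simp only [Pi.mul_apply, inChart_of_notMem e _ hy, mul_zero]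

theorem inChart_smul {U : Opens M₀} (e : OpenPartialHomeomorph M₀ (Model p)) (r : ℝ)
    (g : Smooth p U) : inChart e (r • g) = r • inChart e g := by
  funext y
  by_cases hy : e.symm y ∈ U
  · simp only [Pi.smul_apply, inChart_of_mem e _ hy]
    rfl
  · simp only [Pi.smul_apply, inChart_of_notMem e _ hy, smul_zero]

theorem differentiableAt_inChart {U : Opens M₀} {e : OpenPartialHomeomorph M₀ (Model p)}
    (he : e ∈ charts p M₀) (hU : e.source = U) (g : Smooth p U) (x : U) :
    DifferentiableAt ℝ (inChart e g) (e x) :=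
  ((inChart_contDiffOn e he hU g).contDiffAt
    (e.open_target.mem_nhds (e.map_source (hU ▸ x.2)))).differentiableAt (by simp)

theorem chartDeriv_apply {U : Opens M₀} (e : OpenPartialHomeomorph M₀ (Model p))
    (he : e ∈ charts p M₀) (hU : e.source = U) (i : Fin p) (g : Smooth p U) (x : U) :
    chartDeriv e he hU i g x = fderiv ℝ (inChart e g) (e x) (EuclideanSpace.single i 1) := rfl

/-- The partial derivative `chartDeriv`, as a derivation of the algebra of smooth functions. -/
def chartDerivation {U : Opens M₀} (e : OpenPartialHomeomorph M₀ (Model p))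
    (he : e ∈ charts p M₀) (hU : e.source = U) (i : Fin p) :
    Derivation ℝ (Smooth p U) (Smooth p U) :=
  Derivation.mk'
    { toFun := chartDeriv e he hU i
      map_add' := fun f g => by
        ext x
        rw [ContMDiffMap.coe_add, Pi.add_apply, chartDeriv_apply, inChart_add,
          fderiv_add (differentiableAt_inChart he hU f x) (differentiableAt_inChart he hU g x)]
        rfl
      map_smul' := fun r g => by
        ext x
        rw [chartDeriv_apply, inChart_smul,
          fderiv_const_smul (differentiableAt_inChart he hU g x)]
        rfl }
    fun f g => by
      ext x
      change chartDeriv e he hU i (f * g) x =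
        f x * chartDeriv e he hU i g x + g x * chartDeriv e he hU i f x
      rw [chartDeriv_apply, inChart_mul,
        fderiv_mul (differentiableAt_inChart he hU f x) (differentiableAt_inChart he hU g x),
        inChart_apply hU, inChart_apply hU]
      rfl

theorem chartDerivation_apply {U : Opens M₀} (e : OpenPartialHomeomorph M₀ (Model p))
    (he : e ∈ charts p M₀) (hU : e.source = U) (i : Fin p) (g : Smooth p U) :
    chartDerivation e he hU i g = chartDeriv e he hU i g := rfl

theorem chartDeriv_smoothRes {U V : Opens M₀} {e e' : OpenPartialHomeomorph M₀ (Model p)}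
    (he : e ∈ charts p M₀) (hU : e.source = U) (he' : e' ∈ charts p M₀) (hV : e'.source = V)
    (h : V ≤ U) (hee' : ∀ x ∈ V, e x = e' x) (i : Fin p) (g : Smooth p U) :
    chartDeriv e' he' hV i (smoothRes h g) = smoothRes h (chartDeriv e he hU i g) := by
  ext x
  rw [smoothRes_apply, chartDeriv_apply, chartDeriv_apply]
  change _ = fderiv ℝ (inChart e g) (e x) _
  rw [hee' x x.2]
  refine congrArg (fun L : Model p →L[ℝ] ℝ => L (EuclideanSpace.single i 1))
    (Filter.EventuallyEq.fderiv_eq ?_)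
  filter_upwards [e'.open_target.mem_nhds (e'.map_source (hV ▸ x.2))] with y hy
  have hyV : e'.symm y ∈ V := symm_mem_of_mem_target hV hy
  have hsymm : e.symm y = e'.symm y := by
    conv_lhs => rw [← e'.right_inv hy, ← hee' _ hyV]
    exact e.left_inv (hU ▸ h hyV)
  have hyU : e.symm y ∈ U := hsymm ▸ h hyV
  rw [inChart_of_mem _ _ hyV, inChart_of_mem _ _ hyU, smoothRes_apply]
  exact congrArg g (Subtype.ext hsymm.symm)

theorem chartCoord_apply {U : Opens M₀} (e : OpenPartialHomeomorph M₀ (Model p))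
    (he : e ∈ charts p M₀) (hU : e.source = U) (i : Fin p) (x : U) :
    chartCoord e he hU i x = e x i := rfl

theorem contDiffAt_transition {e e' : OpenPartialHomeomorph M₀ (Model p)} (he : e ∈ charts p M₀)
    (he' : e' ∈ charts p M₀) {x : M₀} (hx : x ∈ e.source) (hx' : x ∈ e'.source) :
    ContDiffAt ℝ ∞ (fun y => e (e'.symm y)) (e' x) := by
  rw [← contMDiffAt_iff_contDiffAt]
  have he_at : ContMDiffAt (𝓡 p) (𝓡 p) ∞ e (e'.symm (e' x)) := by
    rw [e'.left_inv hx']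
    exact contMDiffAt_of_mem_maximalAtlas he hx
  exact he_at.comp (e' x) (contMDiffAt_symm_of_mem_maximalAtlas he' (e'.map_source hx'))

theorem chartDeriv_chartCoord {U : Opens M₀} {e e' : OpenPartialHomeomorph M₀ (Model p)}
    (he : e ∈ charts p M₀) (hU : e.source = U) (he' : e' ∈ charts p M₀) (hU' : e'.source = U)
    (i j : Fin p) (x : U) :
    chartDeriv e' he' hU' i (chartCoord e he hU j) x =
      (fderiv ℝ (fun y => e (e'.symm y)) (e' x) (EuclideanSpace.single i 1)) j := by
  have hx : (x : M₀) ∈ e.source := hU ▸ x.2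
  have hx' : (x : M₀) ∈ e'.source := hU' ▸ x.2
  have hlocal : inChart e' (chartCoord e he hU j) =ᶠ[nhds (e' x)] fun y => e (e'.symm y) j := by
    filter_upwards [e'.open_target.mem_nhds (e'.map_source hx')] with y hy
    rw [inChart_of_mem _ _ (symm_mem_of_mem_target hU' hy), chartCoord_apply]
  rw [chartDeriv_apply, hlocal.fderiv_eq]
  exact DFunLike.congr_fun ((EuclideanSpace.proj j : Model p →L[ℝ] ℝ).hasFDerivAt.comp (e' x)
    ((contDiffAt_transition he he' hx hx').differentiableAt (by simp)).hasFDerivAt).fderiv _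

theorem fderiv_transition_self {X E : Type*} [TopologicalSpace X] [NormedAddCommGroup E]
    [NormedSpace ℝ E] {e : OpenPartialHomeomorph X E} {x : X} (hx : x ∈ e.source) :
    fderiv ℝ (fun y => e (e.symm y)) (e x) = ContinuousLinearMap.id ℝ E := by
  have hlocal : (fun y => e (e.symm y)) =ᶠ[nhds (e x)] id := by
    filter_upwards [e.open_target.mem_nhds (e.map_source hx)] with y hy using e.right_inv hy
  rw [hlocal.fderiv_eq, fderiv_id]

theorem abs_det_fderiv_transition_self {X E : Type*} [TopologicalSpace X] [NormedAddCommGroup E]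
    [NormedSpace ℝ E] {e : OpenPartialHomeomorph X E} {x : X} (hx : x ∈ e.source) :
    |(fderiv ℝ (fun y => e (e.symm y)) (e x)).det| = 1 := by
  rw [fderiv_transition_self hx, ContinuousLinearMap.det, ContinuousLinearMap.coe_id,
    LinearMap.det_id, abs_one]

theorem chartDeriv_chartCoord_self {U : Opens M₀} (e : OpenPartialHomeomorph M₀ (Model p))
    (he : e ∈ charts p M₀) (hU : e.source = U) (i j : Fin p) :
    chartDeriv e he hU i (chartCoord e he hU j) = if i = j then 1 else 0 := by
  ext x
  rw [chartDeriv_chartCoord, fderiv_transition_self (hU ▸ x.2 : (x : M₀) ∈ e.source)]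
  rcases eq_or_ne i j with rfl | hij
  · simp
  · simp [hij, hij.symm]

theorem det_chartDeriv_chartCoord {U : Opens M₀} {e e' : OpenPartialHomeomorph M₀ (Model p)}
    (he : e ∈ charts p M₀) (hU : e.source = U) (he' : e' ∈ charts p M₀) (hU' : e'.source = U)
    (x : U) :
    (Matrix.of fun i j => chartDeriv e' he' hU' i (chartCoord e he hU j)).det x =
      (fderiv ℝ (fun y => e (e'.symm y)) (e' x)).det := by
  rw [← evalAt_apply, RingHom.map_det, ContinuousLinearMap.det,
    ← LinearMap.det_toMatrix (EuclideanSpace.basisFun (Fin p) ℝ).toBasis, ← Matrix.det_transpose]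
  refine congrArg Matrix.det (Matrix.ext fun j i => ?_)
  rw [LinearMap.toMatrix_apply]
  refine (chartDeriv_chartCoord he hU he' hU' i j x).trans ?_
  simp

theorem det_transition_mul {e e' : OpenPartialHomeomorph M₀ (Model p)} (he : e ∈ charts p M₀)
    (he' : e' ∈ charts p M₀) {x : M₀} (hx : x ∈ e.source) (hx' : x ∈ e'.source) :
    (fderiv ℝ (fun y => e' (e.symm y)) (e x)).det *
      (fderiv ℝ (fun y => e (e'.symm y)) (e' x)).det = 1 := by
  have hfwd := (contDiffAt_transition he he' hx hx').differentiableAt (by simp)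
  have hbwd := (contDiffAt_transition he' he hx' hx).differentiableAt (by simp)
  have hbwd' : HasFDerivAt (fun y => e' (e.symm y)) (fderiv ℝ (fun y => e' (e.symm y)) (e x))
      (e (e'.symm (e' x))) := by
    rw [e'.left_inv hx']
    exact hbwd.hasFDerivAt
  have hid : (fun y => e' (e.symm y)) ∘ (fun y => e (e'.symm y)) =ᶠ[nhds (e' x)] id := by
    have hsource : e'.symm ⁻¹' e.source ∈ nhds (e' x) :=
      e'.continuousAt_symm (e'.map_source hx')
        (by rw [e'.left_inv hx']; exact e.open_source.mem_nhds hx)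
    filter_upwards [hsource, e'.open_target.mem_nhds (e'.map_source hx')] with y hy hy'
    simp only [Function.comp_apply, id_eq, e.left_inv hy, e'.right_inv hy']
  have hcomp := ((hbwd'.comp (e' x) hfwd.hasFDerivAt).congr_of_eventuallyEq hid.symm).unique
    (hasFDerivAt_id (e' x))
  rw [ContinuousLinearMap.det, ContinuousLinearMap.det, ← LinearMap.det_comp,
    ← ContinuousLinearMap.toLinearMap_comp, hcomp, ContinuousLinearMap.coe_id,
    LinearMap.det_id]

theorem exists_smooth_eq_comp_chart_nhds {W : Opens M₀} (g : Smooth p W)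
    {e : OpenPartialHomeomorph M₀ (Model p)} (he : e ∈ charts p M₀) (a : W)
    (ha : (a : M₀) ∈ e.source) :
    ∃ f : Model p → ℝ, ContDiff ℝ ∞ f ∧ ∃ V : Opens M₀, (a : M₀) ∈ V ∧ (V : Set M₀) ⊆ e.source ∧
      ∃ h : V ≤ W, ∀ y : V, g ⟨y, h y.2⟩ = f (e y) := by
  let V₀ : Opens M₀ := W ⊓ ⟨e.source, e.open_source⟩
  have hV₀ : (V₀ : Set M₀) ⊆ e.source := fun _ hy => hy.2
  have hs : (e.restr V₀).source = V₀ := restr_source_eq hV₀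
  have ha₀ : (a : M₀) ∈ (e.restr V₀).source := by
    rw [hs]
    exact ⟨a.2, ha⟩
  let g₀ : Smooth p V₀ := smoothRes inf_le_left g
  obtain ⟨f, hf, hfg⟩ := exists_contDiff_eventuallyEq (e.restr V₀).open_target
    (inChart_contDiffOn (e.restr V₀) (restr_mem_charts he V₀) hs g₀)
    ((e.restr V₀).map_source ha₀)
  obtain ⟨t, ht, hto, hta⟩ := eventually_nhds_iff.1 hfg
  let V : Opens M₀ := ⟨_, (e.restr V₀).isOpen_inter_preimage hto⟩
  have hVV₀ : V ≤ V₀ := fun y hy => (hs ▸ hy.1 : y ∈ (V₀ : Set M₀))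
  refine ⟨f, hf, V, ⟨ha₀, hta⟩, fun y hy => hV₀ (hVV₀ hy), hVV₀.trans inf_le_left, fun y => ?_⟩
  exact (inChart_apply hs g₀ ⟨y, hVV₀ y.2⟩).symm.trans (ht (e y) y.2.2).symm

theorem exists_eq_add_sum_mul {W : Opens M₀} (g : Smooth p W)
    (e : OpenPartialHomeomorph M₀ (Model p)) (he : e ∈ charts p M₀) (a : W)
    (ha : (a : M₀) ∈ e.source) :
    ∃ (V : Opens M₀) (_ : V ≤ W) (_ : (a : M₀) ∈ V) (h : Fin p → Smooth p V),
      (V : Set M₀) ⊆ e.source ∧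
      ∀ y (hy : y ∈ W) (hyV : y ∈ V), g ⟨y, hy⟩ = g a + ∑ i, (e y i - e a i) * h i ⟨y, hyV⟩ := by
  obtain ⟨f, hf, V, haV, hVe, hVW, hgf⟩ := exists_smooth_eq_comp_chart_nhds g he a ha
  obtain ⟨h, hh, hfh⟩ := exists_contDiff_eq_add_sum_mul hf (e a)
  have hsmooth (i : Fin p) : ContMDiff (𝓡 p) 𝓘(ℝ) ∞ fun y : V => h i (e y) := fun y =>
    (hh i).contMDiff.contMDiffAt.comp y
      (contMDiffAt_subtype_iff.2 (contMDiffAt_of_mem_maximalAtlas he (hVe y.2)))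
  refine ⟨V, hVW, haV, fun i => toSmooth _ (hsmooth i), hVe, fun y _ hyV => ?_⟩
  exact (hgf ⟨y, hyV⟩).trans ((hfh (e y)).trans (congrArg (· + _) (hgf ⟨a, haV⟩).symm))

theorem integral_chartDeriv_eq_zero {U : Opens M₀} {e : OpenPartialHomeomorph M₀ (Model p)}
    (he : e ∈ charts p M₀) (hU : e.source = U) (i : Fin p) (h : Smooth p U) {K : Set M₀}
    (hK : IsCompact K) (hKU : K ⊆ U) (hh : ∀ x : U, (x : M₀) ∉ K → h x = 0) :
    ∫ y in e.target, inChart e (chartDeriv e he hU i h) y = 0 := by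
  have hderiv : ∀ y ∈ e.target, inChart e (chartDeriv e he hU i h) y =
      fderiv ℝ (inChart e h) y (EuclideanSpace.single i 1) := fun y hy => by
    rw [inChart_of_mem _ _ (symm_mem_of_mem_target hU hy), chartDeriv_apply, e.right_inv hy]
  have hKe : K ⊆ e.source := hU ▸ hKU
  rw [setIntegral_congr_fun e.open_target.measurableSet hderiv]
  refine setIntegral_fderiv_apply_eq_zero volume e.open_target
    ((inChart_contDiffOn e he hU h).of_le (by simp))
    (hK.image_of_continuousOn (e.continuousOn.mono hKe)) (e.mapsTo.mono_left hKe).image_subset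
    (fun y hy hyK => ?_) _
  rw [inChart_of_mem _ _ (symm_mem_of_mem_target hU hy)]
  exact hh _ fun hmem => hyK ⟨_, hmem, e.right_inv hy⟩

end ChartCalculus

/-! ### Integration of densities -/

section Integration

theorem measurableSet_image_inter_source {X Y : Type*} [TopologicalSpace X] [TopologicalSpace Y]
    [MeasurableSpace Y] [BorelSpace Y] (e : OpenPartialHomeomorph X Y) {B : Set X}
    (hB : MeasurableSet[borel X] B) : MeasurableSet (e '' (e.source ∩ B)) := by
  let _ : MeasurableSpace X := borel X
  have _ : BorelSpace X := ⟨rfl⟩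
  have hsymm : Continuous (e.target.domRestrict e.symm) :=
    continuousOn_iff_continuous_domRestrict.1 e.continuousOn_symm
  have himage : e '' (e.source ∩ B) = Subtype.val '' (e.target.domRestrict e.symm ⁻¹' B) := by
    rw [e.image_source_inter_eq', Set.domRestrict_eq, Set.preimage_comp,
      Subtype.image_preimage_coe]
  rw [himage]
  exact e.open_target.measurableSet.subtype_image (hsymm.measurable hB)

theorem image_transition {X E F : Type*} [TopologicalSpace X] [TopologicalSpace E]
    [TopologicalSpace F] {e : OpenPartialHomeomorph X F} {e' : OpenPartialHomeomorph X E}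
    {B : Set X} (hBe' : B ⊆ e'.source) : (fun y => e (e'.symm y)) '' (e' '' B) = e '' B := by
  rw [Set.image_image]
  exact Set.image_congr fun x hx => by rw [e'.left_inv (hBe' hx)]

theorem injOn_transition {X E F : Type*} [TopologicalSpace X] [TopologicalSpace E]
    [TopologicalSpace F] {e : OpenPartialHomeomorph X F} {e' : OpenPartialHomeomorph X E}
    {B : Set X} (hBe : B ⊆ e.source) (hBe' : B ⊆ e'.source) :
    Set.InjOn (fun y => e (e'.symm y)) (e' '' B) := by
  rintro _ ⟨x, hx, rfl⟩ _ ⟨z, hz, rfl⟩ hxz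
  simp only [e'.left_inv (hBe' hx), e'.left_inv (hBe' hz)] at hxz
  rw [e.injOn (hBe hx) (hBe hz) hxz]

variable {p : ℕ} {M₀ : Type u} [TopologicalSpace M₀] [ChartedSpace (Model p) M₀]

theorem ChartPartition.measurableSet_image_piece (P : ChartPartition p M₀) (n : P.ι) :
    MeasurableSet (P.chart n '' P.piece n) := by
  rw [← Set.inter_eq_right.2 (P.subset n)]
  exact measurableSet_image_inter_source _ (P.measurable n)

theorem ChartPartition.hasSum_setIntegral (P : ChartPartition p M₀)
    (e : OpenPartialHomeomorph M₀ (Model p)) {f : Model p → ℝ}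
    (hf : IntegrableOn f e.target volume) :
    HasSum (fun n => ∫ y in e '' (e.source ∩ P.piece n), f y) (∫ y in e.target, f y) := by
  have : Countable P.ι := P.countable
  have hunion : ⋃ n, e '' (e.source ∩ P.piece n) = e.target := by
    rw [← Set.image_iUnion, ← Set.inter_iUnion, P.cover, Set.inter_univ, e.image_source_eq_target]
  have hdisjoint : Pairwise (Function.onFun Disjoint fun n => e '' (e.source ∩ P.piece n)) :=
    fun m n hmn => Set.disjoint_image_image fun x hx z hz hxz =>
      Set.disjoint_left.1 (P.disjoint hmn) hx.2 (e.injOn hx.1 hz.1 hxz ▸ hz.2)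
  rw [← hunion] at hf ⊢
  exact hasSum_integral_iUnion (fun n => measurableSet_image_inter_source e (P.measurable n))
    hdisjoint hf

section ChangeOfVariables

variable {e e' : OpenPartialHomeomorph M₀ (Model p)}

theorem hasFDerivWithinAt_transition (he : e ∈ charts p M₀) (he' : e' ∈ charts p M₀)
    {B : Set M₀} (hBe : B ⊆ e.source) (hBe' : B ⊆ e'.source) :
    ∀ y ∈ e' '' B, HasFDerivWithinAt (fun y => e (e'.symm y))
      (fderiv ℝ (fun y => e (e'.symm y)) y) (e' '' B) y := by
  rintro _ ⟨x, hx, rfl⟩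
  exact ((contDiffAt_transition he he' (hBe hx) (hBe' hx)).differentiableAt
    (by simp)).hasFDerivAt.hasFDerivWithinAt

variable (he : e ∈ charts p M₀) (he' : e' ∈ charts p M₀) {B : Set M₀}
  (hB : MeasurableSet[borel M₀] B) (hBe : B ⊆ e.source) (hBe' : B ⊆ e'.source)
  {f f' : Model p → ℝ}
  (hff' : ∀ x ∈ B, f' (e' x) = |(fderiv ℝ (fun y => e (e'.symm y)) (e' x)).det| * f (e x))
include he he' hB hBe hBe' hff'

theorem integrableOn_image_chart_iff :
    IntegrableOn f (e '' B) volume ↔ IntegrableOn f' (e' '' B) volume := by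
  have hmeas : MeasurableSet (e' '' B) :=
    Set.inter_eq_right.2 hBe' ▸ measurableSet_image_inter_source e' hB
  rw [← image_transition hBe', integrableOn_image_iff_integrableOn_abs_det_fderiv_smul volume hmeas
    (hasFDerivWithinAt_transition he he' hBe hBe') (injOn_transition hBe hBe')]
  refine integrableOn_congr_fun ?_ hmeas
  rintro _ ⟨x, hx, rfl⟩
  simp only [hff' x hx, e'.left_inv (hBe' hx), smul_eq_mul]

theorem setIntegral_image_chart_eq : ∫ y in e '' B, f y = ∫ y in e' '' B, f' y := by
  have hmeas : MeasurableSet (e' '' B) :=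
    Set.inter_eq_right.2 hBe' ▸ measurableSet_image_inter_source e' hB
  rw [← image_transition hBe', integral_image_eq_integral_abs_det_fderiv_smul volume hmeas
    (hasFDerivWithinAt_transition he he' hBe hBe') (injOn_transition hBe hBe')]
  refine setIntegral_congr_fun hmeas ?_
  rintro _ ⟨x, hx, rfl⟩
  simp only [hff' x hx, e'.left_inv (hBe' hx), smul_eq_mul]

end ChangeOfVariables

namespace Density

/-- The coefficient function of a density in a chart, as a function on the model space. -/
def reading (ρ : Density p M₀) (e : OpenPartialHomeomorph M₀ (Model p)) (y : Model p) : ℝ :=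
  ρ.val e (e.symm y)

theorem reading_apply (ρ : Density p M₀) {e : OpenPartialHomeomorph M₀ (Model p)} {x : M₀}
    (hx : x ∈ e.source) : ρ.reading e (e x) = ρ.val e x := by
  rw [reading, e.left_inv hx]

theorem continuousOn_reading (ρ : Density p M₀) {e : OpenPartialHomeomorph M₀ (Model p)}
    (he : e ∈ charts p M₀) : ContinuousOn (ρ.reading e) e.target :=
  (ρ.smooth e he).continuousOn.comp e.continuousOn_symm fun _ hy => e.map_target hy

/-- The density `ρ` vanishes outside of `K`. -/
def VanishesOff (ρ : Density p M₀) (K : Set M₀) : Prop :=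
  ∀ e ∈ charts p M₀, ∀ x ∈ e.source, x ∉ K → ρ.val e x = 0

theorem VanishesOff.integrableOn_reading {ρ : Density p M₀}
    {e : OpenPartialHomeomorph M₀ (Model p)} (he : e ∈ charts p M₀) {K : Set M₀}
    (hK : IsCompact K) (hKe : K ⊆ e.source) (hρ : ρ.VanishesOff K) :
    IntegrableOn (ρ.reading e) e.target volume := by
  refine IntegrableOn.of_forall_sdiff_eq_zero
    (((ρ.continuousOn_reading he).mono (e.mapsTo.mono_left hKe).image_subset).integrableOn_compact
      (hK.image_of_continuousOn (e.continuousOn.mono hKe)))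
    e.open_target.measurableSet fun y hy => ?_
  exact hρ e he _ (e.map_target hy.1) fun hyK => hy.2 ⟨_, hyK, e.right_inv hy.1⟩

theorem VanishesOff.reading_eq_zero {ρ : Density p M₀} {K : Set M₀} (hρ : ρ.VanishesOff K)
    {e : OpenPartialHomeomorph M₀ (Model p)} (hKe : K ⊆ e.source) (P : ChartPartition p M₀)
    (n : P.ι) : ∀ y ∈ (P.chart n '' P.piece n) \ (P.chart n '' (e.source ∩ P.piece n)),
      ρ.reading (P.chart n) y = 0 := by
  rintro _ ⟨⟨x, hx, rfl⟩, hxe⟩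
  rw [ρ.reading_apply (P.subset n hx)]
  exact hρ _ (P.chart_mem n) x (P.subset n hx) fun hxK => hxe ⟨x, ⟨hKe hxK, hx⟩, rfl⟩

-- Applied with `F = id` and `F = |·|`, which give the integral and its absolute convergence.
theorem VanishesOff.hasSum_setIntegral_comp_reading {ρ : Density p M₀}
    {e : OpenPartialHomeomorph M₀ (Model p)} (he : e ∈ charts p M₀) {K : Set M₀}
    (hKe : K ⊆ e.source) (hρ : ρ.VanishesOff K) (P : ChartPartition p M₀) {F : ℝ → ℝ}
    (hF : ∀ a b, F (|a| * b) = |a| * F b)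
    (hint : IntegrableOn (fun y => F (ρ.reading e y)) e.target volume) :
    (∀ n, IntegrableOn (fun y => F (ρ.reading (P.chart n) y)) (P.chart n '' P.piece n) volume) ∧
      HasSum (fun n => ∫ y in P.chart n '' P.piece n, F (ρ.reading (P.chart n) y))
        (∫ y in e.target, F (ρ.reading e y)) := by
  have hF0 : F 0 = 0 := by simpa only [abs_zero, zero_mul] using hF 0 0
  have hzero (n : P.ι) (y : Model p)
      (hy : y ∈ (P.chart n '' P.piece n) \ (P.chart n '' (e.source ∩ P.piece n))) :
      F (ρ.reading (P.chart n) y) = 0 := by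
    rw [hρ.reading_eq_zero hKe P n y hy, hF0]
  have hmeas (n : P.ι) : MeasurableSet[borel M₀] (e.source ∩ P.piece n) :=
    MeasurableSet.inter (MeasurableSpace.measurableSet_generateFrom e.open_source) (P.measurable n)
  have hsubset (n : P.ι) : e.source ∩ P.piece n ⊆ (P.chart n).source :=
    Set.inter_subset_right.trans (P.subset n)
  have hchange (n : P.ι) (x : M₀) (hx : x ∈ e.source ∩ P.piece n) :
      F (ρ.reading (P.chart n) (P.chart n x)) =
        |(fderiv ℝ (fun y => e ((P.chart n).symm y)) (P.chart n x)).det| *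
          F (ρ.reading e (e x)) := by
    rw [ρ.reading_apply (hsubset n hx), ρ.reading_apply hx.1,
      ρ.change e he _ (P.chart_mem n) x ⟨hx.1, hsubset n hx⟩, mul_comm, hF]
  constructor
  · intro n
    refine IntegrableOn.of_forall_sdiff_eq_zero ?_ (P.measurableSet_image_piece n) (hzero n)
    rw [← integrableOn_image_chart_iff (f := fun y => F (ρ.reading e y)) he (P.chart_mem n)
      (hmeas n) Set.inter_subset_left (hsubset n) (hchange n)]
    exact hint.mono_set (e.mapsTo.mono_left Set.inter_subset_left).image_subset
  · refine (P.hasSum_setIntegral e hint).congr_fun fun n => ?_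
    rw [setIntegral_image_chart_eq (f' := fun y => F (ρ.reading (P.chart n) y)) he
      (P.chart_mem n) (hmeas n) Set.inter_subset_left (hsubset n) (hchange n)]
    exact setIntegral_eq_of_subset_of_forall_sdiff_eq_zero (P.measurableSet_image_piece n)
      (Set.image_mono Set.inter_subset_right) (hzero n)

theorem VanishesOff.hasIntegral {ρ : Density p M₀} {e : OpenPartialHomeomorph M₀ (Model p)}
    (he : e ∈ charts p M₀) {K : Set M₀} (hK : IsCompact K) (hKe : K ⊆ e.source)
    (hρ : ρ.VanishesOff K) : ρ.HasIntegral (∫ y in e.target, ρ.reading e y) := by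
  intro P
  have hint := hρ.integrableOn_reading he hK hKe
  obtain ⟨hintegrable, hsum⟩ :=
    hρ.hasSum_setIntegral_comp_reading he hKe P (F := id) (by simp) hint
  obtain ⟨-, habs⟩ :=
    hρ.hasSum_setIntegral_comp_reading he hKe P (F := abs) (by simp [abs_mul]) hint.abs
  exact ⟨hintegrable, habs.summable, hsum⟩

theorem HasIntegral.unique [SecondCountableTopology M₀] [IsManifold (𝓡 p) ∞ M₀]
    {ρ : Density p M₀} {I J : ℝ} (hI : ρ.HasIntegral I) (hJ : ρ.HasIntegral J) : I = J := by
  obtain ⟨P⟩ := ChartPartition.nonempty p M₀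
  exact (hI P).2.2.unique (hJ P).2.2

theorem hasIntegral_of_eq_sum {ι : Type*} (s : Finset ι) {ρ : Density p M₀}
    {τ : ι → Density p M₀} {I : ι → ℝ} (hτ : ∀ i ∈ s, (τ i).HasIntegral (I i))
    (hsum : ∀ e ∈ charts p M₀, ∀ x ∈ e.source, ρ.val e x = ∑ i ∈ s, (τ i).val e x) :
    ρ.HasIntegral (∑ i ∈ s, I i) := by
  intro P
  have hreading (n : P.ι) : ∀ y ∈ P.chart n '' P.piece n, ρ.val (P.chart n) ((P.chart n).symm y) =
      ∑ i ∈ s, (τ i).val (P.chart n) ((P.chart n).symm y) := by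
    rintro _ ⟨x, hx, rfl⟩
    rw [(P.chart n).left_inv (P.subset n hx)]
    exact hsum _ (P.chart_mem n) x (P.subset n hx)
  have hint (n : P.ι) : IntegrableOn (fun y => ρ.val (P.chart n) ((P.chart n).symm y))
      (P.chart n '' P.piece n) volume :=
    IntegrableOn.congr_fun (integrable_finsetSum s fun i hi => (hτ i hi P).1 n)
      (fun y hy => (hreading n y hy).symm) (P.measurableSet_image_piece n)
  refine ⟨hint, ?_, ?_⟩
  · refine Summable.of_nonneg_of_le (fun n => integral_nonneg fun _ => abs_nonneg _) (fun n => ?_)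
      (summable_sum fun i hi => (hτ i hi P).2.1)
    rw [← integral_finsetSum _ fun i hi => ((hτ i hi P).1 n).abs]
    refine setIntegral_mono_on (hint n).abs
      (integrable_finsetSum _ fun i hi => ((hτ i hi P).1 n).abs)
      (P.measurableSet_image_piece n) fun y hy => ?_
    rw [hreading n y hy]
    exact Finset.abs_sum_le_sum_abs _ _
  · refine (hasSum_sum fun i hi => (hτ i hi P).2.2).congr_fun fun n => ?_
    rw [← integral_finsetSum _ fun i hi => (hτ i hi P).1 n]
    exact setIntegral_congr_fun (P.measurableSet_image_piece n) (hreading n)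

end Density

end Integration

/-! ### Grassmann frames of a supermanifold -/

section Frames

namespace SuperalgebraSheaf

variable {X : Type u} [TopologicalSpace X] (𝒪 : SuperalgebraSheaf X) {U : Opens X}

theorem res_self (h : U ≤ U) (a : 𝒪.Sec U) : 𝒪.res h a = a := by
  have hid : 𝒪.sheaf.presheaf.map (homOfLE h).op = 𝟙 _ := 𝒪.sheaf.presheaf.map_id (op U)
  simp only [SuperalgebraSheaf.res, hid]
  rfl

theorem one_mem_parity (U : Opens X) : (1 : 𝒪.Sec U) ∈ 𝒪.parity U 0 := (𝒪.graded U).one_mem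

variable {𝒪}

theorem mul_mem_parity {i j : ZMod 2} {a b : 𝒪.Sec U} (ha : a ∈ 𝒪.parity U i)
    (hb : b ∈ 𝒪.parity U j) : a * b ∈ 𝒪.parity U (i + j) :=
  (𝒪.graded U).mul_mem ha hb

theorem eq_zero_of_mem_parity {i j : ZMod 2} (hij : i ≠ j) {a : 𝒪.Sec U}
    (hi : a ∈ 𝒪.parity U i) (hj : a ∈ 𝒪.parity U j) : a = 0 := by
  have hcases : ∀ i j : ZMod 2, i ≠ j → i = 0 ∧ j = 1 ∨ i = 1 ∧ j = 0 := by decide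
  have hdisjoint := Submodule.disjoint_def.1 (𝒪.isCompl U).disjoint
  obtain ⟨rfl, rfl⟩ | ⟨rfl, rfl⟩ := hcases i j hij
  · exact hdisjoint a hi hj
  · exact hdisjoint a hj hi

theorem even_mul_comm {a : 𝒪.Sec U} (ha : a ∈ 𝒪.parity U 0) (b : 𝒪.Sec U) : a * b = b * a := by
  have hb : b ∈ 𝒪.parity U 0 ⊔ 𝒪.parity U 1 := (𝒪.isCompl U).sup_eq_top ▸ Submodule.mem_top
  obtain ⟨b₀, hb₀, b₁, hb₁, rfl⟩ := Submodule.mem_sup.1 hb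
  have hcomm₀ : a * b₀ = b₀ * a := by simpa using 𝒪.supercomm U 0 0 a b₀ ha hb₀
  have hcomm₁ : a * b₁ = b₁ * a := by simpa using 𝒪.supercomm U 0 1 a b₁ ha hb₁
  rw [mul_add, add_mul, hcomm₀, hcomm₁]

theorem odd_anticomm {a b : 𝒪.Sec U} (ha : a ∈ 𝒪.parity U 1) (hb : b ∈ 𝒪.parity U 1) :
    a * b = -(b * a) := by
  simpa [ZMod.val_one] using 𝒪.supercomm U 1 1 a b ha hb

theorem odd_mul_self {a : 𝒪.Sec U} (ha : a ∈ 𝒪.parity U 1) : a * a = 0 := by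
  have htwo : (2 : ℝ) • (a * a) = 0 := by
    rw [two_smul, ← eq_neg_iff_add_eq_zero]
    exact odd_anticomm ha ha
  exact (smul_eq_zero.1 htwo).resolve_left two_ne_zero

end SuperalgebraSheaf

open SuperalgebraSheaf

variable {p q : ℕ} {M₀ : Type u} [TopologicalSpace M₀] [ChartedSpace (Model p) M₀]

namespace Splitting

variable {𝒪 : SuperalgebraSheaf M₀} {U : Opens M₀}

/-- The presentation of the sections over `W` as a Grassmann algebra over `C^∞(W)`. -/
def frame (σ : Splitting (p := p) q 𝒪 U) (W : Opens M₀) (hW : W ≤ U) :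
    GrassmannFrame q (Smooth p W) (𝒪.Sec W) where
  incl := (σ.pullback W hW : Smooth p W →+* 𝒪.Sec W)
  gen j := 𝒪.res hW (σ.odd j)
  incl_comm c a := even_mul_comm (σ.pullback_even W hW c) a
  gen_anticomm i j :=
    odd_anticomm (𝒪.map_parity hW 1 _ (σ.odd_mem i)) (𝒪.map_parity hW 1 _ (σ.odd_mem j))
  gen_mul_self i := odd_mul_self (𝒪.map_parity hW 1 _ (σ.odd_mem i))
  bijective := σ.bijective W hW

variable (σ : Splitting (p := p) q 𝒪 U) (W : Opens M₀) (hW : W ≤ U)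

theorem frame_incl (c : Smooth p W) : (σ.frame W hW).incl c = σ.pullback W hW c := rfl

theorem frame_incl_algebraMap (r : ℝ) :
    (σ.frame W hW).incl (algebraMap ℝ (Smooth p W) r) = algebraMap ℝ (𝒪.Sec W) r :=
  (σ.pullback W hW).commutes r

theorem gen_mem_parity (j : Fin q) : (σ.frame W hW).gen j ∈ 𝒪.parity W 1 :=
  𝒪.map_parity hW 1 _ (σ.odd_mem j)

theorem monomial_mem_parity (ν : Finset (Fin q)) :
    (σ.frame W hW).monomial ν ∈ 𝒪.parity W (ν.card : ZMod 2) := by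
  induction ν using Finset.induction_on_min with
  | empty =>
    rw [GrassmannFrame.monomial_empty, Finset.card_empty, Nat.cast_zero]
    exact 𝒪.one_mem_parity W
  | insert j s hj ih =>
    rw [GrassmannFrame.monomial_insert_of_lt _ hj,
      Finset.card_insert_of_notMem fun h => lt_irrefl _ (hj j h), Nat.cast_add, Nat.cast_one,
      add_comm]
    exact mul_mem_parity (σ.gen_mem_parity W hW j) ih

theorem incl_mul_monomial_mem_parity (c : Smooth p W) (ν : Finset (Fin q)) :
    (σ.frame W hW).incl c * (σ.frame W hW).monomial ν ∈ 𝒪.parity W (ν.card : ZMod 2) :=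
  zero_add (ν.card : ZMod 2) ▸
    mul_mem_parity (σ.pullback_even W hW c) (σ.monomial_mem_parity W hW ν)

variable {W}

theorem coeff_eq_zero_of_mem_parity {i : ZMod 2} {a : 𝒪.Sec W} (ha : a ∈ 𝒪.parity W i)
    {ν : Finset (Fin q)} (hν : (ν.card : ZMod 2) ≠ i) : (σ.frame W hW).coeff ν a = 0 := by
  let x := σ.frame W hW
  let term (μ : Finset (Fin q)) : 𝒪.Sec W := x.incl (x.coeff μ a) * x.monomial μ
  let part := ∑ μ with (μ.card : ZMod 2) = i, term μ
  let rest := ∑ μ with ¬(μ.card : ZMod 2) = i, term μ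
  have hadd : part + rest = a :=
    (Finset.sum_filter_add_sum_filter_not _ _ _).trans (x.sum_coeff a)
  have hpart : part ∈ 𝒪.parity W i := sum_mem fun μ hμ =>
    (Finset.mem_filter.1 hμ).2 ▸ σ.incl_mul_monomial_mem_parity W hW _ μ
  have hrest : rest ∈ 𝒪.parity W (i + 1) := by
    have heq : ∀ j k : ZMod 2, j ≠ k → j = k + 1 := by decide
    exact sum_mem fun μ hμ =>
      heq _ _ (Finset.mem_filter.1 hμ).2 ▸ σ.incl_mul_monomial_mem_parity W hW _ μ
  have hrest_zero : rest = 0 :=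
    eq_zero_of_mem_parity (by simp) (eq_sub_of_add_eq' hadd ▸ sub_mem ha hpart) hrest
  change x.coeff ν a = 0
  rw [← hadd, hrest_zero, add_zero, map_sum]
  refine Finset.sum_eq_zero fun μ hμ => ?_
  rw [x.coeff_incl_mul_monomial, if_neg]
  rintro rfl
  exact hν (Finset.mem_filter.1 hμ).2

theorem isOdd_of_mem_parity {a : 𝒪.Sec W} (ha : a ∈ 𝒪.parity W 1) : (σ.frame W hW).IsOdd a := by
  intro ν hν
  refine σ.coeff_eq_zero_of_mem_parity hW ha ?_
  rw [(ZMod.natCast_eq_zero_iff_even).2 hν]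
  decide

end Splitting

namespace Supermanifold

variable {M : Supermanifold p q M₀} {U : Opens M₀}

theorem body_of_mem_parity_one {W : Opens M₀} {a : M.Sec W} (ha : a ∈ M.parity W 1) :
    M.body W a = 0 := by
  have hsq : M.body W a * M.body W a = 0 := by
    rw [← map_mul, odd_mul_self ha, map_zero]
  ext x
  exact mul_self_eq_zero.1 (congrArg (evalAt x) hsq)

theorem frame_body (σ : Splitting (p := p) q M.toSuperalgebraSheaf U) (W : Opens M₀) (hW : W ≤ U)
    (a : M.Sec W) : (σ.frame W hW).body a = M.body W a := by
  let x := σ.frame W hW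
  refine DFunLike.congr_fun (x.addHom_ext (f := (x.body : M.Sec W →+ Smooth p W))
    (g := (M.body W : M.Sec W →+ Smooth p W)) fun c ν => ?_) a
  change x.body (x.incl c * x.monomial ν) = M.body W (x.incl c * x.monomial ν)
  rw [GrassmannFrame.body_apply, GrassmannFrame.coeff_incl_mul_monomial, map_mul,
    Splitting.frame_incl, M.body_pullback]
  split_ifs with hν
  · rw [← hν, GrassmannFrame.monomial_empty, map_one, mul_one]
  · obtain ⟨j, hj⟩ := Finset.nonempty_iff_ne_empty.2 (Ne.symm hν)
    have hmonomial : M.body W (x.monomial ν) = 0 := by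
      rw [GrassmannFrame.monomial, map_oddMonomial, oddMonomial]
      refine List.prod_eq_zero (List.mem_ofFn.2 ⟨j, ?_⟩)
      rw [if_pos hj, body_of_mem_parity_one (σ.gen_mem_parity W hW j)]
    rw [hmonomial, mul_zero]

theorem mem_filtration_one_iff (σ : Splitting (p := p) q M.toSuperalgebraSheaf U) (W : Opens M₀)
    (hW : W ≤ U) (a : M.Sec W) : a ∈ (σ.frame W hW).filtration 1 ↔ M.body W a = 0 := by
  rw [GrassmannFrame.mem_filtration_one_iff, frame_body]

/-- The splitting with the same odd sections and another pullback of functions. -/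
def withPullback (σ : Splitting (p := p) q M.toSuperalgebraSheaf U)
    (π : ∀ W : Opens M₀, W ≤ U → (Smooth p W →ₐ[ℝ] M.Sec W))
    (heven : ∀ W hW g, π W hW g ∈ M.parity W 0)
    (hres : ∀ {V W : Opens M₀} (hW : W ≤ U) (h : V ≤ W) (g : Smooth p W),
      M.res h (π W hW g) = π V (h.trans hW) (smoothRes h g))
    (hbody : ∀ W hW g, M.body W (π W hW g) = g) :
    Splitting (p := p) q M.toSuperalgebraSheaf U where
  pullback := π
  pullback_even := heven
  res_pullback := hres
  odd := σ.odd
  odd_mem := σ.odd_mem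
  bijective W hW :=
    (σ.frame W hW).bijective_of_sub_mem_filtration (π W hW : Smooth p W →+* M.Sec W) fun c => by
      rw [mem_filtration_one_iff, map_sub, Splitting.frame_incl, M.body_pullback]
      exact sub_eq_zero.2 (hbody W hW c)

/-- The coordinate system given by a splitting and a chart. -/
def coordSystemOfSplitting (σ : Splitting (p := p) q M.toSuperalgebraSheaf U)
    (e : OpenPartialHomeomorph M₀ (Model p)) (he : e ∈ charts p M₀) (V : Opens M₀) (hV : V ≤ U)
    (hVe : e.source = V) : M.CoordSystem V where
  pullback W hW := σ.pullback W (hW.trans hV)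
  pullback_even W hW g := σ.pullback_even W (hW.trans hV) g
  res_pullback hW h' g := σ.res_pullback (hW.trans hV) h' g
  odd j := M.res hV (σ.odd j)
  odd_mem j := M.map_parity hV 1 _ (σ.odd_mem j)
  bijective W hW := by
    simp only [SuperalgebraSheaf.res_res]
    exact σ.bijective W (hW.trans hV)
  chart := e
  chart_mem := he
  source_eq := hVe

theorem Retraction.exists_isAdapted (γ : M.Retraction) {e : OpenPartialHomeomorph M₀ (Model p)}
    (he : e ∈ charts p M₀) {o : M₀} (ho : o ∈ e.source) :
    ∃ (V : Opens M₀) (x : M.CoordSystem V), o ∈ V ∧ x.IsAdapted γ ∧ (V : Set M₀) ⊆ e.source ∧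
      x.chart = e.restr V := by
  obtain ⟨U, hoU, ⟨σ⟩⟩ := M.locally_split o
  let V : Opens M₀ := U ⊓ ⟨e.source, e.open_source⟩
  have hV : (V : Set M₀) ⊆ e.source := fun _ h => h.2
  let τ := withPullback σ (fun W _ => γ.pullback W) (fun W _ => γ.pullback_even W)
    (fun _ h g => γ.res_pullback h g) (fun W _ => γ.body_pullback W)
  exact ⟨V, coordSystemOfSplitting τ (e.restr V) (restr_mem_charts he V) V inf_le_left
    (restr_source_eq hV), ⟨hoU, ho⟩, fun _ _ => rfl, hV, rfl⟩

namespace CoordSystem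

/-- The presentation of the sections over `U` as a Grassmann algebra over `C^∞(U)`. -/
def frame (x : M.CoordSystem U) : GrassmannFrame q (Smooth p U) (M.Sec U) :=
  x.toSplitting.frame U le_rfl

theorem frame_incl (x : M.CoordSystem U) (c : Smooth p U) :
    x.frame.incl c = x.pullback U le_rfl c := rfl

theorem frame_gen (x : M.CoordSystem U) (j : Fin q) : x.frame.gen j = x.odd j :=
  M.res_self le_rfl _

theorem frame_monomial (x : M.CoordSystem U) (ν : Finset (Fin q)) :
    x.frame.monomial ν = x.monomial ν := by
  rw [GrassmannFrame.monomial, funext x.frame_gen]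
  rfl

theorem frame_coeff (x : M.CoordSystem U) (f : M.Sec U) (ν : Finset (Fin q)) :
    x.frame.coeff ν f = x.coeff f ν := by
  conv_lhs => rw [← x.sum_coeff f]
  simp only [← frame_monomial, ← frame_incl]
  exact x.frame.coeff_sum _ ν

theorem frame_incl_algebraMap (x : M.CoordSystem U) (r : ℝ) :
    x.frame.incl (algebraMap ℝ (Smooth p U) r) = algebraMap ℝ (M.Sec U) r :=
  x.toSplitting.frame_incl_algebraMap U le_rfl r

/-- The partial derivative `∂/∂u_{0,i}` of the functions on `U`. -/
abbrev chartPartial (x : M.CoordSystem U) (i : Fin p) :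
    Derivation ℝ (Smooth p U) (Smooth p U) :=
  chartDerivation x.chart x.chart_mem x.source_eq i

theorem derivEven_eq (x : M.CoordSystem U) (i : Fin p) (f : M.Sec U) :
    x.derivEven i f = x.frame.evenDeriv (x.chartPartial i) f := by
  simp only [derivEven, GrassmannFrame.evenDeriv_apply, frame_monomial, frame_coeff]
  rfl

theorem derivOdd_eq (x : M.CoordSystem U) (j : Fin q) (f : M.Sec U) :
    x.derivOdd j f = x.frame.oddDeriv j f := by
  simp only [derivOdd, GrassmannFrame.oddDeriv_apply, frame_monomial, frame_coeff, frame_incl]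
  refine Finset.sum_congr rfl fun ν _ => ?_
  rw [zsmul_eq_mul, Int.cast_pow, Int.cast_neg, Int.cast_one]

theorem compatible {x y : M.CoordSystem U} (h : ∀ c, x.frame.incl c = y.frame.incl c) :
    GrassmannFrame.Compatible x.frame y.frame :=
  ⟨RingHom.ext h,
    fun b => y.toSplitting.isOdd_of_mem_parity le_rfl (x.toSplitting.gen_mem_parity U le_rfl b),
    fun b => x.toSplitting.isOdd_of_mem_parity le_rfl (y.toSplitting.gen_mem_parity U le_rfl b)⟩

theorem coeff_restrict (x : M.CoordSystem U) (V : Opens M₀) (h : V ≤ U) (f : M.Sec U)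
    (ν : Finset (Fin q)) :
    (x.restrict V h).coeff (M.res h f) ν = smoothRes h (x.coeff f ν) := by
  rw [← frame_coeff, ← frame_coeff]
  refine x.frame.coeff_map (x.restrict V h).frame (φ := (M.res h).toRingHom)
    (ψ := (smoothRes (p := p) h).toRingHom) (fun c => x.res_pullback le_rfl h c)
    (fun j => ?_) ν f
  rw [frame_gen, frame_gen]
  rfl

theorem IsAdapted.restrict {x : M.CoordSystem U} {γ : M.Retraction} (hx : x.IsAdapted γ)
    (V : Opens M₀) (h : V ≤ U) : (x.restrict V h).IsAdapted γ :=
  fun W hW => hx W (hW.trans h)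

end CoordSystem

end Supermanifold

end Frames

/-! ### The fibre integral -/

section FibreIntegral

variable {p q : ℕ} {M₀ : Type u} [TopologicalSpace M₀] [ChartedSpace (Model p) M₀]

theorem smoothSign_mul_self_apply {U : Opens M₀} (g : Smooth p U) (hg : ∀ x, g x ≠ 0) (x : U) :
    (smoothSign g * g) x = |g x| := by
  rw [ContMDiffMap.coe_mul, Pi.mul_apply, smoothSign_apply g hg]
  rcases lt_or_gt_of_ne (hg x) with h | h
  · rw [Real.sign_of_neg h, abs_of_neg h, neg_one_mul]
  · rw [Real.sign_of_pos h, abs_of_pos h, one_mul]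

namespace Supermanifold

variable {M : Supermanifold p q M₀} {U : Opens M₀}

/-- The top coefficient `f_{(1,…,1)}` of `β = f |Dx|` in the coordinate system `x`. -/
def BerezinDensity.topCoeff (β : M.BerezinDensity) (x : M.CoordSystem U) : Smooth p U :=
  x.coeff (β.val U x) Finset.univ

namespace CoordSystem

/-- The Jacobian matrix `∂u₀/∂v₀` of the underlying classical charts of `x = (u, ξ)` and
`y = (v, η)`. -/
def baseJacobian (x y : M.CoordSystem U) : Matrix (Fin p) (Fin p) (Smooth p U) :=
  Matrix.of fun i j => chartDeriv y.chart y.chart_mem y.source_eq i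
    (chartCoord x.chart x.chart_mem x.source_eq j)

theorem det_baseJacobian_apply (x y : M.CoordSystem U) (o : U) :
    (baseJacobian x y).det o =
      (fderiv ℝ (fun z => x.chart (y.chart.symm z)) (y.chart o)).det :=
  det_chartDeriv_chartCoord x.chart_mem x.source_eq y.chart_mem y.source_eq o

theorem det_baseJacobian_ne_zero (x y : M.CoordSystem U) (o : U) :
    (baseJacobian x y).det o ≠ 0 := by
  rw [det_baseJacobian_apply]
  exact right_ne_zero_of_mul_eq_one (det_transition_mul x.chart_mem y.chart_mem
    (x.source_eq ▸ o.2) (y.source_eq ▸ o.2))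

section SameRetraction

variable {x y : M.CoordSystem U} (h : ∀ c, x.frame.incl c = y.frame.incl c)

include h

theorem even_of_incl_eq (j : Fin p) :
    x.even j = y.frame.incl (chartCoord x.chart x.chart_mem x.source_eq j) :=
  h _

theorem jacEvenEven_of_incl_eq : jacEvenEven x y = (baseJacobian x y).map y.frame.incl := by
  ext i j
  rw [jacEvenEven, Matrix.of_apply, even_of_incl_eq h, derivEven_eq,
    GrassmannFrame.evenDeriv_incl]
  rfl

theorem derivOdd_even_of_incl_eq :
    (Matrix.of fun a j => y.derivOdd a (x.even j)) = (0 : Matrix (Fin q) (Fin p) _) := by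
  ext a j
  rw [Matrix.of_apply, even_of_incl_eq h, derivOdd_eq, GrassmannFrame.oddDeriv_incl]
  rfl

theorem absBer_of_incl_eq :
    x.absBer y =
      y.frame.incl (smoothSign (baseJacobian x y).det * (baseJacobian x y).det) *
        leibnizDet (GrassmannFrame.jacobian x.frame y.frame) := by
  have hodd : (Matrix.of fun a b => y.derivOdd a (x.odd b)) =
      GrassmannFrame.jacobian y.frame x.frame := by
    ext a b
    rw [Matrix.of_apply, derivOdd_eq, GrassmannFrame.jacobian, Matrix.of_apply, frame_gen]
  have hdet : leibnizDet (jacEvenEven x y) = y.frame.incl (baseJacobian x y).det := by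
    rw [jacEvenEven_of_incl_eq h, ← map_leibnizDet, leibnizDet_eq_det]
  rw [absBer, ber, berezinian, derivOdd_even_of_incl_eq h, hodd, Matrix.mul_zero, sub_zero,
    (compatible h).inverse_jacobian, hdet, map_mul, frame_incl, frame_incl, M.body_pullback,
    mul_assoc]

theorem topCoeff_of_incl_eq (β : M.BerezinDensity) (o : U) :
    β.topCoeff y o = β.topCoeff x o *
      |(fderiv ℝ (fun z => x.chart (y.chart.symm z)) (y.chart o)).det| := by
  have hsplit : β.topCoeff y =
      smoothSign (baseJacobian x y).det * (baseJacobian x y).det * β.topCoeff x := by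
    rw [BerezinDensity.topCoeff, β.change x y, absBer_of_incl_eq h, ← frame_coeff, ← mul_assoc,
      ← y.frame.incl_comm, mul_assoc, GrassmannFrame.coeff_incl_mul,
      (compatible h).coeff_univ_mul_det, frame_coeff]
    rfl
  rw [← det_baseJacobian_apply, hsplit,
    ← smoothSign_mul_self_apply _ (det_baseJacobian_ne_zero x y), mul_comm (β.topCoeff x o)]
  rfl

end SameRetraction

theorem IsAdapted.incl_eq {γ : M.Retraction} {x y : M.CoordSystem U} (hx : x.IsAdapted γ)
    (hy : y.IsAdapted γ) (c : Smooth p U) : x.frame.incl c = y.frame.incl c := by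
  rw [frame_incl, frame_incl, hx, hy]

theorem topCoeff_restrict (β : M.BerezinDensity) (x : M.CoordSystem U) (V : Opens M₀)
    (h : V ≤ U) (o : V) : β.topCoeff (x.restrict V h) o = β.topCoeff x ⟨o, h o.2⟩ := by
  rw [BerezinDensity.topCoeff, β.val_restrict, coeff_restrict]
  rfl

theorem IsAdapted.topCoeff_eq {γ : M.Retraction} {V : Opens M₀} {x : M.CoordSystem U}
    {y : M.CoordSystem V} (hx : x.IsAdapted γ) (hy : y.IsAdapted γ) (β : M.BerezinDensity)
    {o : M₀} (hoU : o ∈ U) (hoV : o ∈ V) :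
    β.topCoeff y ⟨o, hoV⟩ = β.topCoeff x ⟨o, hoU⟩ *
      |(fderiv ℝ (fun z => x.chart (y.chart.symm z)) (y.chart o)).det| := by
  have h := topCoeff_of_incl_eq
    ((hx.restrict (U ⊓ V) inf_le_left).incl_eq (hy.restrict (U ⊓ V) inf_le_right)) β ⟨o, hoU, hoV⟩
  rwa [topCoeff_restrict, topCoeff_restrict] at h

end CoordSystem

namespace BerezinDensity

variable (β : M.BerezinDensity) (s : ℕ → ℕ → ℕ) (γ : M.Retraction)
  {e : OpenPartialHomeomorph M₀ (Model p)} {o : M₀}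

theorem exists_forall_eq_topCoeff (he : e ∈ charts p M₀) (ho : o ∈ e.source) :
    ∃ r : ℝ, ∀ (U : Opens M₀) (x : M.CoordSystem U), x.IsAdapted γ → ∀ hoU : o ∈ U,
      r = (-1) ^ s p q * β.topCoeff x ⟨o, hoU⟩ *
        |(fderiv ℝ (fun z => x.chart (e.symm z)) (e o)).det| := by
  obtain ⟨V, y, hoV, hy, -, hye⟩ := γ.exists_isAdapted he ho
  refine ⟨(-1) ^ s p q * β.topCoeff y ⟨o, hoV⟩, fun U x hx hoU => ?_⟩
  rw [hx.topCoeff_eq hy β hoU hoV, mul_assoc, hye]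
  rfl

open Classical in
/-- The value at `o` of the fibre integral of `β` along `γ`, read in the chart `e`; it is `0` by
convention outside of the domain of `e`. -/
def fibreValue (e : OpenPartialHomeomorph M₀ (Model p)) (o : M₀) : ℝ :=
  if h : e ∈ charts p M₀ ∧ o ∈ e.source then
    (β.exists_forall_eq_topCoeff s γ h.1 h.2).choose
  else 0

variable {γ}

theorem fibreValue_eq (he : e ∈ charts p M₀) (ho : o ∈ e.source) {x : M.CoordSystem U}
    (hx : x.IsAdapted γ) (hoU : o ∈ U) :
    β.fibreValue s γ e o = (-1) ^ s p q * β.topCoeff x ⟨o, hoU⟩ *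
      |(fderiv ℝ (fun z => x.chart (e.symm z)) (e o)).det| := by
  rw [fibreValue, dif_pos ⟨he, ho⟩]
  exact (β.exists_forall_eq_topCoeff s γ he ho).choose_spec U x hx hoU

theorem fibreValue_chart {x : M.CoordSystem U} (hx : x.IsAdapted γ) (o : U) :
    β.fibreValue s γ x.chart o = (-1) ^ s p q * β.topCoeff x o := by
  have ho : (o : M₀) ∈ x.chart.source := x.source_eq ▸ o.2
  rw [β.fibreValue_eq s x.chart_mem ho hx o.2, abs_det_fderiv_transition_self ho, mul_one]

variable (γ)

/-- The fibre integral `γ_!(β)`. -/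
def fibreIntegral : Density p M₀ where
  val := β.fibreValue s γ
  smooth e he o ho := by
    obtain ⟨V, y, hoV, hy, hVe, hye⟩ := γ.exists_isAdapted he ho
    have hval : (fun z : V => β.fibreValue s γ e z) = ⇑((-1 : ℝ) ^ s p q • β.topCoeff y) := by
      funext z
      rw [β.fibreValue_eq s he (hVe z.2) hy z.2, hye]
      exact (congrArg _ (abs_det_fderiv_transition_self (hVe z.2))).trans (mul_one _)
    have hsmooth : ContMDiffAt (𝓡 p) 𝓘(ℝ) ∞ (fun z : V => β.fibreValue s γ e z) ⟨o, hoV⟩ :=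
      hval ▸ ContMDiffMap.contMDiff _ _
    exact (contMDiffAt_subtype_iff.1 hsmooth).contMDiffWithinAt
  change e he e' he' o ho := by
    obtain ⟨V, y, hoV, hy, -, hye⟩ := γ.exists_isAdapted he ho.1
    have hval : β.fibreValue s γ e o = (-1) ^ s p q * β.topCoeff y ⟨o, hoV⟩ := by
      rw [β.fibreValue_eq s he ho.1 hy hoV, hye]
      exact (congrArg _ (abs_det_fderiv_transition_self ho.1)).trans (mul_one _)
    rw [hval, β.fibreValue_eq s he' ho.2 hy hoV, hye]
    rfl

theorem isFibreIntegral_fibreIntegral : β.IsFibreIntegral s γ (β.fibreIntegral s γ) :=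
  fun _ _ hx o => β.fibreValue_chart s hx o

variable {β s γ}

theorem IsFibreIntegral.val_eq {ρ : Density p M₀} (hρ : β.IsFibreIntegral s γ ρ)
    {x : M.CoordSystem U} (hx : x.IsAdapted γ) (he : e ∈ charts p M₀) (ho : o ∈ e.source)
    (hoU : o ∈ U) :
    ρ.val e o = (-1) ^ s p q * β.topCoeff x ⟨o, hoU⟩ *
      |(fderiv ℝ (fun z => x.chart (e.symm z)) (e o)).det| := by
  rw [ρ.change x.chart x.chart_mem e he o ⟨x.source_eq ▸ hoU, ho⟩, hρ U x hx ⟨o, hoU⟩]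
  rfl

theorem topCoeff_eq_sum {ι : Type*} {t : Finset ι} {α : ι → M.BerezinDensity}
    {x : M.CoordSystem U} (hsum : β.val U x = ∑ i ∈ t, (α i).val U x) (o : U) :
    β.topCoeff x o = ∑ i ∈ t, (α i).topCoeff x o := by
  simp only [topCoeff, ← CoordSystem.frame_coeff, ← evalAt_apply]
  rw [hsum, map_sum, map_sum]

theorem IsFibreIntegral.val_eq_sum {ι : Type*} {t : Finset ι} {α : ι → M.BerezinDensity}
    {ρ : Density p M₀} {τ : ι → Density p M₀} (hρ : β.IsFibreIntegral s γ ρ)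
    (hτ : ∀ i, (α i).IsFibreIntegral s γ (τ i))
    (hsum : ∀ (U : Opens M₀) (x : M.CoordSystem U), β.val U x = ∑ i ∈ t, (α i).val U x)
    (he : e ∈ charts p M₀) (ho : o ∈ e.source) :
    ρ.val e o = ∑ i ∈ t, (τ i).val e o := by
  obtain ⟨V, y, hoV, hy, -, -⟩ := γ.exists_isAdapted he ho
  simp only [hρ.val_eq hy he ho hoV, (hτ _).val_eq hy he ho hoV, topCoeff_eq_sum (hsum V y),
    Finset.mul_sum, Finset.sum_mul]

end BerezinDensity

end Supermanifold

end FibreIntegral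

/-! ### Taylor expansion in a nilpotent element -/

open Finset.HasAntidiagonal (antidiagonal mem_antidiagonal)

theorem sum_range_mul_pow {A : Type*} [Ring A] {m : A} {N : ℕ} (hm : ∀ a, m * a = a * m)
    (hN : m ^ N = 0) (a b : ℕ → A) :
    (∑ k ∈ Finset.range N, a k * m ^ k) * ∑ k ∈ Finset.range N, b k * m ^ k =
      ∑ n ∈ Finset.range N, (∑ k ∈ antidiagonal n, a k.1 * b k.2) * m ^ n := by
  have hmul : ∀ k : ℕ × ℕ,
      a k.1 * m ^ k.1 * (b k.2 * m ^ k.2) = a k.1 * b k.2 * m ^ (k.1 + k.2) := by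
    intro k
    have hcomm : m ^ k.1 * b k.2 = b k.2 * m ^ k.1 := Commute.pow_left (hm _) _
    rw [mul_assoc, ← mul_assoc (m ^ k.1), hcomm, mul_assoc (b k.2), ← pow_add, mul_assoc]
  have hhigh : ∑ k ∈ Finset.range N ×ˢ Finset.range N with ¬k.1 + k.2 < N,
      a k.1 * b k.2 * m ^ (k.1 + k.2) = 0 :=
    Finset.sum_eq_zero fun k hk => by
      rw [pow_eq_zero_of_le (not_lt.1 (Finset.mem_filter.1 hk).2) hN, mul_zero]
  have hfiber : ∀ n ∈ Finset.range N,
      ((Finset.range N ×ˢ Finset.range N).filter fun k => k.1 + k.2 < N).filter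
        (fun k => k.1 + k.2 = n) = antidiagonal n := by
    intro n hn
    ext k
    simp only [Finset.mem_filter, Finset.mem_product, Finset.mem_range, mem_antidiagonal]
      at hn ⊢
    omega
  simp only [Finset.sum_mul_sum, ← Finset.sum_product', hmul]
  rw [← Finset.sum_filter_add_sum_filter_not _ (fun k : ℕ × ℕ => k.1 + k.2 < N), hhigh, add_zero,
    ← Finset.sum_fiberwise_of_maps_to (t := Finset.range N) (g := fun k : ℕ × ℕ => k.1 + k.2)
      fun k hk => Finset.mem_range.2 (Finset.mem_filter.1 hk).2]
  refine Finset.sum_congr rfl fun n hn => ?_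
  rw [hfiber n hn, Finset.sum_mul]
  exact Finset.sum_congr rfl fun k hk => by rw [mem_antidiagonal.1 hk]

section DivPow

variable {k V : Type*} [Field k] [AddCommGroup V] [Module k V]

/-- The divided power `D ^ n / n!` of an endomorphism `D`. -/
def divPow (D : Module.End k V) (n : ℕ) : Module.End k V := (n.factorial : k)⁻¹ • D ^ n

theorem divPow_zero (D : Module.End k V) : divPow D 0 = 1 := by
  rw [divPow, Nat.factorial_zero, Nat.cast_one, inv_one, one_smul, pow_zero]

theorem succ_smul_divPow_succ [CharZero k] (D : Module.End k V) (n : ℕ) (a : V) :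
    ((n + 1 : ℕ) : k) • divPow D (n + 1) a = D (divPow D n a) := by
  have hne : ((n + 1 : ℕ) : k) ≠ 0 := Nat.cast_ne_zero.2 n.succ_ne_zero
  rw [divPow, divPow, LinearMap.smul_apply, LinearMap.smul_apply, map_smul, pow_succ', smul_smul,
    Nat.factorial_succ, Nat.cast_mul, mul_inv, mul_inv_cancel_left₀ hne, Module.End.mul_apply]

theorem map_divPow {W : Type*} [AddCommGroup W] [Module k W] {D : Module.End k V}
    {E : Module.End k W} {f : V →ₗ[k] W} (hf : ∀ a, f (D a) = E (f a)) (n : ℕ) (a : V) :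
    f (divPow D n a) = divPow E n (f a) := by
  have hpow : f ((D ^ n) a) = (E ^ n) (f a) := by
    induction n with
    | zero => rfl
    | succ n ih => rw [pow_succ', pow_succ', Module.End.mul_apply, Module.End.mul_apply, hf, ih]
  rw [divPow, divPow, LinearMap.smul_apply, LinearMap.smul_apply, map_smul, hpow]

end DivPow

section Taylor

variable {k A : Type*} [Field k] [Ring A] [Algebra k A]
  {D : Module.End k A} (hD : ∀ a b, D (a * b) = a * D b + D a * b)
include hD

theorem map_pow_succ_of_leibniz {m : A} (hm : ∀ a, m * a = a * m) (n : ℕ) :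
    D (m ^ (n + 1)) = ((n + 1 : ℕ) : k) • (m ^ n * D m) := by
  induction n with
  | zero => simp
  | succ n ih =>
    rw [pow_succ, hD, ih, smul_mul_assoc, mul_assoc, ← hm (D m), ← mul_assoc, ← pow_succ,
      Nat.cast_succ (n + 1), add_smul, one_smul, add_comm]

variable [CharZero k]

theorem divPow_mul (n : ℕ) (a b : A) :
    divPow D n (a * b) = ∑ i ∈ antidiagonal n, divPow D i.1 a * divPow D i.2 b := by
  induction n with
  | zero => simp [divPow_zero]
  | succ n ih =>
    have hne : ((n + 1 : ℕ) : k) ≠ 0 := Nat.cast_ne_zero.2 n.succ_ne_zero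
    have hleft : ∑ i ∈ antidiagonal (n + 1),
        (i.1 : k) • (divPow D i.1 a * divPow D i.2 b) =
        ∑ i ∈ antidiagonal n, D (divPow D i.1 a) * divPow D i.2 b := by
      simp only [Finset.Nat.sum_antidiagonal_succ, Nat.cast_zero, zero_smul, zero_mul,
        zero_add, ← smul_mul_assoc, succ_smul_divPow_succ]
    have hright : ∑ i ∈ antidiagonal (n + 1),
        (i.2 : k) • (divPow D i.1 a * divPow D i.2 b) =
        ∑ i ∈ antidiagonal n, divPow D i.1 a * D (divPow D i.2 b) := by
      simp only [Finset.Nat.sum_antidiagonal_succ', Nat.cast_zero, zero_smul, mul_zero,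
        zero_add, ← mul_smul_comm, succ_smul_divPow_succ]
    apply smul_right_injective A hne
    beta_reduce
    rw [succ_smul_divPow_succ, ih, map_sum, Finset.smul_sum]
    simp only [hD]
    rw [Finset.sum_add_distrib, ← hleft, ← hright, ← Finset.sum_add_distrib]
    refine Finset.sum_congr rfl fun i hi => ?_
    rw [← add_smul, ← mem_antidiagonal.1 hi, Nat.cast_add, add_comm]

/-- `1 + D m` is the Jacobian of the substitution `a ↦ ∑ n, D ^ n a / n! * m ^ n`, which is
therefore volume preserving up to a total derivative. -/
theorem sum_divPow_mul_pow_mul_one_add {m : A} (hm : ∀ a, m * a = a * m) {N : ℕ}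
    (hN : m ^ N = 0) (a : A) :
    (∑ n ∈ Finset.range N, divPow D n a * m ^ n) * (1 + D m) =
      a + D (∑ n ∈ Finset.range N, ((n + 1 : ℕ) : k)⁻¹ • (divPow D n a * m ^ (n + 1))) := by
  have hterm : ∀ n, D (((n + 1 : ℕ) : k)⁻¹ • (divPow D n a * m ^ (n + 1))) =
      divPow D (n + 1) a * m ^ (n + 1) + divPow D n a * m ^ n * D m := by
    intro n
    have hne : ((n + 1 : ℕ) : k) ≠ 0 := Nat.cast_ne_zero.2 n.succ_ne_zero
    rw [map_smul, hD, map_pow_succ_of_leibniz hD hm, ← succ_smul_divPow_succ, smul_mul_assoc,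
      mul_smul_comm, ← smul_add, inv_smul_smul₀ hne, mul_assoc, add_comm]
  have htelescope : (∑ n ∈ Finset.range N, divPow D (n + 1) a * m ^ (n + 1)) + a =
      ∑ n ∈ Finset.range N, divPow D n a * m ^ n := by
    have hsucc := Finset.sum_range_succ' (fun n => divPow D n a * m ^ n) N
    rw [Finset.sum_range_succ, hN, mul_zero, add_zero, divPow_zero, pow_zero, mul_one] at hsucc
    exact hsucc.symm
  rw [map_sum, Finset.sum_congr rfl fun n _ => hterm n, Finset.sum_add_distrib, ← Finset.sum_mul,
    mul_add, mul_one, ← htelescope]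
  abel

end Taylor

section TaylorHom

variable {k C A : Type*} [Field k] [CharZero k] [CommRing C] [Algebra k C] [Ring A] [Algebra k A]

/-- The Taylor expansion `c ↦ ∑ n < N, π (d ^ n c / n!) * m ^ n` of `c (u + m)` in a central
nilpotent element `m`, where `d` plays the role of `∂/∂u`. -/
def taylorHom (π : C →ₐ[k] A) (d : Derivation k C C) (m : A) (hm : ∀ a, m * a = a * m) (N : ℕ)
    (hN : m ^ (N + 1) = 0) : C →ₐ[k] A :=
  AlgHom.ofLinearMap
    (∑ n ∈ Finset.range (N + 1),
      (LinearMap.mulRight k (m ^ n)).comp (π.toLinearMap.comp (divPow (d : Module.End k C) n)))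
    (by
      have hone : ∀ n, divPow (d : Module.End k C) (n + 1) 1 = 0 := fun n => by
        rw [divPow, pow_succ, LinearMap.smul_apply, Module.End.mul_apply, Derivation.coeFn_coe,
          d.map_one_eq_zero, map_zero, smul_zero]
      simp [Finset.sum_range_succ', hone, divPow_zero])
    (fun a b => by
      have hd : ∀ a b, (d : Module.End k C) (a * b) = a * d b + d a * b := fun a b => by
        rw [Derivation.coeFn_coe, d.leibniz, smul_eq_mul, smul_eq_mul, mul_comm b]
      simp only [LinearMap.sum_apply, LinearMap.comp_apply, LinearMap.mulRight_apply,
        AlgHom.toLinearMap_apply, divPow_mul hd, map_sum, map_mul,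
        ← Finset.sum_mul]
      exact (sum_range_mul_pow hm hN (fun n => π (divPow (d : Module.End k C) n a))
        fun n => π (divPow (d : Module.End k C) n b)).symm)

theorem taylorHom_apply (π : C →ₐ[k] A) (d : Derivation k C C) {m : A} (hm : ∀ a, m * a = a * m)
    {N : ℕ} (hN : m ^ (N + 1) = 0) (c : C) : taylorHom π d m hm N hN c =
      ∑ n ∈ Finset.range (N + 1), π (divPow (d : Module.End k C) n c) * m ^ n := by
  simp [taylorHom, LinearMap.sum_apply]

end TaylorHom

/-! ### Shifting one even coordinate -/

section Shift

open SuperalgebraSheaf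

variable {p q : ℕ} {M₀ : Type u} [TopologicalSpace M₀] [ChartedSpace (Model p) M₀]

namespace Supermanifold

variable {M : Supermanifold p q M₀} {U : Opens M₀}

theorem pow_eq_zero_of_body_eq_zero (σ : Splitting (p := p) q M.toSuperalgebraSheaf U)
    {W : Opens M₀} (hW : W ≤ U) {m : M.Sec W} (hm : M.body W m = 0) {n : ℕ} (hn : q < n) :
    m ^ n = 0 :=
  (σ.frame W hW).eq_zero_of_mem_filtration hn
    ((σ.frame W hW).pow_mem_filtration ((M.mem_filtration_one_iff σ W hW m).2 hm) n)

namespace CoordSystem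

theorem chart_restr_source (x : M.CoordSystem U) {W : Opens M₀} (hW : W ≤ U) :
    (x.chart.restr W).source = W :=
  restr_source_eq (x.source_eq ▸ hW)

/-- The partial derivative `∂/∂u_{0,i}` of the functions on an open subset of `U`. -/
def partialDeriv (x : M.CoordSystem U) (i : Fin p) (W : Opens M₀) (hW : W ≤ U) :
    Derivation ℝ (Smooth p W) (Smooth p W) :=
  chartDerivation (x.chart.restr W) (restr_mem_charts x.chart_mem W) (x.chart_restr_source hW) i

theorem partialDeriv_smoothRes (x : M.CoordSystem U) (i : Fin p) {V W : Opens M₀} (hW : W ≤ U)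
    (h : V ≤ W) (g : Smooth p W) : x.partialDeriv i V (h.trans hW) (smoothRes h g) =
      smoothRes h (x.partialDeriv i W hW g) :=
  chartDeriv_smoothRes (restr_mem_charts x.chart_mem W) (x.chart_restr_source hW)
    (restr_mem_charts x.chart_mem V) (x.chart_restr_source (h.trans hW)) h (fun _ _ => rfl) i g

theorem partialDeriv_self (x : M.CoordSystem U) (i : Fin p) :
    x.partialDeriv i U le_rfl = x.chartPartial i :=
  Derivation.ext fun g => chartDeriv_smoothRes x.chart_mem x.source_eq
    (restr_mem_charts x.chart_mem U) (x.chart_restr_source le_rfl) le_rfl (fun _ _ => rfl) i g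

theorem divPow_partialDeriv_smoothRes (x : M.CoordSystem U) (i : Fin p) {V W : Opens M₀}
    (hW : W ≤ U) (h : V ≤ W) (n : ℕ) (g : Smooth p W) :
    divPow (x.partialDeriv i V (h.trans hW) : Module.End ℝ (Smooth p V)) n (smoothRes h g) =
      smoothRes h (divPow (x.partialDeriv i W hW : Module.End ℝ (Smooth p W)) n g) :=
  (map_divPow (f := (smoothRes h).toLinearMap)
    (fun a => (x.partialDeriv_smoothRes i hW h a).symm) n g).symm

/-- The pullback of functions along the retraction for which the `i`-th even coordinate is shifted
by the even nilpotent superfunction `m`. Already `m ^ (q + 1) = 0`, but with `q + 2` terms the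
expansion has a linear term even for `q = 0`. -/
def shiftPullback (x : M.CoordSystem U) (i : Fin p) (m : M.Sec U) (hm : m ∈ M.parity U 0)
    (hm₀ : M.body U m = 0) (W : Opens M₀) (hW : W ≤ U) : Smooth p W →ₐ[ℝ] M.Sec W :=
  taylorHom (x.pullback W hW) (x.partialDeriv i W hW) (M.res hW m)
    (even_mul_comm (M.map_parity hW 0 m hm)) (q + 1)
    (pow_eq_zero_of_body_eq_zero x.toSplitting hW (by rw [M.body_res, hm₀, map_zero]) (by omega))

theorem shiftPullback_apply (x : M.CoordSystem U) (i : Fin p) (m : M.Sec U)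
    (hm : m ∈ M.parity U 0) (hm₀ : M.body U m = 0) (W : Opens M₀) (hW : W ≤ U)
    (g : Smooth p W) : x.shiftPullback i m hm hm₀ W hW g = ∑ n ∈ Finset.range (q + 2),
      x.pullback W hW (divPow (x.partialDeriv i W hW : Module.End ℝ (Smooth p W)) n g) *
        M.res hW m ^ n :=
  taylorHom_apply _ _ _ _ _

theorem shiftPullback_even (x : M.CoordSystem U) (i : Fin p) (m : M.Sec U)
    (hm : m ∈ M.parity U 0) (hm₀ : M.body U m = 0) (W : Opens M₀) (hW : W ≤ U)
    (g : Smooth p W) : x.shiftPullback i m hm hm₀ W hW g ∈ M.parity W 0 := by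
  rw [shiftPullback_apply]
  refine sum_mem fun n _ => ?_
  have := M.graded W
  have hpow : M.res hW m ^ n ∈ M.parity W (n • 0) :=
    SetLike.pow_mem_graded n (M.map_parity hW 0 m hm)
  rw [smul_zero] at hpow
  exact add_zero (0 : ZMod 2) ▸ mul_mem_parity (x.pullback_even W hW _) hpow

theorem res_shiftPullback (x : M.CoordSystem U) (i : Fin p) (m : M.Sec U)
    (hm : m ∈ M.parity U 0) (hm₀ : M.body U m = 0) {V W : Opens M₀} (hW : W ≤ U) (h : V ≤ W)
    (g : Smooth p W) : M.res h (x.shiftPullback i m hm hm₀ W hW g) =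
      x.shiftPullback i m hm hm₀ V (h.trans hW) (smoothRes h g) := by
  simp only [shiftPullback_apply, map_sum, map_mul, map_pow, M.res_res, x.res_pullback,
    ← x.divPow_partialDeriv_smoothRes i hW h]

theorem body_shiftPullback (x : M.CoordSystem U) (i : Fin p) (m : M.Sec U)
    (hm : m ∈ M.parity U 0) (hm₀ : M.body U m = 0) (W : Opens M₀) (hW : W ≤ U)
    (g : Smooth p W) : M.body W (x.shiftPullback i m hm hm₀ W hW g) = g := by
  simp only [shiftPullback_apply, map_sum, map_mul, map_pow, M.body_res, hm₀, map_zero]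
  rw [Finset.sum_range_succ', Finset.sum_eq_zero fun n _ => by rw [zero_pow n.succ_ne_zero,
    mul_zero], zero_add, pow_zero, mul_one, divPow_zero, M.body_pullback, Module.End.one_apply]

/-- The coordinate system whose `i`-th even coordinate is shifted by `m`. -/
def shift (x : M.CoordSystem U) (i : Fin p) (m : M.Sec U) (hm : m ∈ M.parity U 0)
    (hm₀ : M.body U m = 0) : M.CoordSystem U where
  toSplitting := withPullback x.toSplitting (x.shiftPullback i m hm hm₀)
    (x.shiftPullback_even i m hm hm₀) (x.res_shiftPullback i m hm hm₀)
    (x.body_shiftPullback i m hm hm₀)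
  chart := x.chart
  chart_mem := x.chart_mem
  source_eq := x.source_eq

section ShiftLemmas

variable (x : M.CoordSystem U) (i : Fin p) (m : M.Sec U) (hm : m ∈ M.parity U 0)
  (hm₀ : M.body U m = 0)

theorem shift_odd : (x.shift i m hm hm₀).odd = x.odd := rfl

theorem shift_monomial (ν : Finset (Fin q)) :
    (x.shift i m hm hm₀).monomial ν = x.monomial ν := rfl

theorem shift_incl (c : Smooth p U) : (x.shift i m hm hm₀).frame.incl c =
    ∑ n ∈ Finset.range (q + 2),
      x.frame.incl (divPow (x.chartPartial i : Module.End ℝ (Smooth p U)) n c) * m ^ n := by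
  change x.shiftPullback i m hm hm₀ U le_rfl c = _
  rw [shiftPullback_apply, partialDeriv_self, M.res_self]
  rfl

theorem shift_even (j : Fin p) :
    (x.shift i m hm hm₀).even j = x.even j + if i = j then m else 0 := by
  let u : Smooth p U := chartCoord x.chart x.chart_mem x.source_eq j
  let d : Module.End ℝ (Smooth p U) := x.chartPartial i
  have hd : d u = if i = j then 1 else 0 := chartDeriv_chartCoord_self _ _ _ _ _
  have hd_sq : d (d u) = 0 := by
    rw [hd]
    split_ifs
    · exact (x.chartPartial i).map_one_eq_zero
    · exact map_zero d
  have hlinear : divPow d 1 u = if i = j then 1 else 0 := by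
    rw [← hd, divPow, Nat.factorial_one, Nat.cast_one, inv_one, one_smul, pow_one]
  have hhigher (n : ℕ) : divPow d (n + 2) u = 0 := by
    rw [divPow, LinearMap.smul_apply, pow_add, Module.End.mul_apply, sq, Module.End.mul_apply,
      hd_sq, map_zero, smul_zero]
  have hzeroth : x.frame.incl (divPow d 0 u) = x.even j := by
    rw [divPow_zero]
    rfl
  calc (x.shift i m hm hm₀).even j
      = ∑ n ∈ Finset.range (q + 2), x.frame.incl (divPow d n u) * m ^ n :=
        x.shift_incl i m hm hm₀ u
    _ = x.frame.incl (divPow d 0 u) + x.frame.incl (divPow d 1 u) * m := by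
        rw [Finset.sum_range_succ', Finset.sum_range_succ', Finset.sum_eq_zero fun n _ => by
          rw [hhigher, map_zero, zero_mul], zero_add, zero_add, pow_zero, pow_one, mul_one,
          add_comm]
    _ = x.even j + if i = j then m else 0 := by
        rw [hzeroth, hlinear, apply_ite x.frame.incl, map_one, map_zero, ite_mul, one_mul, zero_mul]

end ShiftLemmas

end CoordSystem

end Supermanifold

end Shift

/-! ### The change of variables formula for a shift -/

section Determinants

variable {R : Type*} {n : ℕ}

theorem prod_ofFn_ite_eq [Monoid R] (i : Fin n) (r : R) :
    (List.ofFn fun j => if j = i then r else 1).prod = r := by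
  induction n with
  | zero => exact i.elim0
  | succ n ih =>
    rw [List.ofFn_succ, List.prod_cons]
    cases i using Fin.cases with
    | zero => simp
    | succ i => simp [(Fin.succ_ne_zero i).symm, ih i]

theorem leibnizDet_of_forall_ne_column [Ring R] {A : Matrix (Fin n) (Fin n) R} (i : Fin n)
    (h : ∀ a j, j ≠ i → A a j = (1 : Matrix (Fin n) (Fin n) R) a j) : leibnizDet A = A i i := by
  rw [leibnizDet, Finset.sum_eq_single 1]
  · have hdiag (j : Fin n) : A j j = if j = i then A i i else 1 := by
      split_ifs with hj
      · rw [hj]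
      · rw [h j j hj, Matrix.one_apply_eq]
    simp only [Equiv.Perm.sign_one, Units.val_one, Int.cast_one, one_mul, Equiv.Perm.one_apply]
    rw [funext hdiag, prod_ofFn_ite_eq]
  · intro σ _ hσ
    obtain ⟨j, hj, hji⟩ :=
      Finset.exists_mem_ne (Equiv.Perm.one_lt_card_support_of_ne_one hσ) i
    have hzero : A (σ j) j = 0 := by
      rw [h _ _ hji, Matrix.one_apply_ne (Equiv.Perm.mem_support.1 hj)]
    rw [List.prod_eq_zero (l := List.ofFn fun j => A (σ j) j) (List.mem_ofFn.2 ⟨j, hzero⟩),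
      mul_zero]
  · simp

theorem leibnizDet_one [Ring R] : leibnizDet (1 : Matrix (Fin n) (Fin n) R) = 1 := by
  have hdet := map_leibnizDet (Int.castRingHom R) (1 : Matrix (Fin n) (Fin n) ℤ)
  rw [leibnizDet_eq_det, Matrix.det_one, map_one, Matrix.map_one _ (map_zero _) (map_one _)] at hdet
  exact hdet.symm

end Determinants

section VanishingIdeal

variable {M₀ : Type u} [TopologicalSpace M₀]

/-- The ideal of the smooth functions on `U` that vanish outside of `K`. -/
def vanishingIdeal (p : ℕ) [ChartedSpace (Model p) M₀] (U : Opens M₀) (K : Set M₀) :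
    Ideal (Smooth p U) where
  carrier := {g | ∀ o : U, (o : M₀) ∉ K → g o = 0}
  zero_mem' _ _ := rfl
  add_mem' {f g} hf hg o ho := by
    rw [ContMDiffMap.coe_add, Pi.add_apply, hf o ho, hg o ho, add_zero]
  smul_mem' c g hg o ho := by
    rw [smul_eq_mul, ContMDiffMap.coe_mul, Pi.mul_apply, hg o ho, mul_zero]

variable {p : ℕ} [ChartedSpace (Model p) M₀] {U : Opens M₀}

theorem chartDeriv_mem_vanishingIdeal {e : OpenPartialHomeomorph M₀ (Model p)}
    (he : e ∈ charts p M₀) (hU : e.source = U) (i : Fin p) {K : Set M₀} (hK : IsClosed K)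
    {g : Smooth p U} (hg : g ∈ vanishingIdeal p U K) :
    chartDeriv e he hU i g ∈ vanishingIdeal p U K := by
  intro o ho
  have hzero : inChart e g =ᶠ[nhds (e o)] 0 := by
    have hopen : IsOpen (e.target ∩ e.symm ⁻¹' Kᶜ) :=
      e.isOpen_inter_preimage_symm hK.isOpen_compl
    have hmem : e o ∈ e.target ∩ e.symm ⁻¹' Kᶜ := by
      have ho' : (o : M₀) ∈ e.source := hU ▸ o.2
      exact ⟨e.map_source ho', by rwa [Set.mem_preimage, e.left_inv ho']⟩
    filter_upwards [hopen.mem_nhds hmem] with y hy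
    rw [inChart_of_mem e g (symm_mem_of_mem_target hU hy.1)]
    exact hg _ hy.2
  rw [chartDeriv_apply, hzero.fderiv_eq, fderiv_zero]
  rfl

theorem smoothSign_one : smoothSign (1 : Smooth p U) = 1 := by
  ext o
  rw [smoothSign_apply _ fun _ => one_ne_zero]
  exact Real.sign_one

end VanishingIdeal

section ShiftLaw

open SuperalgebraSheaf

variable {p q : ℕ} {M₀ : Type u} [TopologicalSpace M₀] [ChartedSpace (Model p) M₀]

namespace Supermanifold

variable {M : Supermanifold p q M₀} {U : Opens M₀}

namespace CoordSystem

variable (x : M.CoordSystem U) (i : Fin p)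

theorem body_evenDeriv (a : M.Sec U) : M.body U (x.frame.evenDeriv (x.chartPartial i) a) =
    x.chartPartial i (M.body U a) := by
  simp only [← M.frame_body x.toSplitting U le_rfl]
  exact x.frame.coeff_evenDeriv _ a ∅

/-- The derivative `∂/∂u_i` as an endomorphism of the real vector space of superfunctions. -/
def derivEvenLinear : Module.End ℝ (M.Sec U) where
  toFun := x.frame.evenDeriv (x.chartPartial i)
  map_add' := map_add _
  map_smul' := x.frame.evenDeriv_smul (x.chartPartial i) x.frame_incl_algebraMap

theorem coeff_divPow_derivEvenLinear (n : ℕ) (a : M.Sec U) (ν : Finset (Fin q)) :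
    x.frame.coeff ν (divPow (x.derivEvenLinear i) n a) =
      divPow (x.chartPartial i : Module.End ℝ (Smooth p U)) n (x.frame.coeff ν a) := by
  let coeffLinear : M.Sec U →ₗ[ℝ] Smooth p U :=
    { x.frame.coeff ν with
      map_smul' := fun r a => x.frame.coeff_smul x.frame_incl_algebraMap r a ν }
  exact map_divPow (f := coeffLinear) (fun a => x.frame.coeff_evenDeriv _ a ν) n a

theorem divPow_derivEvenLinear_expansion (n : ℕ) (c : Finset (Fin q) → Smooth p U) :
    divPow (x.derivEvenLinear i) n (x.frame.expansion c) = x.frame.expansion fun ν =>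
      divPow (x.chartPartial i : Module.End ℝ (Smooth p U)) n (c ν) :=
  x.frame.ext_coeff fun ν => by
    simp only [coeff_divPow_derivEvenLinear, GrassmannFrame.expansion_apply,
      GrassmannFrame.coeff_sum]

theorem divPow_chartPartial_mem_vanishingIdeal {K : Set M₀} (hK : IsClosed K) {g : Smooth p U}
    (hg : g ∈ vanishingIdeal p U K) (n : ℕ) :
    divPow (x.chartPartial i : Module.End ℝ (Smooth p U)) n g ∈ vanishingIdeal p U K := by
  rw [divPow, LinearMap.smul_apply]
  refine Submodule.smul_of_tower_mem _ _ ?_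
  induction n with
  | zero => exact hg
  | succ n ih =>
    rw [pow_succ']
    exact chartDeriv_mem_vanishingIdeal x.chart_mem x.source_eq i hK ih

variable (m : M.Sec U) (hm : m ∈ M.parity U 0) (hm₀ : M.body U m = 0)

theorem jacEvenEven_shift_apply (a j : Fin p) : jacEvenEven (x.shift i m hm hm₀) x a j =
    (1 : Matrix (Fin p) (Fin p) (M.Sec U)) a j +
      if i = j then x.frame.evenDeriv (x.chartPartial a) m else 0 := by
  have heven : x.frame.evenDeriv (x.chartPartial a) (x.even j) =
      (1 : Matrix (Fin p) (Fin p) (M.Sec U)) a j := by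
    change x.frame.evenDeriv _ (x.frame.incl (chartCoord x.chart x.chart_mem x.source_eq j)) = _
    rw [GrassmannFrame.evenDeriv_incl, chartDerivation_apply, chartDeriv_chartCoord_self,
      apply_ite x.frame.incl, map_one, map_zero, Matrix.one_apply]
  rw [jacEvenEven, Matrix.of_apply, shift_even, derivEven_eq, map_add, heven, apply_ite
    (x.frame.evenDeriv _), map_zero]

theorem leibnizDet_jacEvenEven_shift : leibnizDet (jacEvenEven (x.shift i m hm hm₀) x) =
    1 + x.frame.evenDeriv (x.chartPartial i) m := by
  rw [leibnizDet_of_forall_ne_column i fun a j hj => by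
    rw [jacEvenEven_shift_apply, if_neg hj.symm, add_zero], jacEvenEven_shift_apply, if_pos rfl,
    Matrix.one_apply_eq]

theorem derivEven_shift_odd :
    (Matrix.of fun a b => x.derivEven a ((x.shift i m hm hm₀).odd b)) = 0 := by
  ext a b
  rw [Matrix.of_apply, shift_odd, derivEven_eq, ← frame_gen, GrassmannFrame.evenDeriv_gen]
  rfl

theorem derivOdd_shift_odd :
    (Matrix.of fun a b => x.derivOdd a ((x.shift i m hm hm₀).odd b)) = 1 := by
  ext a b
  rw [Matrix.of_apply, shift_odd, derivOdd_eq, ← frame_gen, GrassmannFrame.oddDeriv_gen,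
    Matrix.one_apply]
  simp only [eq_comm]

theorem absBer_shift :
    (x.shift i m hm hm₀).absBer x = 1 + x.frame.evenDeriv (x.chartPartial i) m := by
  have hsign : smoothSign (M.body U (leibnizDet (jacEvenEven (x.shift i m hm hm₀) x))) = 1 := by
    rw [leibnizDet_jacEvenEven_shift, map_add, map_one, body_evenDeriv, hm₀, map_zero, add_zero,
      smoothSign_one]
  rw [absBer, ber, berezinian, derivEven_shift_odd, derivOdd_shift_odd, Matrix.zero_mul,
    Matrix.zero_mul, sub_zero, Ring.inverse_one, leibnizDet_one, mul_one, hsign, map_one, one_mul,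
    leibnizDet_jacEvenEven_shift]

theorem sum_divPow_expansion_mul_pow (c : Finset (Fin q) → Smooth p U) :
    ∑ n ∈ Finset.range (q + 2), divPow (x.derivEvenLinear i) n (x.frame.expansion c) * m ^ n =
      (x.shift i m hm hm₀).frame.expansion c := by
  have hcomm (n : ℕ) (a : M.Sec U) : a * m ^ n = m ^ n * a :=
    (Commute.pow_left (even_mul_comm hm a) n).symm
  simp only [divPow_derivEvenLinear_expansion]
  simp only [GrassmannFrame.expansion_apply, Finset.sum_mul]
  rw [Finset.sum_comm]
  refine Finset.sum_congr rfl fun ν _ => ?_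
  rw [shift_incl, frame_monomial, frame_monomial, shift_monomial, Finset.sum_mul]
  exact Finset.sum_congr rfl fun n _ => by rw [mul_assoc, hcomm, mul_assoc]

theorem exists_topCoeff_eq_add_chartDeriv (β : M.BerezinDensity) {K : Set M₀} (hK : IsClosed K)
    (hβ : ∀ ν, (x.shift i m hm hm₀).frame.coeff ν (β.val U (x.shift i m hm hm₀)) ∈
      vanishingIdeal p U K) :
    ∃ h ∈ vanishingIdeal p U K, β.topCoeff x = β.topCoeff (x.shift i m hm hm₀) +
      chartDeriv x.chart x.chart_mem x.source_eq i h := by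
  let y := x.shift i m hm hm₀
  let D := x.derivEvenLinear i
  let g (ν : Finset (Fin q)) : Smooth p U := y.frame.coeff ν (β.val U y)
  let G : M.Sec U := x.frame.expansion g
  let H : M.Sec U :=
    ∑ n ∈ Finset.range (q + 2), ((n + 1 : ℕ) : ℝ)⁻¹ • (divPow D n G * m ^ (n + 1))
  have hG (ν : Finset (Fin q)) : x.frame.coeff ν G = g ν := x.frame.coeff_sum g ν
  have hval : β.val U x = G + D H := by
    have hy : ∑ n ∈ Finset.range (q + 2), divPow D n G * m ^ n = β.val U y :=
      (x.sum_divPow_expansion_mul_pow i m hm hm₀ g).trans (y.frame.sum_coeff _)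
    have hpow : m ^ (q + 2) = 0 :=
      pow_eq_zero_of_body_eq_zero x.toSplitting le_rfl hm₀ (by omega)
    have htaylor := sum_divPow_mul_pow_mul_one_add (D := D) (x.frame.evenDeriv_mul _)
      (even_mul_comm hm) hpow G
    rw [hy] at htaylor
    rw [β.change y x, x.absBer_shift]
    exact htaylor
  refine ⟨x.frame.coeff Finset.univ H, ?_, ?_⟩
  · rw [map_sum]
    refine sum_mem fun n _ => ?_
    rw [x.frame.coeff_smul x.frame_incl_algebraMap]
    refine Submodule.smul_of_tower_mem _ _ (x.frame.coeff_mul_mem _ (fun ν => ?_) _ _)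
    rw [coeff_divPow_derivEvenLinear, hG]
    exact x.divPow_chartPartial_mem_vanishingIdeal i hK (hβ ν) n
  · rw [BerezinDensity.topCoeff, BerezinDensity.topCoeff, ← frame_coeff, ← frame_coeff, hval,
      map_add, hG]
    exact congrArg _ (x.frame.coeff_evenDeriv _ H Finset.univ)

end CoordSystem

end Supermanifold

end ShiftLaw

/-! ### Coordinate systems are determined by their coordinates -/

section Uniqueness

variable {p q : ℕ} {M₀ : Type u} [TopologicalSpace M₀] [ChartedSpace (Model p) M₀]

-- Hadamard's lemma expands `g` to first order in the coordinates around each point.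
theorem derivation_eq_zero_of_chartCoord {U : Opens M₀} {e : OpenPartialHomeomorph M₀ (Model p)}
    (he : e ∈ charts p M₀) (hU : e.source = U)
    (δ : ∀ V : Opens M₀, V ≤ U → Derivation ℝ (Smooth p V) (Smooth p V))
    (hδ : ∀ {V W : Opens M₀} (hW : W ≤ U) (h : V ≤ W) (f : Smooth p W),
      δ V (h.trans hW) (smoothRes h f) = smoothRes h (δ W hW f))
    (hcoord : ∀ j, δ U le_rfl (chartCoord e he hU j) = 0) {W : Opens M₀} (hW : W ≤ U) :
    δ W hW = 0 := by
  ext g a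
  obtain ⟨V, hVW, haV, h, -, hg⟩ := exists_eq_add_sum_mul g e he a (hU ▸ hW a.2)
  have hV : V ≤ U := hVW.trans hW
  let u (i : Fin p) : Smooth p V :=
    smoothRes hV (chartCoord e he hU i) - algebraMap ℝ (Smooth p V) (e a i)
  have hu (i : Fin p) : δ V hV (u i) = 0 := by
    rw [map_sub, hδ le_rfl hV, hcoord, map_zero, Derivation.map_algebraMap, sub_zero]
  have hu₀ (i : Fin p) : u i ⟨a, haV⟩ = 0 := sub_self (e a i)
  have hadamard : smoothRes hVW g = algebraMap ℝ _ (g a) + ∑ i, u i * h i := by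
    ext y
    change _ = evalAt y (algebraMap ℝ _ (g a) + ∑ i, u i * h i)
    rw [smoothRes_apply, hg y (hVW y.2) y.2, map_add, map_sum]
    rfl
  calc δ W hW g a = evalAt (⟨a, haV⟩ : V) (δ V hV (smoothRes hVW g)) := by
        rw [hδ hW hVW]
        rfl
    _ = ∑ i, u i ⟨a, haV⟩ * δ V hV (h i) ⟨a, haV⟩ := by
        rw [hadamard, map_add, Derivation.map_algebraMap, zero_add, map_sum, map_sum]
        refine Finset.sum_congr rfl fun i _ => ?_
        rw [Derivation.leibniz, hu, smul_zero, add_zero, smul_eq_mul, map_mul]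
        rfl
    _ = 0 := Finset.sum_eq_zero fun i _ => by rw [hu₀, zero_mul]

theorem Splitting.coeff_frame_res {𝒪 : SuperalgebraSheaf M₀} {U : Opens M₀}
    (σ : Splitting (p := p) q 𝒪 U) {V W : Opens M₀} (hW : W ≤ U) (h : V ≤ W)
    (ν : Finset (Fin q)) (a : 𝒪.Sec W) : (σ.frame V (h.trans hW)).coeff ν (𝒪.res h a) =
      smoothRes h ((σ.frame W hW).coeff ν a) :=
  (σ.frame W hW).coeff_map (σ.frame V (h.trans hW)) (φ := (𝒪.res h).toRingHom)
    (ψ := (smoothRes (p := p) h).toRingHom) (fun c => σ.res_pullback hW h c)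
    (fun j => 𝒪.res_res hW h (σ.odd j)) ν a

namespace Supermanifold

variable {M : Supermanifold p q M₀} {U : Opens M₀}

namespace CoordSystem

-- The leading term of the difference of the two pullbacks is a derivation.
theorem pullback_sub_mem_filtration (x : M.CoordSystem U) (γ : M.Retraction)
    (hx : ∀ j, γ.pullback U (chartCoord x.chart x.chart_mem x.source_eq j) = x.even j) (k : ℕ)
    {W : Opens M₀} (hW : W ≤ U) (g : Smooth p W) :
    γ.pullback W g - x.pullback W hW g ∈ (x.toSplitting.frame W hW).filtration (k + 1) := by
  induction k generalizing W with
  | zero =>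
    rw [zero_add, M.mem_filtration_one_iff, map_sub, γ.body_pullback, M.body_pullback, sub_self]
  | succ k ih =>
    intro ν hν
    let δ (V : Opens M₀) (hV : V ≤ U) : Derivation ℝ (Smooth p V) (Smooth p V) :=
      (x.toSplitting.frame V hV).coeffSubDerivation (x.toSplitting.frame_incl_algebraMap V hV)
        (γ.pullback V) (x.pullback V hV)
        (fun c => (x.toSplitting.frame_incl V hV c).symm) k (ih hV) ν (by omega)
    refine DFunLike.congr_fun
      (derivation_eq_zero_of_chartCoord x.chart_mem x.source_eq δ (fun {V W'} hW' h f => ?_)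
        (fun j => ?_) hW) g
    · simp only [δ, GrassmannFrame.coeffSubDerivation_apply]
      rw [← γ.res_pullback, ← x.res_pullback hW', ← map_sub, Splitting.coeff_frame_res]
    · simp only [δ, GrassmannFrame.coeffSubDerivation_apply]
      rw [hx, even, sub_self, map_zero]

theorem isAdapted_of_even_eq (x : M.CoordSystem U) (γ : M.Retraction)
    (hx : ∀ j, γ.pullback U (chartCoord x.chart x.chart_mem x.source_eq j) = x.even j) :
    x.IsAdapted γ := fun W hW => AlgHom.ext fun g =>
  (sub_eq_zero.1 ((x.toSplitting.frame W hW).eq_zero_of_mem_filtration q.lt_succ_self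
    (x.pullback_sub_mem_filtration γ hx q hW g))).symm

end CoordSystem

end Supermanifold

end Uniqueness

/-! ### Independence of the retraction in a coordinate neighbourhood -/

section LocalIndependence

variable {p q : ℕ} {M₀ : Type u} [TopologicalSpace M₀] [ChartedSpace (Model p) M₀]

theorem integrableOn_inChart {U : Opens M₀} {e : OpenPartialHomeomorph M₀ (Model p)}
    (he : e ∈ charts p M₀) (hU : e.source = U) {K : Set M₀} (hK : IsCompact K) (hKU : K ⊆ U)
    {f : Smooth p U} (hf : f ∈ vanishingIdeal p U K) :
    IntegrableOn (inChart e f) e.target volume := by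
  have hKe : K ⊆ e.source := hU ▸ hKU
  refine IntegrableOn.of_forall_sdiff_eq_zero
    (((inChart_contDiffOn e he hU f).continuousOn.mono
      (e.mapsTo.mono_left hKe).image_subset).integrableOn_compact
        (hK.image_of_continuousOn (e.continuousOn.mono hKe)))
    e.open_target.measurableSet fun y hy => ?_
  rw [inChart_of_mem e f (symm_mem_of_mem_target hU hy.1)]
  exact hf _ fun hyK => hy.2 ⟨_, hyK, e.right_inv hy.1⟩

namespace Supermanifold

variable {M : Supermanifold p q M₀} {U : Opens M₀}

/-- All coefficients of the Berezin density `β` in all coordinate systems vanish outside of `K`. -/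
def BerezinDensity.VanishesOff (β : M.BerezinDensity) (K : Set M₀) : Prop :=
  ∀ (U : Opens M₀) (x : M.CoordSystem U) (ν : Finset (Fin q)),
    x.frame.coeff ν (β.val U x) ∈ vanishingIdeal p U K

theorem BerezinDensity.VanishesOff.topCoeff_mem {β : M.BerezinDensity} {K : Set M₀}
    (hβ : β.VanishesOff K) (x : M.CoordSystem U) : β.topCoeff x ∈ vanishingIdeal p U K := by
  rw [BerezinDensity.topCoeff, ← x.frame_coeff]
  exact hβ U x Finset.univ

namespace CoordSystem

/-- The Berezin integral `∫ f_{(1,…,1)} |du₀|` of `β|_U = f |Dx|` in the coordinate system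
`x = (u, ξ)`. -/
def berezinIntegral (x : M.CoordSystem U) (β : M.BerezinDensity) : ℝ :=
  ∫ y in x.chart.target, inChart x.chart (β.topCoeff x) y

section

variable [T2Space M₀] {β : M.BerezinDensity} {K : Set M₀} (hK : IsCompact K) (hKU : K ⊆ U)
  (hβ : β.VanishesOff K)
include hK hKU hβ

theorem berezinIntegral_shift (x : M.CoordSystem U) (i : Fin p) (m : M.Sec U)
    (hm : m ∈ M.parity U 0) (hm₀ : M.body U m = 0) :
    (x.shift i m hm hm₀).berezinIntegral β = x.berezinIntegral β := by
  obtain ⟨h, hh, htop⟩ :=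
    x.exists_topCoeff_eq_add_chartDeriv i m hm hm₀ β hK.isClosed (hβ U _)
  have hadd := integral_add
    (integrableOn_inChart x.chart_mem x.source_eq hK hKU
      (hβ.topCoeff_mem (x.shift i m hm hm₀)))
    (integrableOn_inChart x.chart_mem x.source_eq hK hKU
      (chartDeriv_mem_vanishingIdeal x.chart_mem x.source_eq i hK.isClosed hh))
  rw [integral_chartDeriv_eq_zero x.chart_mem x.source_eq i h hK hKU hh, add_zero] at hadd
  rw [berezinIntegral, berezinIntegral, htop, inChart_add]
  exact hadd.symm

theorem exists_even_eq_berezinIntegral_eq (x : M.CoordSystem U) (γ : M.Retraction) (i : Fin p) :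
    ∃ y : M.CoordSystem U, y.chart = x.chart ∧
      y.even i = γ.pullback U (chartCoord x.chart x.chart_mem x.source_eq i) ∧
      (∀ j ≠ i, y.even j = x.even j) ∧ y.berezinIntegral β = x.berezinIntegral β := by
  let m : M.Sec U := γ.pullback U (chartCoord x.chart x.chart_mem x.source_eq i) - x.even i
  have hm : m ∈ M.parity U 0 := sub_mem (γ.pullback_even U _) (x.pullback_even U le_rfl _)
  have hm₀ : M.body U m = 0 := by
    rw [map_sub, γ.body_pullback, even, M.body_pullback, sub_self]
  refine ⟨x.shift i m hm hm₀, rfl, ?_, fun j hj => ?_,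
    berezinIntegral_shift hK hKU hβ x i m hm hm₀⟩
  · rw [shift_even, if_pos rfl, add_sub_cancel]
  · rw [shift_even, if_neg hj.symm, add_zero]

theorem exists_isAdapted_berezinIntegral_eq (x : M.CoordSystem U) (γ : M.Retraction) :
    ∃ y : M.CoordSystem U, y.IsAdapted γ ∧ y.berezinIntegral β = x.berezinIntegral β := by
  have hshift (k : ℕ) (hk : k ≤ p) : ∃ y : M.CoordSystem U,
      (∀ j : Fin p, (j : ℕ) < k →
        γ.pullback U (chartCoord y.chart y.chart_mem y.source_eq j) = y.even j) ∧
      y.berezinIntegral β = x.berezinIntegral β := by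
    induction k with
    | zero => exact ⟨x, fun j hj => absurd hj j.val.not_lt_zero, rfl⟩
    | succ k ih =>
      obtain ⟨y, hy, hyx⟩ := ih (Nat.le_of_succ_le hk)
      obtain ⟨z, hchart, hz, hzy, hint⟩ :=
        exists_even_eq_berezinIntegral_eq hK hKU hβ y γ ⟨k, hk⟩
      refine ⟨z, fun j hj => ?_, hint.trans hyx⟩
      simp only [hchart]
      by_cases hjk : j = ⟨k, hk⟩
      · rw [hjk, hz]
      · rw [hzy j hjk]
        exact hy j (lt_of_le_of_ne (Nat.lt_succ_iff.1 hj) fun h => hjk (Fin.ext h))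
  obtain ⟨y, hy, hyx⟩ := hshift p le_rfl
  exact ⟨y, y.isAdapted_of_even_eq γ fun j => hy j j.2, hyx⟩

end

end CoordSystem

namespace BerezinDensity

variable {β : M.BerezinDensity} {K : Set M₀} {s : ℕ → ℕ → ℕ} {γ : M.Retraction} {ρ : Density p M₀}

theorem VanishesOff.density (hβ : β.VanishesOff K) (hρ : β.IsFibreIntegral s γ ρ) :
    ρ.VanishesOff K := by
  intro e he o ho hoK
  obtain ⟨V, x, hoV, hx, -, -⟩ := γ.exists_isAdapted he ho
  rw [hρ.val_eq hx he ho hoV, hβ.topCoeff_mem x ⟨o, hoV⟩ hoK, mul_zero, zero_mul]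

theorem IsFibreIntegral.setIntegral_reading (hρ : β.IsFibreIntegral s γ ρ) {x : M.CoordSystem U}
    (hx : x.IsAdapted γ) : ∫ z in x.chart.target, ρ.reading x.chart z =
      (-1) ^ s p q * x.berezinIntegral β := by
  rw [CoordSystem.berezinIntegral, ← integral_const_mul]
  refine setIntegral_congr_fun x.chart.open_target.measurableSet fun z hz => ?_
  have hzU := symm_mem_of_mem_target x.source_eq hz
  simp only [inChart_of_mem _ _ hzU]
  exact hρ U x hx ⟨_, hzU⟩

theorem VanishesOff.hasIntegral [T2Space M₀] (hβ : β.VanishesOff K) (hK : IsCompact K)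
    (hKU : K ⊆ U) (x : M.CoordSystem U) (hρ : β.IsFibreIntegral s γ ρ) :
    ρ.HasIntegral ((-1) ^ s p q * x.berezinIntegral β) := by
  obtain ⟨y, hy, hyx⟩ := x.exists_isAdapted_berezinIntegral_eq hK hKU hβ γ
  rw [← hyx, ← hρ.setIntegral_reading hy]
  exact (hβ.density hρ).hasIntegral y.chart_mem hK (y.source_eq ▸ hKU)

end BerezinDensity

end Supermanifold

end LocalIndependence

/-! ### Globalization -/

section PartitionOfUnity

open scoped Topology

theorem exists_finset_eventually_sum_eq_one {ι X : Type*} [TopologicalSpace X]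
    (f : PartitionOfUnity ι X) {K : Set X} (hK : IsCompact K) :
    ∃ t : Finset ι, ∀ᶠ x in 𝓝ˢ K, ∑ i ∈ t, f i x = 1 := by
  have hfinite := f.locallyFinite.closure.finite_nonempty_inter_compact hK
  refine ⟨hfinite.toFinset, eventually_nhdsSet_iff_forall.2 fun x hx => ?_⟩
  filter_upwards [f.eventually_finsupport_subset x] with y hy
  have hsupport : Function.support (fun i => f i y) ⊆ hfinite.toFinset := by
    intro i hi
    have hix := hy ((f.mem_finsupport y).2 hi)
    exact hfinite.mem_toFinset.2 ⟨x, (f.mem_fintsupport_iff x i).1 hix, hx⟩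
  rw [← finsum_eq_sum_of_support_subset _ hsupport]
  exact f.sum_eq_one (Set.mem_univ y)

theorem exists_smooth_partition {p : ℕ} {M₀ : Type u} [TopologicalSpace M₀] [T2Space M₀]
    [SecondCountableTopology M₀] [ChartedSpace (Model p) M₀] [IsManifold (𝓡 p) ∞ M₀] {K : Set M₀}
    (hK : IsCompact K) {ι : Type*} (V : ι → Opens M₀) (hV : ∀ o, ∃ i, o ∈ V i) :
    ∃ (t : Finset ι) (φ : ι → Smooth p (⊤ : Opens M₀)) (N : Opens M₀),
      (∀ i, ∃ C : Set M₀, IsClosed C ∧ C ⊆ V i ∧ φ i ∈ vanishingIdeal p ⊤ C) ∧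
      K ⊆ N ∧ ∀ o : (⊤ : Opens M₀), (o : M₀) ∈ N → (∑ i ∈ t, φ i) o = 1 := by
  have : LocallyCompactSpace M₀ := ChartedSpace.locallyCompactSpace (Model p) M₀
  obtain ⟨f, hf⟩ := SmoothPartitionOfUnity.exists_isSubordinate (𝓡 p) (isClosed_univ (X := M₀))
    (fun i => (V i : Set M₀)) (fun i => (V i).isOpen) fun o _ => Set.mem_iUnion.2 (hV o)
  obtain ⟨t, ht⟩ := exists_finset_eventually_sum_eq_one f.toPartitionOfUnity hK
  obtain ⟨N, hN, hKN, hsum⟩ := eventually_nhdsSet_iff_exists.1 ht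
  refine ⟨t, fun i => toSmooth (fun o => f i o) ((f i).contMDiff.comp contMDiff_subtype_val),
    ⟨N, hN⟩, fun i => ⟨tsupport (f i), isClosed_closure, hf i, fun o ho => ?_⟩, hKN,
    fun o ho => ?_⟩
  · exact image_eq_zero_of_notMem_tsupport (f := f i) ho
  · rw [← evalAt_apply, map_sum]
    exact hsum o ho

end PartitionOfUnity

section Globalization

variable {p q : ℕ} {M₀ : Type u} [TopologicalSpace M₀] [ChartedSpace (Model p) M₀]

namespace Supermanifold

variable {M : Supermanifold p q M₀} {U : Opens M₀}

namespace CoordSystem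

theorem coeff_apply_eq_zero_of_res (x : M.CoordSystem U) {W : Opens M₀} (h : W ≤ U)
    {f : M.Sec U} (hf : M.res h f = 0) (ν : Finset (Fin q)) (o : U) (ho : (o : M₀) ∈ W) :
    x.frame.coeff ν f o = 0 := by
  have hrestrict := x.coeff_restrict W h f ν
  rw [hf, ← frame_coeff, ← frame_coeff, map_zero] at hrestrict
  exact (congrArg (fun g : Smooth p W => g ⟨o, ho⟩) hrestrict).symm

theorem eq_of_res_eq (x : M.CoordSystem U) {f g : M.Sec U}
    (h : ∀ o ∈ U, ∃ (W : Opens M₀) (hW : W ≤ U), o ∈ W ∧ M.res hW f = M.res hW g) : f = g := by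
  refine x.frame.ext_coeff fun ν => ?_
  rw [← sub_eq_zero, ← map_sub]
  ext o
  obtain ⟨W, hW, ho, hfg⟩ := h o o.2
  exact x.coeff_apply_eq_zero_of_res hW (by rw [map_sub, hfg, sub_self]) ν o ho

end CoordSystem

namespace BerezinDensity

theorem exists_vanishesOn {β : M.BerezinDensity} {o : M₀} (ho : o ∉ β.support) :
    ∃ W : Opens M₀, o ∈ W ∧ β.VanishesOn W := by
  by_contra! h
  exact ho h

theorem VanishesOn.res_eq_zero {β : M.BerezinDensity} {W : Opens M₀} (hW : β.VanishesOn W)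
    (x : M.CoordSystem U) : M.res (inf_le_left : U ⊓ W ≤ U) (β.val U x) = 0 := by
  rw [← β.val_restrict]
  exact hW _ inf_le_right _

/-- The product of a Berezin density with a smooth function, pulled back along a retraction. It
serves to localize Berezin densities by partitions of unity. -/
def smulPullback (β : M.BerezinDensity) (γ : M.Retraction) (φ : Smooth p (⊤ : Opens M₀)) :
    M.BerezinDensity where
  val U x := γ.pullback U (smoothRes le_top φ) * β.val U x
  val_restrict h x := by
    rw [β.val_restrict, map_mul, γ.res_pullback]
    rfl
  change x y := by rw [β.change x y, mul_assoc]

variable (β : M.BerezinDensity) (γ : M.Retraction)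

theorem res_smulPullback_val (φ : Smooth p (⊤ : Opens M₀)) {W : Opens M₀} (h : W ≤ U)
    (x : M.CoordSystem U) : M.res h ((β.smulPullback γ φ).val U x) =
      γ.pullback W (smoothRes le_top φ) * M.res h (β.val U x) := by
  rw [smulPullback, map_mul, γ.res_pullback]
  rfl

theorem smulPullback_vanishesOff {φ : Smooth p (⊤ : Opens M₀)} {C : Set M₀} (hC : IsClosed C)
    (hφ : φ ∈ vanishingIdeal p ⊤ C) : (β.smulPullback γ φ).VanishesOff (C ∩ β.support) := by
  intro U x ν o ho
  by_cases hs : (o : M₀) ∈ β.support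
  · have hoC : (o : M₀) ∉ C := fun h => ho ⟨h, hs⟩
    let W : Opens M₀ := U ⊓ ⟨Cᶜ, hC.isOpen_compl⟩
    have hφW : (smoothRes le_top φ : Smooth p W) = 0 := by
      ext z
      exact hφ _ z.2.2
    refine x.coeff_apply_eq_zero_of_res (W := W) inf_le_left ?_ ν o ⟨o.2, hoC⟩
    rw [res_smulPullback_val, hφW, map_zero, zero_mul]
  · obtain ⟨W, hoW, hW⟩ := exists_vanishesOn hs
    refine x.coeff_apply_eq_zero_of_res inf_le_left ?_ ν o ⟨o.2, hoW⟩
    rw [res_smulPullback_val, hW.res_eq_zero, mul_zero]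

theorem smulPullback_val_of_eq_one {φ : Smooth p (⊤ : Opens M₀)} {N : Opens M₀}
    (hβN : β.support ⊆ N) (hφ : ∀ o : (⊤ : Opens M₀), (o : M₀) ∈ N → φ o = 1)
    (x : M.CoordSystem U) : (β.smulPullback γ φ).val U x = β.val U x := by
  refine x.eq_of_res_eq fun o ho => ?_
  by_cases hs : o ∈ β.support
  · refine ⟨U ⊓ N, inf_le_left, ⟨ho, hβN hs⟩, ?_⟩
    have hφN : (smoothRes le_top φ : Smooth p (U ⊓ N : Opens M₀)) = 1 := by
      ext z
      exact hφ _ z.2.2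
    rw [res_smulPullback_val, hφN, map_one, one_mul]
  · obtain ⟨W, hoW, hW⟩ := exists_vanishesOn hs
    refine ⟨U ⊓ W, inf_le_left, ⟨ho, hoW⟩, ?_⟩
    rw [res_smulPullback_val, hW.res_eq_zero, mul_zero]

theorem smulPullback_sum_val {ι : Type*} (t : Finset ι) (φ : ι → Smooth p (⊤ : Opens M₀))
    (x : M.CoordSystem U) : (β.smulPullback γ (∑ i ∈ t, φ i)).val U x =
      ∑ i ∈ t, (β.smulPullback γ (φ i)).val U x := by
  simp only [smulPullback, map_sum, Finset.sum_mul]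

variable {β}

theorem exists_forall_hasIntegral [T2Space M₀] [SecondCountableTopology M₀]
    [IsManifold (𝓡 p) ∞ M₀] (hβ : IsCompact β.support) (s : ℕ → ℕ → ℕ)
    (γ₀ : M.Retraction) : ∃ I : ℝ, ∀ (γ : M.Retraction) (ρ : Density p M₀),
      β.IsFibreIntegral s γ ρ → ρ.HasIntegral I := by
  choose V x hV _ _ _ using fun o : M₀ =>
    γ₀.exists_isAdapted (IsManifold.chart_mem_maximalAtlas (I := 𝓡 p) (n := ∞) o)
      (mem_chart_source (Model p) o)
  obtain ⟨t, φ, N, hφ, hβN, hsum⟩ :=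
    exists_smooth_partition (p := p) hβ V fun o => ⟨o, hV o⟩
  choose C hC hCV hφC using hφ
  refine ⟨∑ i ∈ t, (-1) ^ s p q * (x i).berezinIntegral (β.smulPullback γ₀ (φ i)),
    fun γ ρ hρ => ?_⟩
  have hτ (i : M₀) := (β.smulPullback γ₀ (φ i)).isFibreIntegral_fibreIntegral s γ
  refine Density.hasIntegral_of_eq_sum t (fun i _ => ?_) fun e he o ho =>
    hρ.val_eq_sum hτ (fun U y => ?_) he ho
  · exact (β.smulPullback_vanishesOff γ₀ (hC i) (hφC i)).hasIntegral (hβ.inter_left (hC i))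
      (Set.inter_subset_left.trans (hCV i)) (x i) (hτ i)
  · rw [← smulPullback_sum_val, β.smulPullback_val_of_eq_one γ₀ hβN hsum]

theorem isIntegrable_and_integral_eq [SecondCountableTopology M₀] [IsManifold (𝓡 p) ∞ M₀]
    {s : ℕ → ℕ → ℕ} {I : ℝ}
    (hI : ∀ ρ : Density p M₀, β.IsFibreIntegral s γ ρ → ρ.HasIntegral I) :
    β.IsIntegrable s γ ∧ β.integral s γ = I := by
  have hint : β.IsIntegrable s γ :=
    ⟨I, β.fibreIntegral s γ, β.isFibreIntegral_fibreIntegral s γ,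
      hI _ (β.isFibreIntegral_fibreIntegral s γ)⟩
  obtain ⟨ρ, hρ, hJ⟩ := hint.choose_spec
  refine ⟨hint, ?_⟩
  rw [integral, dif_pos hint]
  exact hJ.unique (hI ρ hρ)

end BerezinDensity

end Supermanifold

end Globalization

end Supergeometry

end

theorem mainTheorem8 {p q : ℕ} {M₀ : Type u} [TopologicalSpace M₀] [T2Space M₀]
    [SecondCountableTopology M₀] [ChartedSpace (Supergeometry.Model p) M₀]
    [IsManifold (𝓡 p) ∞ M₀] (M : Supergeometry.Supermanifold p q M₀)
    (s : ℕ → ℕ → ℕ) (γ γ' : M.Retraction) (β : M.BerezinDensity)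
    (hβ : IsCompact β.support) :
    β.IsIntegrable s γ ∧ β.IsIntegrable s γ' ∧ β.integral s γ = β.integral s γ' := by
  obtain ⟨I, hI⟩ := Supergeometry.Supermanifold.BerezinDensity.exists_forall_hasIntegral hβ s γ
  obtain ⟨hγ, hγI⟩ := β.isIntegrable_and_integral_eq γ (hI γ)
  obtain ⟨hγ', hγI'⟩ := β.isIntegrable_and_integral_eq γ' (hI γ')
  exact ⟨hγ, hγ', hγI.trans hγI'.symm⟩
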